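/- There is a single algorithm (a program for a random access machine with logarithmic cost) and there are a constant $c$ and polynomials $p,q$ such that the following holds. Let the input consist of a finite simple undirected graph $G$ with weight function $\mathrm{cost}\colon E(G)\to\mathbb{N}$ (weights, possibly zero, encoded in binary), a set of terminals $K\subseteq V(G)$, and a multiway cut $S\subseteq V(G)$ for $K$, that is, a vertex set, possibly containing terminals, such that each connected component of $G-S$ contains at most one terminal. Let $n$ denote the total binary length of this input. Then the algorithm halts and outputs a minimum-weight Steiner tree for $K$ in $G$, that is, a nonempty tree $T\subseteq G$ with $K\subseteq V(T)$ for which $\sum_{e\in E(T)}\mathrm{cost}(e)$ is minimum among all connected subgraphs of $G$ containing $K$; if no Steiner tree for $K$ exists, it reports this. It runs in time at most $2^{c\,|S|\log_2|S|}\cdot p(n)$ (with $0\log_2 0=0$), i.e. in time $2^{\mathcal{O}(|S|\log|S|)}\mathrm{poly}(n)$, and uses space at most $q(n)$. -/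

import Mathlib

/-! ## Random access machines with logarithmic cost

A program has natural-number registers `0, 1, 2, …` that it addresses directly and a memory
of natural-number cells `0, 1, 2, …` that it addresses through registers. Each operation is charged
for the binary lengths of the numbers, and of the memory addresses, that it handles.
The space in use is the binary length of all nonzero registers and cells, with their addresses. -/

namespace LogRAM

/-- Contents of the registers and of the memory; all but finitely many are zero. -/
structure State where
  reg : ℕ →₀ ℕ
  mem : ℕ →₀ ℕ

namespace State

noncomputable def setReg (s : State) (x v : ℕ) : State := ⟨s.reg.update x v, s.mem⟩

noncomputable def setMem (s : State) (a v : ℕ) : State := ⟨s.reg, s.mem.update a v⟩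

/-- Number of bits held by a state: every nonzero register or cell contributes the binary lengths
of its address and of its contents. -/
def size (s : State) : ℕ :=
  (s.reg.sum fun a v => Nat.size a + Nat.size v) + (s.mem.sum fun a v => Nat.size a + Nat.size v)

end State

/-- Instructions; `x`, `y`, `z` are names of registers. -/
inductive Instr where
  /-- `x := n` -/
  | const (x n : ℕ)
  /-- `x := y` -/
  | copy (x y : ℕ)
  /-- `x := y + z` -/
  | add (x y z : ℕ)
  /-- `x := max (y - z) 0` -/
  | sub (x y z : ℕ)
  /-- `x := y * z` -/
  | mul (x y z : ℕ)
  /-- `x := ⌊y / z⌋`, and `x := 0` if `z = 0` -/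
  | div (x y z : ℕ)
  /-- `x := mem[y]` -/
  | load (x y : ℕ)
  /-- `mem[x] := y` -/
  | store (x y : ℕ)

namespace Instr

noncomputable def run : Instr → State → State
  | const x n, s => s.setReg x n
  | copy x y, s => s.setReg x (s.reg y)
  | add x y z, s => s.setReg x (s.reg y + s.reg z)
  | sub x y z, s => s.setReg x (s.reg y - s.reg z)
  | mul x y z, s => s.setReg x (s.reg y * s.reg z)
  | div x y z, s => s.setReg x (s.reg y / s.reg z)
  | load x y, s => s.setReg x (s.mem (s.reg y))
  | store x y, s => s.setMem (s.reg x) (s.reg y)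

/-- Logarithmic cost of executing an instruction in a given state. -/
def cost : Instr → State → ℕ
  | const _ n, _ => 1 + Nat.size n
  | copy _ y, s => 1 + Nat.size (s.reg y)
  | add _ y z, s => 1 + Nat.size (s.reg y) + Nat.size (s.reg z)
  | sub _ y z, s => 1 + Nat.size (s.reg y) + Nat.size (s.reg z)
  | mul _ y z, s => 1 + Nat.size (s.reg y) + Nat.size (s.reg z)
  | div _ y z, s => 1 + Nat.size (s.reg y) + Nat.size (s.reg z)
  | load _ y, s => 1 + Nat.size (s.reg y) + Nat.size (s.mem (s.reg y))
  | store x y, s => 1 + Nat.size (s.reg x) + Nat.size (s.reg y)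

end Instr

/-- Programs, with structured control flow. -/
inductive Prog where
  | skip
  | instr (i : Instr)
  | seq (P Q : Prog)
  /-- if register `x` is nonzero then `P` else `Q` -/
  | ite (x : ℕ) (P Q : Prog)
  /-- while register `x` is nonzero do `P` -/
  | loop (x : ℕ) (P : Prog)

/-- `Exec P s s' t m`: started in state `s`, the program `P` halts in state `s'`, after running for
total time `t`, and `m` is the largest size of a state during the run. -/
inductive Exec : Prog → State → State → ℕ → ℕ → Prop where
  | skip (s : State) : Exec Prog.skip s s 1 s.size
  | instr (i : Instr) (s : State) :
      Exec (Prog.instr i) s (i.run s) (i.cost s) (max s.size (i.run s).size)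
  | seq {P Q : Prog} {s₁ s₂ s₃ : State} {t₁ t₂ m₁ m₂ : ℕ}
      (hP : Exec P s₁ s₂ t₁ m₁) (hQ : Exec Q s₂ s₃ t₂ m₂) :
      Exec (Prog.seq P Q) s₁ s₃ (t₁ + t₂) (max m₁ m₂)
  | ite_true {x : ℕ} {P Q : Prog} {s s' : State} {t m : ℕ}
      (hx : s.reg x ≠ 0) (hP : Exec P s s' t m) :
      Exec (Prog.ite x P Q) s s' (1 + Nat.size (s.reg x) + t) m
  | ite_false {x : ℕ} {P Q : Prog} {s s' : State} {t m : ℕ}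
      (hx : s.reg x = 0) (hQ : Exec Q s s' t m) :
      Exec (Prog.ite x P Q) s s' (1 + Nat.size (s.reg x) + t) m
  | loop_true {x : ℕ} {P : Prog} {s₁ s₂ s₃ : State} {t₁ t₂ m₁ m₂ : ℕ}
      (hx : s₁.reg x ≠ 0) (hP : Exec P s₁ s₂ t₁ m₁) (hL : Exec (Prog.loop x P) s₂ s₃ t₂ m₂) :
      Exec (Prog.loop x P) s₁ s₃ (1 + Nat.size (s₁.reg x) + t₁ + t₂) (max m₁ m₂)
  | loop_false {x : ℕ} {P : Prog} {s : State} (hx : s.reg x = 0) :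
      Exec (Prog.loop x P) s s (1 + Nat.size (s.reg x)) s.size

/-- The initial state on input `w`: the entries of `w` are in cells `0, 1, …, w.length - 1`, and all
other cells and all registers are zero. -/
noncomputable def start (w : List ℕ) : State := ⟨0, w.toFinsupp⟩

/-- The final state `s` presents the output `w`: it is in the memory cells from cell `0` on. -/
def Outputs (s : State) (w : List ℕ) : Prop := ∀ (i : ℕ) (h : i < w.length), s.mem i = w[i]

/-- Binary length of an input, with one separator for each number. -/
def inputSize (w : List ℕ) : ℕ := (w.map fun a => Nat.size a + 1).sum

end LogRAM

/-! ## Steiner trees and multiway cuts -/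

/-- `S` is a (node) multiway cut for the terminals `K`: each connected component of `G - S` contains
at most one terminal. The set `S` may itself contain terminals. -/
def IsMultiwayCut {V : Type*} (G : SimpleGraph V) (K S : Finset V) : Prop :=
  ∀ C : (G.induce {v | v ∉ S}).ConnectedComponent, {v | v ∈ C.supp ∧ v.1 ∈ K}.Subsingleton

/-- A Steiner tree for `K` in `G` is a subgraph of `G` that is a (nonempty) tree and contains every
terminal. -/
def IsSteinerTree {V : Type*} (G : SimpleGraph V) (K : Finset V) (T : G.Subgraph) : Prop :=
  T.coe.IsTree ∧ ∀ v ∈ K, v ∈ T.verts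

open Classical in
/-- Total weight of the edges of a subgraph. -/
noncomputable def subgraphWeight {V : Type*} [Fintype V] {G : SimpleGraph V}
    (cost : G.edgeSet → ℕ) (H : G.Subgraph) : ℕ :=
  ∑ e : H.edgeSet, cost ⟨e.1, H.edgeSet_subset e.2⟩

/-- A minimum-weight Steiner tree: no connected subgraph containing all the terminals (in
particular no Steiner tree) has smaller weight. -/
def IsMinSteinerTree {V : Type*} [Fintype V] (G : SimpleGraph V) (cost : G.edgeSet → ℕ)
    (K : Finset V) (T : G.Subgraph) : Prop :=
  IsSteinerTree G K T ∧
    ∀ H : G.Subgraph, H.Connected → (∀ v ∈ K, v ∈ H.verts) →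
      subgraphWeight cost T ≤ subgraphWeight cost H

/-! ## Input and output formats -/

open Classical in
/-- The characteristic vector of a set of vertices. -/
noncomputable def encodeSet {n : ℕ} (X : Set (Fin n)) : List ℕ :=
  (List.finRange n).map fun v => if v ∈ X then 1 else 0

open Classical in
/-- An instance as a list of numbers: the number of vertices; the weighted adjacency matrix row by
row, with entry `0` for a non-edge and `c + 1` for an edge of weight `c`; the characteristic vectors
of the terminal set and of the multiway cut. -/
noncomputable def encodeInstance {n : ℕ} (G : SimpleGraph (Fin n)) (cost : G.edgeSet → ℕ)
    (K S : Finset (Fin n)) : List ℕ :=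
  [n] ++
  ((List.finRange n).flatMap fun u => (List.finRange n).map fun v =>
    if h : G.Adj u v then cost ⟨s(u, v), h⟩ + 1 else 0) ++
  encodeSet (K : Set (Fin n)) ++ encodeSet (S : Set (Fin n))

open Classical in
/-- A subgraph as an answer: the number `1`, the characteristic vector of the vertex set, and the
adjacency matrix row by row. -/
noncomputable def encodeSubgraph {n : ℕ} {G : SimpleGraph (Fin n)} (T : G.Subgraph) : List ℕ :=
  [1] ++ encodeSet T.verts ++
  ((List.finRange n).flatMap fun u => (List.finRange n).map fun v => if T.Adj u v then 1 else 0)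

/-- A final state is a correct answer: it presents a minimum-weight Steiner tree, or the number `0` if
there is no Steiner tree. -/
def IsCorrectAnswer {n : ℕ} (G : SimpleGraph (Fin n)) (cost : G.edgeSet → ℕ) (K : Finset (Fin n))
    (s : LogRAM.State) : Prop :=
  (∃ T : G.Subgraph, IsMinSteinerTree G cost K T ∧ LogRAM.Outputs s (encodeSubgraph T)) ∨
  ((¬ ∃ T : G.Subgraph, IsSteinerTree G K T) ∧ LogRAM.Outputs s [0])

/-! If at least two terminals must be joined, every Steiner tree contains a vertex of `S`: otherwise
it would lie in one component of `G - S`, which has at most one terminal. Split the tree at its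
vertices of `S`. Each piece meets at most one component of `G - S`, so it carries at most one
terminal outside `S`. A piece that touches `S` in a single vertex serves at most to attach one
terminal, and a shortest path to the nearest vertex of `S` in the tree does this at no greater
weight. Every other piece is a small Steiner tree on some vertices of `S` and at most one further
terminal.

These pieces are built from slots, one for each vertex of `S`. The partial tree of a slot is stored
as the function that gives its weight when extended to each vertex, initially the distances `D`.
Slots outside the tree are dropped. A piece arises by merging slots one after the other, through a
meeting vertex of minimum total weight, and by then completing the surviving slot, which becomes
fresh again. Each merge uses up a slot and each completed piece needs a merge, so at most `2 * |S|`
operations are needed (`TreeIn.mergeable`, `TreeIn.decompose`, `TreeIn.exists_guess`).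

Naming the terminal of a piece directly would cost a factor up to `n` per piece. But completing a
piece leads to the same state whichever terminal it carries, and choosing `t` instead of attaching
it separately changes the weight by `h t - d t`. An exchange argument therefore allows only the
`|S|` terminals with the smallest differences, named by their rank (`Core.exists_rankBound`). An
operation now takes three digits in base `|S| + 3`, and there are `(|S| + 3) ^ (6 * |S|)` guesses to
try.

Conversely every number decodes to permissible operations, and the value of a guess either reaches
the bound `B`, which plays the role of infinity, or is an upper bound for the weight of a connected
subgraph containing `K` (`Guess.Sound.app`, `Guess.Sound.value`). Hence the minimum over all
guesses, `treeWeight`, is the optimum (`treeWeight_sound`, `treeWeight_le`). A tree is found by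
self-reduction: each edge is deleted in turn if the optimum stays the same, and the edges that
remain at the end are exactly those of an optimal tree (`not_connects_prune`, `answerGraph_isTree`).

The algorithm is written in a small language of assignments to square arrays and loops.
`Expr.runs_comp` and `Cmd.runs_comp` compile it for the machine once and for all; stored values are
capped, so that numbers keep polynomial length however long the loops run. `steinerProg_correct`
puts everything together. -/

namespace LogRAM

/-! ### Executions within bounds on bits, registers and memory cells. -/

@[simp] theorem State.setReg_reg (s : State) (x v y : ℕ) :
    (s.setReg x v).reg y = if y = x then v else s.reg y := by
  classical
  simp [State.setReg, Finsupp.update_apply]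

@[simp] theorem State.setReg_mem (s : State) (x v : ℕ) : (s.setReg x v).mem = s.mem := rfl

@[simp] theorem State.setMem_reg (s : State) (x v : ℕ) : (s.setMem x v).reg = s.reg := rfl

@[simp] theorem State.setMem_mem (s : State) (x v y : ℕ) :
    (s.setMem x v).mem y = if y = x then v else s.mem y := by
  classical
  simp [State.setMem, Finsupp.update_apply]

/-- Bounds on the bit length of all numbers, the registers and the memory cells in use. -/
structure Limits where
  bits : ℕ
  regs : ℕ
  cells : ℕ

structure State.Within (L : Limits) (s : State) : Prop where
  reg_lt : ∀ i, s.reg i < 2 ^ L.bits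
  reg_zero : ∀ i, L.regs ≤ i → s.reg i = 0
  mem_lt : ∀ a, s.mem a < 2 ^ L.bits
  mem_zero : ∀ a, L.cells ≤ a → s.mem a = 0

/-- A bound on the size of the states within given limits. -/
def Limits.space (L : Limits) : ℕ :=
  L.regs * (L.regs + L.bits) + L.cells * (L.cells + L.bits)

theorem finsupp_size_le {f : ℕ →₀ ℕ} {b c : ℕ} (hlt : ∀ i, f i < 2 ^ b)
    (hz : ∀ i, c ≤ i → f i = 0) :
    (f.sum fun a v => Nat.size a + Nat.size v) ≤ c * (c + b) := by
  have hsub : f.support ⊆ Finset.range c := by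
    intro i hi
    rw [Finsupp.mem_support_iff] at hi
    rw [Finset.mem_range]
    by_contra h
    exact hi (hz i (not_lt.1 h))
  calc (f.sum fun a v => Nat.size a + Nat.size v)
      = ∑ a ∈ f.support, (Nat.size a + Nat.size (f a)) := rfl
    _ ≤ ∑ a ∈ Finset.range c, (Nat.size a + Nat.size (f a)) :=
        Finset.sum_le_sum_of_subset hsub
    _ ≤ ∑ _a ∈ Finset.range c, (c + b) := by
        refine Finset.sum_le_sum fun a ha => Nat.add_le_add ?_ (Nat.size_le.2 (hlt a))
        rw [Finset.mem_range] at ha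
        exact (Nat.size_le.2 a.lt_two_pow_self).trans ha.le
    _ = c * (c + b) := by simp

theorem State.Within.size_le {L : Limits} {s : State} (h : s.Within L) : s.size ≤ L.space :=
  Nat.add_le_add (finsupp_size_le h.reg_lt h.reg_zero) (finsupp_size_le h.mem_lt h.mem_zero)

theorem State.Within.reg_size {L : Limits} {s : State} (h : s.Within L) (i : ℕ) :
    Nat.size (s.reg i) ≤ L.bits := Nat.size_le.2 (h.reg_lt i)

theorem State.Within.mem_size {L : Limits} {s : State} (h : s.Within L) (i : ℕ) :
    Nat.size (s.mem i) ≤ L.bits := Nat.size_le.2 (h.mem_lt i)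

theorem State.Within.setReg {L : Limits} {s : State} (h : s.Within L) {x v : ℕ}
    (hx : x < L.regs) (hv : v < 2 ^ L.bits) : (s.setReg x v).Within L := by
  refine ⟨fun i => ?_, fun i hi => ?_, h.mem_lt, h.mem_zero⟩
  · rw [State.setReg_reg]; split_ifs
    · exact hv
    · exact h.reg_lt i
  · rw [State.setReg_reg, if_neg (by omega)]; exact h.reg_zero i hi

theorem State.Within.setMem {L : Limits} {s : State} (h : s.Within L) {x v : ℕ}
    (hx : x < L.cells) (hv : v < 2 ^ L.bits) : (s.setMem x v).Within L := by
  refine ⟨h.reg_lt, h.reg_zero, fun i => ?_, fun i hi => ?_⟩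
  · rw [State.setMem_mem]; split_ifs
    · exact hv
    · exact h.mem_lt i
  · rw [State.setMem_mem, if_neg (by omega)]; exact h.mem_zero i hi

/-- The program leads from `s` to `s'` in at most `k` basic steps, staying within the limits. -/
def Runs (L : Limits) (P : Prog) (s s' : State) (k : ℕ) : Prop :=
  s'.Within L ∧ ∃ t m, Exec P s s' t m ∧ t ≤ k * (1 + 2 * L.bits) ∧ m ≤ L.space

theorem Runs.mono {L : Limits} {P : Prog} {s s' : State} {k k' : ℕ} (h : Runs L P s s' k)
    (hk : k ≤ k') : Runs L P s s' k' := by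
  obtain ⟨h1, t, m, h2, h3, h4⟩ := h
  exact ⟨h1, t, m, h2, h3.trans (Nat.mul_le_mul_right _ hk), h4⟩

theorem Runs.seq {L : Limits} {P Q : Prog} {s₁ s₂ s₃ : State} {k₁ k₂ : ℕ}
    (hP : Runs L P s₁ s₂ k₁) (hQ : Runs L Q s₂ s₃ k₂) :
    Runs L (P.seq Q) s₁ s₃ (k₁ + k₂) := by
  obtain ⟨_, t, m, h2, h3, h4⟩ := hP
  obtain ⟨h1, t', m', h2', h3', h4'⟩ := hQ
  refine ⟨h1, _, _, Exec.seq h2 h2', ?_, max_le h4 h4'⟩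
  rw [Nat.add_mul]; omega

theorem Runs.skip {L : Limits} {s : State} (h : s.Within L) : Runs L Prog.skip s s 1 :=
  ⟨h, _, _, Exec.skip s, by omega, h.size_le⟩

theorem Runs.ite {L : Limits} {P Q : Prog} {s s' : State} {x k : ℕ} (h : s.Within L)
    (hP : s.reg x ≠ 0 → Runs L P s s' k) (hQ : s.reg x = 0 → Runs L Q s s' k) :
    Runs L (Prog.ite x P Q) s s' (k + 1) := by
  have hb := h.reg_size x
  by_cases hx : s.reg x = 0
  · obtain ⟨h1, t, m, h2, h3, h4⟩ := hQ hx
    refine ⟨h1, _, _, Exec.ite_false hx h2, ?_, h4⟩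
    rw [Nat.add_mul]; omega
  · obtain ⟨h1, t, m, h2, h3, h4⟩ := hP hx
    refine ⟨h1, _, _, Exec.ite_true hx h2, ?_, h4⟩
    rw [Nat.add_mul]; omega

/-- A loop whose body decreases the control register by one. -/
theorem Runs.countdown {L : Limits} {P : Prog} {x T : ℕ} (I : ℕ → State → Prop)
    (step : ∀ j s, s.Within L → I (j + 1) s → s.reg x = j + 1 →
      ∃ s', Runs L P s s' T ∧ I j s' ∧ s'.reg x = j) :
    ∀ j s, s.Within L → I j s → s.reg x = j →
      ∃ s', Runs L (Prog.loop x P) s s' (j * (T + 1) + 1) ∧ I 0 s' ∧ s'.reg x = 0 := by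
  intro j
  induction j with
  | zero =>
    intro s hs hI hx
    refine ⟨s, ⟨hs, _, _, Exec.loop_false hx, ?_, hs.size_le⟩, hI, hx⟩
    have := hs.reg_size x
    omega
  | succ j ih =>
    intro s hs hI hx
    obtain ⟨s₁, ⟨hw, t, m, hE, ht, hm⟩, hI₁, hx₁⟩ := step j s hs hI hx
    obtain ⟨s₂, ⟨hw₂, t₂, m₂, hE₂, ht₂, hm₂⟩, hI₂, hx₂⟩ := ih s₁ hw hI₁ hx₁
    refine ⟨s₂, ⟨hw₂, _, _, Exec.loop_true (by omega) hE hE₂, ?_, max_le hm hm₂⟩, hI₂, hx₂⟩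
    have := hs.reg_size x
    have e : ((j + 1) * (T + 1) + 1) * (1 + 2 * L.bits) =
        (1 + 2 * L.bits) + T * (1 + 2 * L.bits) + (j * (T + 1) + 1) * (1 + 2 * L.bits) := by ring
    rw [e]; omega

namespace Instr

/-- The instruction keeps a state within the limits. -/
def Safe (L : Limits) : Instr → State → Prop
  | const x n, _ => x < L.regs ∧ n < 2 ^ L.bits
  | copy x _, _ => x < L.regs
  | add x y z, s => x < L.regs ∧ s.reg y + s.reg z < 2 ^ L.bits
  | sub x _ _, _ => x < L.regs
  | mul x y z, s => x < L.regs ∧ s.reg y * s.reg z < 2 ^ L.bits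
  | div x _ _, _ => x < L.regs
  | load x _, _ => x < L.regs
  | store x _, s => s.reg x < L.cells

/-- An instruction is charged one unit and the lengths of at most two numbers, each of at most
`L.bits` bits. This is the origin of the factor `1 + 2 * L.bits` per step in `Runs`. -/
theorem runs {L : Limits} {i : Instr} {s : State} (hs : s.Within L) (hi : i.Safe L s) :
    Runs L (Prog.instr i) s (i.run s) 1 := by
  have hw : (i.run s).Within L := by
    cases i with
    | const x n => exact hs.setReg hi.1 hi.2
    | copy x y => exact hs.setReg hi (hs.reg_lt y)
    | add x y z => exact hs.setReg hi.1 hi.2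
    | sub x y z => exact hs.setReg hi ((Nat.sub_le _ _).trans_lt (hs.reg_lt y))
    | mul x y z => exact hs.setReg hi.1 hi.2
    | div x y z => exact hs.setReg hi ((Nat.div_le_self _ _).trans_lt (hs.reg_lt y))
    | load x y => exact hs.setReg hi (hs.mem_lt _)
    | store x y => exact hs.setMem hi (hs.reg_lt y)
  refine ⟨hw, _, _, Exec.instr i s, ?_, max_le hs.size_le hw.size_le⟩
  rw [one_mul]
  have hr := hs.reg_size
  have hm := hs.mem_size
  cases i with
  | const x n =>
    have := Nat.size_le.2 hi.2
    simp only [Instr.cost]; omega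
  | copy x y => have := hr y; simp only [Instr.cost]; omega
  | add x y z => have := hr y; have := hr z; simp only [Instr.cost]; omega
  | sub x y z => have := hr y; have := hr z; simp only [Instr.cost]; omega
  | mul x y z => have := hr y; have := hr z; simp only [Instr.cost]; omega
  | div x y z => have := hr y; have := hr z; simp only [Instr.cost]; omega
  | load x y => have := hr y; have := hm (s.reg y); simp only [Instr.cost]; omega
  | store x y => have := hr x; have := hr y; simp only [Instr.cost]; omega

end Instr

/-- Straight-line code. -/
def block : List Instr → Prog
  | [] => Prog.skip
  | i :: is => (Prog.instr i).seq (block is)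

noncomputable def runBlock : List Instr → State → State
  | [], s => s
  | i :: is, s => runBlock is (i.run s)

def BlockSafe (L : Limits) : List Instr → State → Prop
  | [], _ => True
  | i :: is, s => i.Safe L s ∧ BlockSafe L is (i.run s)

theorem runs_block {L : Limits} {is : List Instr} {s : State} (hs : s.Within L)
    (h : BlockSafe L is s) : Runs L (block is) s (runBlock is s) (is.length + 1) := by
  induction is generalizing s with
  | nil => exact Runs.skip hs
  | cons i is ih =>
    have h1 := Instr.runs hs h.1
    have h2 := ih h1.1 h.2
    exact (h1.seq h2).mono (by simp only [List.length_cons]; omega)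

/-! ### Register allocation and loops over indices -/

/-- Temporary registers. -/
def slot (k : ℕ) : ℕ := 11 + 2 * k

/-- Registers that hold index variables. -/
def ixr (d : ℕ) : ℕ := 10 + 2 * d

/-- The two states differ only in temporary registers from number `k` on. -/
structure Frame (k : ℕ) (s s' : State) : Prop where
  mem : s'.mem = s.mem
  reg : ∀ r, r % 2 = 0 ∨ r < slot k → s'.reg r = s.reg r

theorem Frame.trans {k : ℕ} {s₁ s₂ s₃ : State} (h : Frame k s₁ s₂) (h' : Frame k s₂ s₃) :
    Frame k s₁ s₃ :=
  ⟨h'.mem.trans h.mem, fun r hr => (h'.reg r hr).trans (h.reg r hr)⟩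

theorem Frame.weaken {k k' : ℕ} {s s' : State} (h : Frame k' s s') (hk : k ≤ k') :
    Frame k s s' :=
  ⟨h.mem, fun r hr => h.reg r (by unfold slot at *; omega)⟩

/-- Run the body with the index register counting from `0` to `n - 1`, where register `0` holds `n`
and register `1` holds `1`. -/
def forIdx (ix cnt : ℕ) (body : Prog) : Prog :=
  (block [Instr.copy cnt 0]).seq
    ((Prog.loop cnt (body.seq (block [Instr.add ix ix 1, Instr.sub cnt cnt 1]))).seq
      (block [Instr.const ix 0]))

/-- The counter runs down while the index runs up, so the invariant at counter value `j` is the one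
for index `n - j`. Afterwards the index returns to zero, on which nested compiled code relies. One
round costs the body, three steps for updating the two registers, and the loop test; copying `n`,
the last test and the reset make up the remaining five steps. -/
theorem runs_forIdx {L : Limits} {ix cnt n T : ℕ} {body : Prog} (I : ℕ → State → Prop)
    (hix : ix < L.regs) (hcnt : cnt < L.regs) (hne : ix ≠ cnt) (h2 : 2 ≤ ix) (h2' : 2 ≤ cnt)
    (hnb : n < 2 ^ L.bits)
    (hI : ∀ v s s', I v s → s'.mem = s.mem → (∀ r, r ≠ ix → r ≠ cnt → s'.reg r = s.reg r) → I v s')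
    (hbody : ∀ v s, v < n → s.Within L → I v s → s.reg ix = v → s.reg 0 = n → s.reg 1 = 1 →
      ∃ s', Runs L body s s' T ∧ I (v + 1) s' ∧
        ∀ r, r = ix ∨ r = cnt ∨ r = 0 ∨ r = 1 → s'.reg r = s.reg r)
    {s : State} (hs : s.Within L) (hs0 : s.reg 0 = n) (hs1 : s.reg 1 = 1) (hsx : s.reg ix = 0)
    (hIs : I 0 s) :
    ∃ s', Runs L (forIdx ix cnt body) s s' (n * (T + 4) + 5) ∧ I n s' ∧ s'.reg ix = 0 := by
  set J : ℕ → State → Prop := fun j s =>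
    j ≤ n ∧ I (n - j) s ∧ s.reg ix = n - j ∧ s.reg 0 = n ∧ s.reg 1 = 1 with hJ
  have e1 : Runs L (block [Instr.copy cnt 0]) s (s.setReg cnt n) 2 := by
    have := runs_block (is := [Instr.copy cnt 0]) hs ⟨hcnt, trivial⟩
    simpa [runBlock, Instr.run, hs0] using this
  have hstep : ∀ j s, s.Within L → J (j + 1) s → s.reg cnt = j + 1 →
      ∃ s', Runs L (body.seq (block [Instr.add ix ix 1, Instr.sub cnt cnt 1])) s s' (T + 3) ∧
        J j s' ∧ s'.reg cnt = j := by
    intro j s hs ⟨hjn, hIj, hxj, h0, h1⟩ hc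
    obtain ⟨s', hr, hI', hfr⟩ := hbody (n - (j + 1)) s (by omega) hs hIj hxj h0 h1
    have f1 := hfr ix (by simp)
    have f2 := hfr cnt (by simp)
    have f3 := hfr 0 (by simp)
    have f4 := hfr 1 (by simp)
    have hsafe : BlockSafe L [Instr.add ix ix 1, Instr.sub cnt cnt 1] s' := by
      refine ⟨⟨hix, ?_⟩, hcnt, trivial⟩
      rw [f1, f4, hxj, h1]; omega
    have hb := runs_block hr.1 hsafe
    refine ⟨_, hr.seq hb, ⟨by omega, ?_, ?_, ?_, ?_⟩, ?_⟩
    · have : n - j = n - (j + 1) + 1 := by omega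
      rw [this]
      refine hI _ _ _ hI' rfl ?_
      intro r h1 h2
      simp [runBlock, Instr.run, h1, h2]
    · simp [runBlock, Instr.run, hne, f1, f4, hxj, h1]; omega
    · simp [runBlock, Instr.run, f3, h0, show (0:ℕ) ≠ ix by omega, show (0:ℕ) ≠ cnt by omega]
    · simp [runBlock, Instr.run, f4, h1, show (1:ℕ) ≠ ix by omega, show (1:ℕ) ≠ cnt by omega]
    · simp [runBlock, Instr.run, f2, f4, h1, hc, hne.symm, show (1:ℕ) ≠ ix by omega]
  obtain ⟨s₂, hr₂, hJ₂, hc₂⟩ := Runs.countdown J hstep n (s.setReg cnt n) e1.1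
    ⟨le_rfl, by
      rw [Nat.sub_self]
      exact hI 0 s _ hIs rfl (fun r _ h => by simp [h]),
      by simp [hne, hsx], by simp [hs0, show (0:ℕ) ≠ cnt by omega],
      by simp [hs1, show (1:ℕ) ≠ cnt by omega]⟩ (by simp)
  obtain ⟨-, hIn, -⟩ := hJ₂
  have hb := runs_block (is := [Instr.const ix 0]) hr₂.1 ⟨⟨hix, by positivity⟩, trivial⟩
  refine ⟨_, (e1.seq (hr₂.seq hb)).mono (by
    simp only [List.length_cons, List.length_nil]; ring_nf; omega), ?_, by simp [runBlock, Instr.run]⟩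
  refine hI _ _ _ hIn rfl (fun r h _ => ?_)
  simp [runBlock, Instr.run, h]

end LogRAM

namespace LogRAM

/-! ### Expressions over square arrays -/

/-- Arrays that can be read: working arrays and the parts of the input. -/
inductive Src where
  | arr (a : ℕ)
  | inM
  | inK
  | inS

namespace Src

/-- Memory layout, for use in `addr`: the input occupies cell `0` and the cells from `1` (matrix),
`n * n + 1` (terminals) and `n * n + n + 1` (cut) on. The characteristic vectors get row distance
`0`, so that the first index is ignored. The block with `c1 = 2`, `c2 = 1` directly behind the input
is a scratch array; the working arrays follow it. -/
def c1 : Src → ℕ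
  | arr _ => 2
  | inM => 0
  | inK => 0
  | inS => 1

def c2 : Src → ℕ
  | arr a => a + 2
  | inM => 0
  | inK => 1
  | inS => 1

/-- The register that holds the distance of consecutive rows. -/
def str : Src → ℕ
  | arr _ => 0
  | inM => 0
  | inK => 9
  | inS => 9

/-- The distance of consecutive rows. -/
def stride (n : ℕ) : Src → ℕ
  | arr _ => n
  | inM => n
  | inK => 0
  | inS => 0

end Src

/-- Address of an array entry. -/
def addr (n c1 c2 st i j : ℕ) : ℕ := (c2 * n + c1) * n + 1 + i * st + j

inductive BinOp where
  | add
  | sub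
  | mul
  | div

inductive AggOp where
  | add
  | min

/-- Expressions; `idx x` is an index variable, `agg` binds the next index variable. -/
inductive Expr where
  | lit (c : ℕ)
  | dim
  | idx (x : ℕ)
  | rd (a : Src) (x y : ℕ)
  | bin (o : BinOp) (e₁ e₂ : Expr)
  | ite (c t e : Expr)
  | agg (o : AggOp) (e₀ e : Expr)

def BinOp.ev : BinOp → ℕ → ℕ → ℕ
  | add, a, b => a + b
  | sub, a, b => a - b
  | mul, a, b => a * b
  | div, a, b => a / b

def AggOp.ev {n : ℕ} : AggOp → ℕ → (Fin n → ℕ) → ℕ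
  | add, a, f => a + ∑ v, f v
  | min, a, f => Finset.univ.fold Min.min a f

def AggOp.step : AggOp → ℕ → ℕ → ℕ
  | add, a, b => a + b
  | min, a, b => Min.min a b

/-- Aggregate of the first values of a function. -/
def AggOp.upTo {n : ℕ} (o : AggOp) (a : ℕ) (f : Fin n → ℕ) : ℕ → ℕ
  | 0 => a
  | k + 1 => if h : k < n then o.step (o.upTo a f k) (f ⟨k, h⟩) else o.upTo a f k

theorem AggOp.upTo_eq {n : ℕ} (o : AggOp) (a : ℕ) (f : Fin n → ℕ) : o.upTo a f n = o.ev a f := by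
  cases o with
  | add =>
    have h : ∀ k, k ≤ n → AggOp.upTo .add a f k =
        a + ∑ i ∈ Finset.range k, if h : i < n then f ⟨i, h⟩ else 0 := by
      intro k
      induction k with
      | zero => intro _; simp [AggOp.upTo]
      | succ k ih =>
        intro hk
        rw [Finset.sum_range_succ, AggOp.upTo, dif_pos (show k < n by omega), ih (by omega),
          dif_pos (show k < n by omega)]
        simp only [AggOp.step]; omega
    rw [h n le_rfl, AggOp.ev, Finset.sum_range]
    simp
  | min =>
    have h : ∀ k, k ≤ n → ∀ c, c ≤ AggOp.upTo .min a f k ↔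
        c ≤ a ∧ ∀ v : Fin n, v.1 < k → c ≤ f v := by
      intro k
      induction k with
      | zero => intro _ c; simp [AggOp.upTo]
      | succ k ih =>
        intro hk c
        have hk' : k < n := by omega
        rw [AggOp.upTo, dif_pos hk', AggOp.step, le_min_iff, ih (by omega)]
        constructor
        · rintro ⟨⟨h1, h2⟩, h3⟩
          refine ⟨h1, fun v hv => ?_⟩
          rcases Nat.lt_succ_iff_lt_or_eq.1 hv with h | h
          · exact h2 v h
          · have : v = ⟨k, hk'⟩ := Fin.ext h
            rw [this]; exact h3
        · rintro ⟨h1, h2⟩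
          exact ⟨⟨h1, fun v hv => h2 v (by omega)⟩, h2 _ (by simp)⟩
    refine eq_of_forall_le_iff fun c => ?_
    rw [h n le_rfl, AggOp.ev, Finset.le_fold_min]
    simp

/-- Contents of all arrays. -/
abbrev Env (n : ℕ) := Src → Fin n → Fin n → ℕ

def Expr.ev {n : ℕ} (E : Env n) : ℕ → Expr → (ℕ → Fin n) → ℕ
  | _, lit c, _ => c
  | _, dim, _ => n
  | _, idx x, ρ => ρ x
  | _, rd a x y, ρ => E a (ρ x) (ρ y)
  | d, bin o e₁ e₂, ρ => o.ev (ev E d e₁ ρ) (ev E d e₂ ρ)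
  | d, ite c t e, ρ => if ev E d c ρ ≠ 0 then ev E d t ρ else ev E d e ρ
  | d, agg o e₀ e, ρ => o.ev (ev E d e₀ ρ) fun v => ev E (d + 1) e (Function.update ρ d v)

/-- A measure of expressions that bounds the registers needed and the length of the values. -/
def Expr.sz : Expr → ℕ
  | lit c => c + 1
  | dim => 1
  | idx _ => 1
  | rd a _ _ => a.c1 + a.c2 + 4
  | bin _ e₁ e₂ => sz e₁ + sz e₂ + 1
  | ite c t e => sz c + sz t + sz e
  | agg _ e₀ e => sz e₀ + sz e + 3

def BinOp.instr : BinOp → ℕ → ℕ → ℕ → Instr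
  | add => Instr.add
  | sub => Instr.sub
  | mul => Instr.mul
  | div => Instr.div

/-- `x := x o y`, possibly changing `y` -/
def AggOp.code : AggOp → ℕ → ℕ → List Instr
  | add, x, y => [Instr.add x x y]
  -- With truncated subtraction, `x - (x - y)` is the minimum of `x` and `y`.
  | min, x, y => [Instr.sub y x y, Instr.sub x x y]

/-- Code that computes an address into register `a`, using also register `b`. -/
def addrCode (c1 c2 st x y a b : ℕ) : List Instr :=
  [Instr.const a c2, Instr.mul a a 0, Instr.const b c1, Instr.add a a b, Instr.mul a a 0,
    Instr.add a a 1, Instr.mul b x st, Instr.add a a b, Instr.add a a y]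

/-- Code that computes an expression into slot `k`, using only slots from `k` on. -/
def Expr.comp : ℕ → ℕ → Expr → Prog
  | _, k, lit c => block [Instr.const (slot k) c]
  | _, k, dim => block [Instr.copy (slot k) 0]
  | _, k, idx x => block [Instr.copy (slot k) (ixr x)]
  | _, k, rd a x y => block (addrCode a.c1 a.c2 a.str (ixr x) (ixr y) (slot k) (slot (k + 1)) ++
      [Instr.load (slot k) (slot k)])
  | d, k, bin o e₁ e₂ => (comp d k e₁).seq ((comp d (k + 1) e₂).seq
      (block [o.instr (slot k) (slot k) (slot (k + 1))]))
  | d, k, ite c t e => (comp d k c).seq (Prog.ite (slot k) (comp d k t) (comp d k e))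
  | d, k, agg o e₀ e => (comp d k e₀).seq (forIdx (ixr d) (slot (k + 1))
      ((comp (d + 1) (k + 2) e).seq (block (o.code (slot k) (slot (k + 2))))))

open Polynomial in
/-- Number of steps for evaluating an expression. -/
noncomputable def Expr.steps : Expr → Polynomial ℕ
  | lit _ => 2
  | dim => 2
  | idx _ => 2
  | rd _ _ _ => 11
  | bin _ e₁ e₂ => steps e₁ + (steps e₂ + 2)
  | ite c t e => steps c + (steps t + steps e + 1)
  | agg _ e₀ e => steps e₀ + (X * (steps e + 3 + 4) + 5)

theorem runBlock_append (l₁ l₂ : List Instr) (s : State) :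
    runBlock (l₁ ++ l₂) s = runBlock l₂ (runBlock l₁ s) := by
  induction l₁ generalizing s with
  | nil => rfl
  | cons i l ih => exact ih _

theorem blockSafe_append {L : Limits} {l₁ l₂ : List Instr} {s : State} (h₁ : BlockSafe L l₁ s)
    (h₂ : BlockSafe L l₂ (runBlock l₁ s)) : BlockSafe L (l₁ ++ l₂) s := by
  induction l₁ generalizing s with
  | nil => exact h₂
  | cons i l ih => exact ⟨h₁.1, ih h₁.2 h₂⟩

/-- Since `n` is positive, no intermediate value exceeds the final address, so `hlt` alone
guarantees that all of them fit into the registers. -/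
theorem addrCode_spec {L : Limits} {c1 c2 st x y a b : ℕ} {s : State} {n i j t : ℕ}
    (ha : a < L.regs) (hb : b < L.regs) (hab : a ≠ b) (ha1 : 9 < a) (hb1 : 9 < b)
    (hst : st ≤ 9) (hxa : x ≠ a) (hxb : x ≠ b) (hya : y ≠ a) (hyb : y ≠ b)
    (h0 : s.reg 0 = n) (h1 : s.reg 1 = 1) (hx : s.reg x = i) (hy : s.reg y = j)
    (ht : s.reg st = t) (hn : 0 < n) (hlt : addr n c1 c2 t i j < 2 ^ L.bits) :
    BlockSafe L (addrCode c1 c2 st x y a b) s ∧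
      (runBlock (addrCode c1 c2 st x y a b) s).reg a = addr n c1 c2 t i j ∧
      (runBlock (addrCode c1 c2 st x y a b) s).mem = s.mem ∧
      ∀ r, r ≠ a → r ≠ b → (runBlock (addrCode c1 c2 st x y a b) s).reg r = s.reg r := by
  unfold addr at hlt
  have g0a : 0 ≠ a := by omega
  have g0b : 0 ≠ b := by omega
  have g1a : 1 ≠ a := by omega
  have g1b : 1 ≠ b := by omega
  have gsa : st ≠ a := by omega
  have gsb : st ≠ b := by omega
  have m1 : (c2 * n + c1) ≤ (c2 * n + c1) * n := Nat.le_mul_of_pos_right _ hn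
  have m2 : c2 ≤ c2 * n := Nat.le_mul_of_pos_right _ hn
  refine ⟨?_, ?_, rfl, ?_⟩
  · simp only [addrCode, BlockSafe, Instr.Safe, Instr.run, State.setReg_reg, if_true, hab, hab.symm,
      if_false, h0, h1, hx, hy, ht, g0a, g0b, g1a, g1b, gsa, gsb, hxa, hxb, hya, hyb, ha, hb,
      true_and, and_true]
    refine ⟨?_, ?_, ?_, ?_, ?_, ?_, ?_, ?_, ?_⟩ <;> omega
  · simp only [addrCode, runBlock, Instr.run, State.setReg_reg, if_true, hab, hab.symm,
      if_false, h0, h1, hx, hy, ht, g0a, g0b, g1a, g1b, gsa, gsb, hxa, hxb, hya, hyb, addr]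
  · intro r hra hrb
    simp [addrCode, runBlock, Instr.run, hra, hrb]

/-- The state holds the arrays and the index variables. -/
structure Holds (n : ℕ) (E : Env n) (ρ : ℕ → Fin n) (s : State) : Prop where
  dim : s.reg 0 = n
  one : s.reg 1 = 1
  zero : s.reg 9 = 0
  ix : ∀ x, s.reg (ixr x) = ρ x
  mem : ∀ (a : Src) (i j : Fin n), s.mem (addr n a.c1 a.c2 (a.stride n) i j) = E a i j

theorem Holds.frame {n : ℕ} {E : Env n} {ρ : ℕ → Fin n} {s s' : State} {k : ℕ}
    (h : Holds n E ρ s) (hf : Frame k s s') : Holds n E ρ s' := by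
  refine ⟨?_, ?_, ?_, fun x => ?_, fun a i j => ?_⟩
  · rw [hf.reg 0 (by simp), h.dim]
  · rw [hf.reg 1 (by unfold slot; omega), h.one]
  · rw [hf.reg 9 (by unfold slot; omega), h.zero]
  · rw [hf.reg _ (by unfold ixr; omega), h.ix]
  · rw [hf.mem, h.mem]

theorem Holds.stride {n : ℕ} {E : Env n} {ρ : ℕ → Fin n} {s : State} (h : Holds n E ρ s)
    (a : Src) : s.reg a.str = a.stride n := by
  cases a <;> simp [Src.str, Src.stride, h.dim, h.zero]

theorem lt_two_pow_mul {c v : ℕ} (hv : 1 ≤ v) : c < 2 ^ (c * v + v) := by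
  calc c < 2 ^ c := Nat.lt_two_pow_self
    _ ≤ 2 ^ (c * v + v) := Nat.pow_le_pow_right (by norm_num) (by nlinarith)

/-- The address is at most `(c1 + c2 + 1) * n ^ 2`. The square needs `2 * v` bits, and the constant
factor at most `c1 + c2 + 1` more. -/
theorem addr_lt {n v c1 c2 st i j : ℕ} (hv : 1 ≤ v) (hn : n < 2 ^ v) (hst : st ≤ n) (hi : i < n)
    (hj : j < n) : addr n c1 c2 st i j < 2 ^ ((c1 + c2 + 4) * v) := by
  have h1 : addr n c1 c2 st i j ≤ (c1 + c2 + 1) * (n * n) := by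
    unfold addr
    have a1 : i * st ≤ (n - 1) * n := Nat.mul_le_mul (by omega) hst
    have a2 : (n - 1) * n + n = n * n := by
      rw [Nat.sub_mul, one_mul]; have := Nat.le_mul_self n; omega
    have a3 : c1 * n ≤ c1 * (n * n) := Nat.mul_le_mul_left _ (Nat.le_mul_self n)
    nlinarith
  have h2 : n * n < 2 ^ (2 * v) := by
    rw [two_mul, pow_add]; exact Nat.mul_lt_mul'' hn hn
  have h3 : c1 + c2 + 1 ≤ 2 ^ (c1 + c2 + 1) := Nat.lt_two_pow_self.le
  calc addr n c1 c2 st i j ≤ (c1 + c2 + 1) * (n * n) := h1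
    _ < (c1 + c2 + 1) * 2 ^ (2 * v) := Nat.mul_lt_mul_of_pos_left h2 (by omega)
    _ ≤ 2 ^ (c1 + c2 + 1) * 2 ^ (2 * v) := Nat.mul_le_mul_right _ h3
    _ = 2 ^ (c1 + c2 + 1 + 2 * v) := (pow_add _ _ _).symm
    _ ≤ 2 ^ ((c1 + c2 + 4) * v) := Nat.pow_le_pow_right (by norm_num) (by nlinarith)

theorem Src.stride_le (n : ℕ) (a : Src) : a.stride n ≤ n := by cases a <;> simp [Src.stride]

theorem two_pow_add_le {a b c : ℕ} (ha : a < c) (hb : b < c) : 2 ^ a + 2 ^ b ≤ 2 ^ c := by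
  obtain ⟨c, rfl⟩ : ∃ d, c = d + 1 := ⟨c - 1, by omega⟩
  rw [pow_succ, mul_two]
  exact Nat.add_le_add (Nat.pow_le_pow_right (by norm_num) (by omega))
    (Nat.pow_le_pow_right (by norm_num) (by omega))

theorem Expr.one_le_sz (e : Expr) : 1 ≤ e.sz := by
  induction e <;> simp only [Expr.sz] <;> omega

theorem AggOp.upTo_lt {n v b c : ℕ} (o : AggOp) {a : ℕ} {f : Fin n → ℕ} (hv : 1 ≤ v)
    (hn : n < 2 ^ v) (ha : a < 2 ^ b) (hf : ∀ i, f i < 2 ^ c) (k : ℕ) (hk : k ≤ n) :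
    o.upTo a f k < 2 ^ (b + c + v) := by
  cases o with
  | add =>
    have : ∀ k, k ≤ n → AggOp.upTo .add a f k < 2 ^ b + k * 2 ^ c := by
      intro k
      induction k with
      | zero => intro _; simpa [AggOp.upTo] using ha
      | succ k ih =>
        intro hk
        rw [AggOp.upTo, dif_pos (show k < n by omega), AggOp.step]
        have := ih (by omega)
        have := hf ⟨k, by omega⟩
        rw [Nat.add_mul]; omega
    calc _ < 2 ^ b + k * 2 ^ c := this k hk
      _ ≤ 2 ^ b * 2 ^ c + (2 ^ v - 1) * (2 ^ b * 2 ^ c) :=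
          Nat.add_le_add (Nat.le_mul_of_pos_right _ (by positivity)) (Nat.mul_le_mul (by omega)
            (Nat.le_mul_of_pos_left _ (by positivity)))
      _ = 2 ^ (b + c + v) := by
          have : 1 ≤ 2 ^ v := Nat.one_le_two_pow
          rw [Nat.sub_mul, one_mul, pow_add, pow_add, mul_comm (2 ^ b * 2 ^ c) (2 ^ v)]
          have := Nat.mul_le_mul_right (2 ^ b * 2 ^ c) this
          omega
  | min =>
    have : ∀ k, AggOp.upTo .min a f k ≤ a := by
      intro k
      induction k with
      | zero => exact le_rfl
      | succ k ih =>
        rw [AggOp.upTo]; split_ifs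
        · exact (min_le_left _ _).trans ih
        · exact ih
    exact (this k).trans_lt (ha.trans_le (Nat.pow_le_pow_right (by norm_num) (by omega)))

/-- Lengths add up under multiplication, and a sum over all vertices adds at most the `v` bits of
their number. So the length of a value is at most a syntactic measure times `v`; the extra summands
in `Expr.sz` pay for carries and for the number of vertices. -/
theorem Expr.ev_lt {n v : ℕ} {E : Env n} (hv : 1 ≤ v) (hn : n < 2 ^ v)
    (hE : ∀ a i j, E a i j < 2 ^ v) (e : Expr) :
    ∀ (d : ℕ) (ρ : ℕ → Fin n), e.ev E d ρ < 2 ^ (e.sz * v) := by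
  induction e with
  | lit c => intro d ρ; simpa [Expr.ev, Expr.sz, Nat.add_mul] using lt_two_pow_mul hv
  | dim => intro d ρ; simpa [Expr.ev, Expr.sz] using hn
  | idx x => intro d ρ; simpa [Expr.ev, Expr.sz] using (ρ x).2.trans hn
  | rd a x y =>
    intro d ρ
    exact (hE a _ _).trans_le (Nat.pow_le_pow_right (by norm_num) (by simp only [Expr.sz]; nlinarith))
  | bin o e₁ e₂ ih₁ ih₂ =>
    intro d ρ
    have h₁ := ih₁ d ρ
    have h₂ := ih₂ d ρ
    have o₁ := e₁.one_le_sz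
    have o₂ := e₂.one_le_sz
    have hle : e₁.sz * v + e₂.sz * v + 1 ≤ (e₁.sz + e₂.sz + 1) * v := by nlinarith
    simp only [Expr.ev, Expr.sz]
    cases o with
    | add =>
      calc _ < 2 ^ (e₁.sz * v) + 2 ^ (e₂.sz * v) := Nat.add_lt_add h₁ h₂
        _ ≤ _ := two_pow_add_le (by omega) (by omega)
    | sub =>
      exact (Nat.sub_le _ _).trans_lt (h₁.trans_le (Nat.pow_le_pow_right (by norm_num) (by omega)))
    | mul =>
      calc _ < 2 ^ (e₁.sz * v) * 2 ^ (e₂.sz * v) := Nat.mul_lt_mul'' h₁ h₂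
        _ ≤ _ := by rw [← pow_add]; exact Nat.pow_le_pow_right (by norm_num) (by omega)
    | div =>
      exact (Nat.div_le_self _ _).trans_lt
        (h₁.trans_le (Nat.pow_le_pow_right (by norm_num) (by omega)))
  | ite c t e _ iht ihe =>
    intro d ρ
    simp only [Expr.ev, Expr.sz]
    split_ifs
    · exact (iht d ρ).trans_le (Nat.pow_le_pow_right (by norm_num) (by nlinarith))
    · exact (ihe d ρ).trans_le (Nat.pow_le_pow_right (by norm_num) (by nlinarith))
  | agg o e₀ e ih₀ ih =>
    intro d ρ
    simp only [Expr.ev, Expr.sz]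
    rw [← AggOp.upTo_eq]
    refine (AggOp.upTo_lt o hv hn (ih₀ d ρ) (fun i => ih (d + 1) _) n le_rfl).trans_le
      (Nat.pow_le_pow_right (by norm_num) (by nlinarith))

theorem BinOp.instr_run (o : BinOp) (x y z : ℕ) (s : State) :
    (o.instr x y z).run s = s.setReg x (o.ev (s.reg y) (s.reg z)) := by
  cases o <;> rfl

theorem BinOp.instr_safe {L : Limits} {o : BinOp} {x y z : ℕ} {s : State} (hx : x < L.regs)
    (h : o.ev (s.reg y) (s.reg z) < 2 ^ L.bits) : (o.instr x y z).Safe L s := by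
  cases o <;> first | exact ⟨hx, h⟩ | exact hx

theorem AggOp.code_spec {L : Limits} {o : AggOp} {x y : ℕ} {s : State} (hx : x < L.regs)
    (hy : y < L.regs) (hxy : x ≠ y) (h : o.step (s.reg x) (s.reg y) < 2 ^ L.bits) :
    BlockSafe L (o.code x y) s ∧
      (runBlock (o.code x y) s).reg x = o.step (s.reg x) (s.reg y) ∧
      (runBlock (o.code x y) s).mem = s.mem ∧
      (∀ r, r ≠ x → r ≠ y → (runBlock (o.code x y) s).reg r = s.reg r) ∧
      (o.code x y).length ≤ 2 := by
  cases o with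
  | add =>
    refine ⟨⟨⟨hx, h⟩, trivial⟩, by simp [AggOp.code, runBlock, Instr.run, AggOp.step], rfl,
      fun r h1 h2 => by simp [AggOp.code, runBlock, Instr.run, h1], by simp [AggOp.code]⟩
  | min =>
    refine ⟨⟨hy, hx, trivial⟩, ?_, rfl,
      fun r h1 h2 => by simp [AggOp.code, runBlock, Instr.run, h1, h2], by simp [AggOp.code]⟩
    simp [AggOp.code, runBlock, Instr.run, AggOp.step, hxy]
    omega

/-- Structural induction: the code for slot `k` leaves all lower slots and all even registers
unchanged, so partial results survive. The condition that unbound index variables are zero lets an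
aggregate start its loop without initialising the index, and the loop restores it. -/
theorem Expr.runs_comp {L : Limits} {n v : ℕ} {E : Env n} (hn0 : 0 < n) (hv : 1 ≤ v)
    (hn : n < 2 ^ v) (hE : ∀ a i j, E a i j < 2 ^ v) (e : Expr) :
    ∀ (d k : ℕ) (ρ : ℕ → Fin n) (s : State), s.Within L → Holds n E ρ s →
      (∀ x, d ≤ x → (ρ x : ℕ) = 0) → e.sz * v ≤ L.bits → 2 * (d + k + e.sz) + 14 ≤ L.regs →
      ∃ s', Runs L (e.comp d k) s s' (e.steps.eval n) ∧ s'.reg (slot k) = e.ev E d ρ ∧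
        Frame k s s' := by
  have h2 : ∀ {a b : ℕ}, a ≤ b → 2 ^ a ≤ 2 ^ b := fun h => Nat.pow_le_pow_right (by norm_num) h
  induction e with
  | lit c =>
    intro d k ρ s hs hH _ hb hr
    have hlt := (lt_two_pow_mul (c := c) hv).trans_le (h2 (a := c * v + v) (b := L.bits)
      (by simp only [Expr.sz] at hb; linarith))
    have := runs_block (is := [Instr.const (slot k) c]) hs
      ⟨⟨by simp only [slot, Expr.sz] at *; omega, hlt⟩, trivial⟩
    refine ⟨_, this.mono (by simp [Expr.steps]), by simp [runBlock, Instr.run, Expr.ev], rfl, ?_⟩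
    intro r hr
    rw [runBlock, runBlock, Instr.run, State.setReg_reg, if_neg (by unfold slot at *; omega)]
  | dim =>
    intro d k ρ s hs hH _ hb hr
    have := runs_block (is := [Instr.copy (slot k) 0]) hs
      ⟨by simp only [Instr.Safe, slot, Expr.sz] at *; omega, trivial⟩
    refine ⟨_, this.mono (by simp [Expr.steps]), by simp [runBlock, Instr.run, Expr.ev, hH.dim], rfl, ?_⟩
    intro r hr
    rw [runBlock, runBlock, Instr.run, State.setReg_reg, if_neg (by unfold slot at *; omega)]
  | idx x =>
    intro d k ρ s hs hH _ hb hr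
    have := runs_block (is := [Instr.copy (slot k) (ixr x)]) hs
      ⟨by simp only [Instr.Safe, slot, Expr.sz] at *; omega, trivial⟩
    refine ⟨_, this.mono (by simp [Expr.steps]), by simp [runBlock, Instr.run, Expr.ev, hH.ix], rfl, ?_⟩
    intro r hr
    rw [runBlock, runBlock, Instr.run, State.setReg_reg, if_neg (by unfold slot at *; omega)]
  | rd a x y =>
    intro d k ρ s hs hH _ hb hr
    simp only [Expr.sz] at hb hr
    obtain ⟨g1, g2, g3, g4⟩ := addrCode_spec (L := L) (c1 := a.c1) (c2 := a.c2) (st := a.str)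
      (x := ixr x) (y := ixr y) (a := slot k) (b := slot (k + 1)) (s := s)
      (by unfold slot; omega) (by unfold slot; omega) (by unfold slot; omega)
      (by unfold slot; omega) (by unfold slot; omega) (by cases a <;> simp [Src.str])
      (by unfold slot ixr; omega) (by unfold slot ixr; omega) (by unfold slot ixr; omega)
      (by unfold slot ixr; omega) hH.dim hH.one (hH.ix x) (hH.ix y) (hH.stride a) hn0
      ((addr_lt hv hn (a.stride_le n) (ρ x).2 (ρ y).2).trans_le (h2 hb))
    have := runs_block (is := addrCode a.c1 a.c2 a.str (ixr x) (ixr y) (slot k) (slot (k + 1)) ++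
      [Instr.load (slot k) (slot k)]) hs (blockSafe_append g1
        ⟨by simp only [Instr.Safe, slot]; omega, trivial⟩)
    refine ⟨_, this.mono (by simp [Expr.steps, addrCode]), ?_, ?_, ?_⟩
    · rw [runBlock_append]
      simp only [runBlock, Instr.run, State.setReg_reg, if_true, g2, g3, Expr.ev]
      exact hH.mem a _ _
    · rw [runBlock_append]; exact g3
    · intro r hr
      rw [runBlock_append, runBlock, runBlock, Instr.run, State.setReg_reg,
        if_neg (by unfold slot at *; omega)]
      exact g4 r (by unfold slot at *; omega) (by unfold slot at *; omega)
  | bin o e₁ e₂ ih₁ ih₂ =>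
    intro d k ρ s hs hH hρ hb hr
    have hlt := (Expr.ev_lt hv hn hE (bin o e₁ e₂) d ρ).trans_le (h2 hb)
    simp only [Expr.sz, Nat.add_mul] at hb hr
    have o₂ := e₂.one_le_sz
    obtain ⟨s₁, r₁, v₁, f₁⟩ := ih₁ d k ρ s hs hH hρ (by omega) (by omega)
    obtain ⟨s₂, r₂, v₂, f₂⟩ := ih₂ d (k + 1) ρ s₁ r₁.1 (hH.frame f₁) hρ (by omega) (by omega)
    have v₁' : s₂.reg (slot k) = e₁.ev E d ρ := by
      rw [f₂.reg _ (by unfold slot; omega), v₁]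
    have r₃ := runs_block (is := [o.instr (slot k) (slot k) (slot (k + 1))]) r₂.1
      ⟨BinOp.instr_safe (by unfold slot; omega) (by rw [v₁', v₂]; exact hlt), trivial⟩
    refine ⟨_, (r₁.seq (r₂.seq r₃)).mono (by simp [Expr.steps]), ?_, ?_⟩
    · simp only [runBlock, BinOp.instr_run, State.setReg_reg, if_true, v₁', v₂, Expr.ev]
    · refine (f₁.trans (f₂.weaken (by omega))).trans ⟨by simp [runBlock, BinOp.instr_run], ?_⟩
      intro r hr
      rw [runBlock, runBlock, BinOp.instr_run, State.setReg_reg, if_neg (by unfold slot at *; omega)]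
  | ite c t e ihc iht ihe =>
    intro d k ρ s hs hH hρ hb hr
    simp only [Expr.sz, Nat.add_mul] at hb hr
    obtain ⟨s₁, r₁, v₁, f₁⟩ := ihc d k ρ s hs hH hρ (by omega) (by omega)
    by_cases hc : c.ev E d ρ = 0
    · obtain ⟨s₂, r₂, v₂, f₂⟩ := ihe d k ρ s₁ r₁.1 (hH.frame f₁) hρ (by omega) (by omega)
      refine ⟨s₂, ?_, by simp [Expr.ev, hc, v₂], f₁.trans f₂⟩
      refine (r₁.seq (Runs.ite r₁.1 (fun h => absurd (v₁.trans hc) h) (fun _ => r₂))).mono ?_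
      simp only [Expr.steps, Polynomial.eval_add, Polynomial.eval_one]; omega
    · obtain ⟨s₂, r₂, v₂, f₂⟩ := iht d k ρ s₁ r₁.1 (hH.frame f₁) hρ (by omega) (by omega)
      refine ⟨s₂, ?_, by simp [Expr.ev, hc, v₂], f₁.trans f₂⟩
      refine (r₁.seq (Runs.ite r₁.1 (fun _ => r₂) (fun h => absurd (v₁.symm.trans h) hc))).mono ?_
      simp only [Expr.steps, Polynomial.eval_add, Polynomial.eval_one]; omega
  | agg o e₀ e ih₀ ih =>
    intro d k ρ s hs hH hρ hb hr
    simp only [Expr.sz, Nat.add_mul] at hb hr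
    have o₀ := e₀.one_le_sz
    obtain ⟨s₁, r₁, v₁, f₁⟩ := ih₀ d k ρ s hs hH hρ (by omega) (by omega)
    have hH₁ := hH.frame f₁
    set f : Fin n → ℕ := fun v => e.ev E (d + 1) (Function.update ρ d v) with hf
    -- Slot `k` accumulates the aggregate of the first `v` values, slot `k + 1` is the loop counter,
    -- and each new value is computed into slot `k + 2`.
    set I : ℕ → State → Prop := fun v t => t.mem = s₁.mem ∧
      (∀ r, r ≠ ixr d → (r % 2 = 0 ∨ r < slot k) → t.reg r = s₁.reg r) ∧
      t.reg (slot k) = o.upTo (e₀.ev E d ρ) f v with hI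
    obtain ⟨s₂, r₂, ⟨m₂, f₂, v₂⟩, z₂⟩ := runs_forIdx (L := L) (ix := ixr d) (cnt := slot (k + 1))
      (n := n) (T := e.steps.eval n + 3)
      (body := (e.comp (d + 1) (k + 2)).seq (block (o.code (slot k) (slot (k + 2))))) I
      (by unfold ixr; omega) (by unfold slot; omega) (by unfold slot ixr; omega)
      (by unfold ixr; omega) (by unfold slot; omega) (hn.trans_le (h2 (by nlinarith)))
      (by
        rintro w t t' ⟨g1, g2, g3⟩ gm gr
        refine ⟨gm.trans g1, fun r h1 h2 => ?_, ?_⟩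
        · rw [gr r h1 (by unfold slot at *; omega), g2 r h1 h2]
        · rw [gr _ (by unfold slot ixr; omega) (by unfold slot; omega), g3])
      (by
        rintro w t hw ht ⟨g1, g2, g3⟩ gx g0 g1'
        have hHt : Holds n E (Function.update ρ d ⟨w, hw⟩) t := by
          refine ⟨g0, g1', ?_, fun x => ?_, fun a i j => ?_⟩
          · rw [g2 9 (by unfold ixr; omega) (by unfold slot; omega), hH₁.zero]
          · by_cases hx : x = d
            · subst hx; simp [gx]
            · rw [g2 _ (by unfold ixr; omega) (by unfold ixr; omega), hH₁.ix,
                Function.update_of_ne hx]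
          · rw [g1, hH₁.mem]
        obtain ⟨t₁, q₁, w₁, p₁⟩ := ih (d + 1) (k + 2) _ t ht hHt
          (by
            intro x hx
            rw [Function.update_of_ne (by omega)]
            exact hρ x (by omega)) (by omega) (by omega)
        have w₁' : t₁.reg (slot k) = o.upTo (e₀.ev E d ρ) f w := by
          rw [p₁.reg _ (by unfold slot; omega), g3]
        have key : o.step (t₁.reg (slot k)) (t₁.reg (slot (k + 2))) =
            o.upTo (e₀.ev E d ρ) f (w + 1) := by
          rw [w₁', w₁, AggOp.upTo, dif_pos hw]
        obtain ⟨c1, c2, c3, c4, c5⟩ := AggOp.code_spec (L := L) (o := o) (x := slot k)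
          (y := slot (k + 2)) (s := t₁) (by unfold slot; omega) (by unfold slot; omega)
          (by unfold slot; omega) (by
            rw [key]
            exact (AggOp.upTo_lt o hv hn (Expr.ev_lt hv hn hE e₀ d ρ)
              (fun i => Expr.ev_lt hv hn hE e (d + 1) _) (w + 1) hw).trans_le (h2 (by omega)))
        refine ⟨_, (q₁.seq (runs_block q₁.1 c1)).mono (by omega), ⟨?_, ?_, ?_⟩, ?_⟩
        · rw [c3, p₁.mem, g1]
        · intro r hr1 hr2
          rw [c4 r (by unfold slot at *; omega) (by unfold slot at *; omega),
            p₁.reg r (by unfold slot at *; omega), g2 r hr1 hr2]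
        · rw [c2, key]
        · intro r hr
          rw [c4 r (by unfold slot ixr at *; omega) (by unfold slot ixr at *; omega),
            p₁.reg r (by unfold slot ixr at *; omega)])
      r₁.1 hH₁.dim hH₁.one (by rw [hH₁.ix, hρ d le_rfl])
      ⟨rfl, fun _ _ _ => rfl, by rw [v₁]; rfl⟩
    refine ⟨s₂, (r₁.seq r₂).mono (by simp [Expr.steps]), ?_, f₁.trans ⟨m₂, fun r hr => ?_⟩⟩
    · rw [v₂, AggOp.upTo_eq]; rfl
    · by_cases hrd : r = ixr d
      · rw [hrd, z₂, hH₁.ix, hρ d le_rfl]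
      · exact f₂ r hrd hr

end LogRAM

namespace LogRAM

/-! ### Commands on square arrays -/

/-- For all `i`, `j`, run the body and store its result, found in slot `k + 2`, in the entry
`(i, j)` of an array. -/
def storeLoop (k c1 c2 : ℕ) (body : Prog) : Prog :=
  forIdx (ixr 0) (slot k) (forIdx (ixr 1) (slot (k + 1)) (body.seq
    (block (addrCode c1 c2 0 (ixr 0) (ixr 1) (slot (k + 3)) (slot (k + 4)) ++
      [Instr.store (slot (k + 3)) (slot (k + 2))]))))

theorem addr_inj {n c1 c2 : ℕ} {i j i' j' : Fin n}
    (h : addr n c1 c2 n i j = addr n c1 c2 n i' j') : i = i' ∧ j = j' := by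
  unfold addr at h
  have h1 : (i : ℕ) * n + j = i' * n + j' := by omega
  have hn : 0 < n := i.pos
  have h2 : (i : ℕ) = i' := by
    have := congrArg (· / n) h1
    simpa [Nat.add_div_of_dvd_right, Nat.mul_div_cancel _ hn, Nat.div_eq_of_lt, mul_comm _ n,
      Nat.mul_add_div hn] using this
  refine ⟨Fin.ext h2, Fin.ext ?_⟩
  rw [h2] at h1; omega

/-- The body is told only what the memory outside the target array contains, because the target is
partly overwritten when the body runs. Hence `val` has to be computable without reading the target.
-/
theorem runs_storeLoop {L : Limits} {n v k c1 c2 T : ℕ} {body : Prog} {s₀ : State}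
    (val : Fin n → Fin n → ℕ) (hn0 : 0 < n) (hv : 1 ≤ v) (hn : n < 2 ^ v)
    (hb : (c1 + c2 + 4) * v ≤ L.bits) (hr : 2 * k + 24 ≤ L.regs)
    (hcells : ∀ i j : Fin n, addr n c1 c2 n i j < L.cells)
    (hs : s₀.Within L) (h0 : s₀.reg 0 = n) (h1 : s₀.reg 1 = 1) (hx : s₀.reg (ixr 0) = 0)
    (hy : s₀.reg (ixr 1) = 0)
    (hbody : ∀ (i j : Fin n) (s : State), s.Within L →
      (∀ r, r ≠ ixr 0 → r ≠ ixr 1 → (r % 2 = 0 ∨ r < slot k) → s.reg r = s₀.reg r) →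
      s.reg (ixr 0) = i → s.reg (ixr 1) = j →
      (∀ x, (∀ i' j' : Fin n, x ≠ addr n c1 c2 n i' j') → s.mem x = s₀.mem x) →
      ∃ s', Runs L body s s' T ∧ s'.reg (slot (k + 2)) = val i j ∧ Frame (k + 2) s s') :
    ∃ s₁, Runs L (storeLoop k c1 c2 body) s₀ s₁ (n * (n * (T + 15) + 9) + 5) ∧
      (∀ r, (r % 2 = 0 ∨ r < slot k) → s₁.reg r = s₀.reg r) ∧
      (∀ i j : Fin n, s₁.mem (addr n c1 c2 n i j) = val i j) ∧
      ∀ x, (∀ i j : Fin n, x ≠ addr n c1 c2 n i j) → s₁.mem x = s₀.mem x := by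
  have hbits : n < 2 ^ L.bits := hn.trans_le (Nat.pow_le_pow_right (by norm_num) (by nlinarith))
  set I : ℕ → State → Prop := fun u t =>
    (∀ r, r ≠ ixr 0 → (r % 2 = 0 ∨ r < slot k) → t.reg r = s₀.reg r) ∧
    (∀ i j : Fin n, i.1 < u → t.mem (addr n c1 c2 n i j) = val i j) ∧
    ∀ x, (∀ i j : Fin n, x ≠ addr n c1 c2 n i j) → t.mem x = s₀.mem x with hI
  obtain ⟨s₁, r₁, ⟨a₁, a₂, a₃⟩, a₄⟩ := runs_forIdx (L := L) (ix := ixr 0) (cnt := slot k) (n := n)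
    (T := n * (T + 11 + 4) + 5) (body := forIdx (ixr 1) (slot (k + 1)) (body.seq
      (block (addrCode c1 c2 0 (ixr 0) (ixr 1) (slot (k + 3)) (slot (k + 4)) ++
      [Instr.store (slot (k + 3)) (slot (k + 2))])))) I
    (by unfold ixr; omega) (by unfold slot; omega) (by unfold slot ixr; omega)
    (by unfold ixr; omega) (by unfold slot; omega) hbits
    (by
      rintro w t t' ⟨g1, g2, g3⟩ gm gr
      refine ⟨fun r h1 h2 => ?_, by rwa [gm], by rwa [gm]⟩
      rw [gr r h1 (by unfold slot at *; omega), g1 r h1 h2])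
    (by
      rintro u t hu ht ⟨g1, g2, g3⟩ gx g0 g1'
      set J : ℕ → State → Prop := fun w q =>
        (∀ r, r ≠ ixr 1 → (r % 2 = 0 ∨ r < slot (k + 1)) → q.reg r = t.reg r) ∧
        (∀ i j : Fin n, i.1 < u ∨ i.1 = u ∧ j.1 < w → q.mem (addr n c1 c2 n i j) = val i j) ∧
        ∀ x, (∀ i j : Fin n, x ≠ addr n c1 c2 n i j) → q.mem x = s₀.mem x with hJ
      obtain ⟨t₁, r₁, ⟨b₁, b₂, b₃⟩, b₄⟩ := runs_forIdx (L := L) (ix := ixr 1) (cnt := slot (k + 1))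
        (n := n) (T := T + 11) (body := body.seq
          (block (addrCode c1 c2 0 (ixr 0) (ixr 1) (slot (k + 3)) (slot (k + 4)) ++
          [Instr.store (slot (k + 3)) (slot (k + 2))]))) J
        (by unfold ixr; omega) (by unfold slot; omega) (by unfold slot ixr; omega)
        (by unfold ixr; omega) (by unfold slot; omega) hbits
        (by
          rintro w q q' ⟨e1, e2, e3⟩ gm gr
          refine ⟨fun r h1 h2 => ?_, by rwa [gm], by rwa [gm]⟩
          rw [gr r h1 (by unfold slot at *; omega), e1 r h1 h2])
        (by
          rintro w q hw hq ⟨e1, e2, e3⟩ ey e0 e1'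
          have ex : q.reg (ixr 0) = u := by
            rw [e1 _ (by unfold ixr; omega) (by unfold ixr; omega), gx]
          obtain ⟨q₁, p₁, p₂, p₃⟩ := hbody ⟨u, hu⟩ ⟨w, hw⟩ q hq
            (by
              intro r hr1 hr2 hr3
              rw [e1 r hr2 (by unfold slot at *; omega), g1 r hr1 hr3]) ex ey e3
          have f0 := p₃.reg 0 (by simp)
          have f1 := p₃.reg 1 (by unfold slot; omega)
          have fx := p₃.reg (ixr 0) (by unfold ixr; omega)
          have fy := p₃.reg (ixr 1) (by unfold ixr; omega)
          obtain ⟨d1, d2, d3, d4⟩ := addrCode_spec (L := L) (c1 := c1) (c2 := c2) (st := 0)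
            (x := ixr 0) (y := ixr 1) (a := slot (k + 3)) (b := slot (k + 4)) (s := q₁)
            (by unfold slot; omega) (by unfold slot; omega) (by unfold slot; omega)
            (by unfold slot; omega) (by unfold slot; omega) (by omega)
            (by unfold slot ixr; omega) (by unfold slot ixr; omega) (by unfold slot ixr; omega)
            (by unfold slot ixr; omega) (f0.trans e0) (f1.trans e1') (fx.trans ex) (fy.trans ey)
            (f0.trans e0) hn0
            ((addr_lt hv hn le_rfl hu hw).trans_le (Nat.pow_le_pow_right (by norm_num) hb))
          have d5 : (runBlock (addrCode c1 c2 0 (ixr 0) (ixr 1) (slot (k + 3)) (slot (k + 4)))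
              q₁).reg (slot (k + 2)) = val ⟨u, hu⟩ ⟨w, hw⟩ := by
            rw [d4 _ (by unfold slot; omega) (by unfold slot; omega), p₂]
          have hc := hcells ⟨u, hu⟩ ⟨w, hw⟩
          have q₂ := runs_block (is := addrCode c1 c2 0 (ixr 0) (ixr 1) (slot (k + 3)) (slot (k + 4))
            ++ [Instr.store (slot (k + 3)) (slot (k + 2))]) p₁.1
            (blockSafe_append d1 ⟨by simp only [Instr.Safe]; rw [d2]; exact hc, trivial⟩)
          refine ⟨_, (p₁.seq q₂).mono (by simp [addrCode]), ⟨?_, ?_, ?_⟩, ?_⟩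
          · intro r hr1 hr2
            rw [runBlock_append]
            simp only [runBlock, Instr.run, State.setMem_reg]
            rw [d4 r (by unfold slot at *; omega) (by unfold slot at *; omega),
              p₃.reg r (by unfold slot at *; omega), e1 r hr1 hr2]
          · intro i j hij
            rw [runBlock_append]
            simp only [runBlock, Instr.run, State.setMem_mem, d2, d5, d3, p₃.mem]
            split_ifs with hE
            · obtain ⟨rfl, rfl⟩ := addr_inj (i' := ⟨u, hu⟩) (j' := ⟨w, hw⟩) hE; rfl
            · refine e2 i j ?_
              rcases hij with h | ⟨h, h'⟩
              · exact Or.inl h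
              · refine Or.inr ⟨h, ?_⟩
                rcases Nat.lt_succ_iff_lt_or_eq.1 h' with h'' | h''
                · exact h''
                · exact absurd (by rw [h, h'']) hE
          · intro x hx
            rw [runBlock_append]
            simp only [runBlock, Instr.run, State.setMem_mem, d2, d3, p₃.mem]
            rw [if_neg (hx ⟨u, hu⟩ ⟨w, hw⟩)]
            exact e3 x hx
          · intro r hr
            rw [runBlock_append]
            simp only [runBlock, Instr.run, State.setMem_reg]
            rw [d4 r (by unfold slot ixr at *; omega) (by unfold slot ixr at *; omega),
              p₃.reg r (by unfold slot ixr at *; omega)])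
        ht g0 g1' (by rw [g1 _ (by unfold ixr; omega) (by unfold ixr; omega), hy])
        ⟨fun _ _ _ => rfl, fun i j hij => g2 i j (by omega), g3⟩
      have b1' : ∀ r, (r % 2 = 0 ∨ r < slot (k + 1)) → t₁.reg r = t.reg r := by
        intro r hr
        by_cases h : r = ixr 1
        · rw [h, b₄, g1 _ (by unfold ixr; omega) (by unfold ixr; omega), hy]
        · exact b₁ r h hr
      refine ⟨t₁, r₁, ⟨?_, ?_, b₃⟩, ?_⟩
      · intro r hr1 hr2
        rw [b1' r (by unfold slot at *; omega), g1 r hr1 hr2]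
      · intro i j hi
        refine b₂ i j ?_
        rcases Nat.lt_succ_iff_lt_or_eq.1 hi with h | h
        · exact Or.inl h
        · exact Or.inr ⟨h, j.2⟩
      · intro r hr
        exact b1' r (by unfold slot ixr at *; omega))
    hs h0 h1 hx ⟨fun _ _ _ => rfl, fun i j h => absurd h (by omega), fun _ _ => rfl⟩
  refine ⟨s₁, r₁.mono (le_of_eq (by ring)), fun r hr => ?_, fun i j => a₂ i j i.2, a₃⟩
  by_cases h : r = ixr 0
  · rw [h, a₄, hx]
  · exact a₁ r h hr

/-- Load the entry `(i, j)` of an array into slot `k`. -/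
def loadEntry (k c1 c2 : ℕ) : Prog :=
  block (addrCode c1 c2 0 (ixr 0) (ixr 1) (slot k) (slot (k + 1)) ++
    [Instr.load (slot k) (slot k)])

theorem runs_loadEntry {L : Limits} {n v k c1 c2 : ℕ} {i j : Fin n} {s : State} (hv : 1 ≤ v)
    (hn : n < 2 ^ v) (hb : (c1 + c2 + 4) * v ≤ L.bits) (hr : 2 * k + 14 ≤ L.regs)
    (hs : s.Within L) (h0 : s.reg 0 = n) (h1 : s.reg 1 = 1) (hx : s.reg (ixr 0) = i)
    (hy : s.reg (ixr 1) = j) :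
    ∃ s', Runs L (loadEntry k c1 c2) s s' 11 ∧ s'.reg (slot k) = s.mem (addr n c1 c2 n i j) ∧
      Frame k s s' := by
  obtain ⟨g1, g2, g3, g4⟩ := addrCode_spec (L := L) (c1 := c1) (c2 := c2) (st := 0)
    (x := ixr 0) (y := ixr 1) (a := slot k) (b := slot (k + 1)) (s := s)
    (by unfold slot; omega) (by unfold slot; omega) (by unfold slot; omega)
    (by unfold slot; omega) (by unfold slot; omega) (by omega)
    (by unfold slot ixr; omega) (by unfold slot ixr; omega) (by unfold slot ixr; omega)
    (by unfold slot ixr; omega) h0 h1 hx hy h0 i.pos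
    ((addr_lt hv hn le_rfl i.2 j.2).trans_le (Nat.pow_le_pow_right (by norm_num) hb))
  have := runs_block (is := addrCode c1 c2 0 (ixr 0) (ixr 1) (slot k) (slot (k + 1)) ++
    [Instr.load (slot k) (slot k)]) hs (blockSafe_append g1
      ⟨by simp only [Instr.Safe, slot]; omega, trivial⟩)
  refine ⟨_, this.mono (by simp [addrCode]), ?_, ?_, ?_⟩
  · rw [runBlock_append]
    simp only [runBlock, Instr.run, State.setReg_reg, if_true, g2, g3]
  · rw [runBlock_append]; exact g3
  · intro r hr
    rw [runBlock_append, runBlock, runBlock, Instr.run, State.setReg_reg,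
      if_neg (by unfold slot at *; omega)]
    exact g4 r (by unfold slot at *; omega) (by unfold slot at *; omega)

/-- Copy an array. -/
def copyArray (k c1 c2 d1 d2 : ℕ) : Prog := storeLoop k c1 c2 (loadEntry (k + 2) d1 d2)

theorem runs_copyArray {L : Limits} {n v k c1 c2 d1 d2 : ℕ} {s₀ : State} (hn0 : 0 < n)
    (hv : 1 ≤ v) (hn : n < 2 ^ v) (hb : (c1 + c2 + 4) * v ≤ L.bits)
    (hb' : (d1 + d2 + 4) * v ≤ L.bits) (hr : 2 * k + 24 ≤ L.regs)
    (hcells : ∀ i j : Fin n, addr n c1 c2 n i j < L.cells)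
    (hdisj : ∀ i j i' j' : Fin n, addr n d1 d2 n i j ≠ addr n c1 c2 n i' j')
    (hs : s₀.Within L) (h0 : s₀.reg 0 = n) (h1 : s₀.reg 1 = 1) (hx : s₀.reg (ixr 0) = 0)
    (hy : s₀.reg (ixr 1) = 0) :
    ∃ s₁, Runs L (copyArray k c1 c2 d1 d2) s₀ s₁ (n * (n * 26 + 9) + 5) ∧
      (∀ r, (r % 2 = 0 ∨ r < slot k) → s₁.reg r = s₀.reg r) ∧
      (∀ i j : Fin n, s₁.mem (addr n c1 c2 n i j) = s₀.mem (addr n d1 d2 n i j)) ∧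
      ∀ x, (∀ i j : Fin n, x ≠ addr n c1 c2 n i j) → s₁.mem x = s₀.mem x := by
  refine runs_storeLoop (T := 11) (fun i j => s₀.mem (addr n d1 d2 n i j)) hn0 hv hn hb hr hcells
    hs h0 h1 hx hy ?_
  intro i j s hs hreg hi hj hm
  obtain ⟨s', r1, r2, r3⟩ := runs_loadEntry (k := k + 2) (c1 := d1) (c2 := d2) hv hn hb' (by omega)
    hs ((hreg 0 (by unfold ixr; omega) (by unfold ixr; omega) (by simp)).trans h0)
    ((hreg 1 (by unfold ixr; omega) (by unfold ixr; omega) (by unfold slot; omega)).trans h1) hi hj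
  exact ⟨s', r1, r2.trans (hm _ (fun i' j' => hdisj i j i' j')), r3⟩

/-- Commands: assign all entries of an array, capped at a fixed value; sequential composition;
repetition as often as there are vertices (`forN`) or guesses (`forG`). -/
inductive Cmd where
  | set (a : ℕ) (e : Expr)
  | seq (c₁ c₂ : Cmd)
  | forN (c : Cmd)
  | forG (c : Cmd)

def Env.set {n : ℕ} (E : Env n) (a : ℕ) (f : Fin n → Fin n → ℕ) : Env n
  | Src.arr b => if b = a then f else E (Src.arr b)
  | Src.inM => E Src.inM
  | Src.inK => E Src.inK
  | Src.inS => E Src.inS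

/-- The two outermost index variables have the given values. -/
def entryIdx {n : ℕ} (i j : Fin n) : ℕ → Fin n :=
  Function.update (Function.update (fun _ => ⟨0, i.pos⟩) 0 i) 1 j

/-- Capping every assigned value keeps all arrays below a fixed power of two, independently of the
number of loop rounds. For the algorithm itself the cap is chosen so large that it never takes
effect. -/
def Cmd.sem {n : ℕ} (cap N : ℕ) : Cmd → Env n → Env n
  | set a e, E => E.set a fun i j => min (e.ev E 2 (entryIdx i j)) cap
  | seq c₁ c₂, E => sem cap N c₂ (sem cap N c₁ E)
  | forN c, E => (sem cap N c)^[n] E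
  | forG c, E => (sem cap N c)^[N] E

/-- An assignment fills the scratch array first and copies it afterwards, so that every entry is
computed from the old contents. The two subtractions take the minimum with the cap in register `3`.
-/
def Cmd.comp : ℕ → Cmd → Prog
  | k, set a e => (storeLoop k 2 1 ((e.comp 2 (k + 2)).seq
      (block [Instr.sub (slot (k + 3)) (slot (k + 2)) 3,
        Instr.sub (slot (k + 2)) (slot (k + 2)) (slot (k + 3))]))).seq
      (copyArray k 2 (a + 2) 2 1)
  | k, seq c₁ c₂ => (comp k c₁).seq (comp k c₂)
  | k, forN c => (block [Instr.copy (slot k) 0]).seq (Prog.loop (slot k)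
      ((comp (k + 1) c).seq (block [Instr.sub (slot k) (slot k) 1])))
  | k, forG c => (block [Instr.copy (slot k) 2]).seq (Prog.loop (slot k)
      ((comp (k + 1) c).seq (block [Instr.sub (slot k) (slot k) 1])))

/-- Number of steps for executing a command. -/
noncomputable def Cmd.steps (n N : ℕ) : Cmd → ℕ
  | set _ e => (n * (n * (e.steps.eval n + 3 + 15) + 9) + 5) + (n * (n * 26 + 9) + 5)
  | seq c₁ c₂ => steps n N c₁ + steps n N c₂
  | forN c => 2 + (n * (steps n N c + 2 + 1) + 1)
  | forG c => 2 + (N * (steps n N c + 2 + 1) + 1)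

/-- A measure of commands that bounds the registers needed and the length of the values. -/
def Cmd.sz : Cmd → ℕ
  | set a e => e.sz + a + 10
  | seq c₁ c₂ => sz c₁ + sz c₂
  | forN c => sz c + 1
  | forG c => sz c + 1

theorem Env.set_lt {n b : ℕ} {E : Env n} {a : ℕ} {f : Fin n → Fin n → ℕ}
    (hE : ∀ x i j, E x i j < b) (hf : ∀ i j, f i j < b) : ∀ x i j, E.set a f x i j < b := by
  intro x i j
  cases x with
  | arr c =>
    simp only [Env.set]; split_ifs
    · exact hf i j
    · exact hE _ i j
  | inM => exact hE _ i j
  | inK => exact hE _ i j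
  | inS => exact hE _ i j

theorem Cmd.sem_lt {n cap N b : ℕ} (hcap : cap < b) (c : Cmd) :
    ∀ E : Env n, (∀ x i j, E x i j < b) → ∀ x i j, c.sem cap N E x i j < b := by
  have hit : ∀ (f : Env n → Env n), (∀ E : Env n, (∀ x i j, E x i j < b) →
      ∀ x i j, f E x i j < b) → ∀ (k : ℕ) (E : Env n), (∀ x i j, E x i j < b) →
      ∀ x i j, f^[k] E x i j < b := by
    intro f hf k
    induction k with
    | zero => exact fun E hE => hE
    | succ k ih => intro E hE; rw [Function.iterate_succ_apply]; exact ih _ (hf E hE)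
  induction c with
  | set a e => exact fun E hE => Env.set_lt hE fun i j => (min_le_right _ _).trans_lt hcap
  | seq c₁ c₂ h₁ h₂ => exact fun E hE => h₂ _ (h₁ E hE)
  | forN c h => exact hit _ h n
  | forG c h => exact hit _ h N

/-- The state holds the arrays, and the number of guesses and the cap in registers `2` and `3`. -/
structure Holds' (n cap N : ℕ) (E : Env n) (s : State) : Prop where
  dim : s.reg 0 = n
  one : s.reg 1 = 1
  zero : s.reg 9 = 0
  ix : ∀ x, s.reg (ixr x) = 0
  guesses : s.reg 2 = N
  cap : s.reg 3 = cap
  mem : ∀ (a : Src) (i j : Fin n), s.mem (addr n a.c1 a.c2 (a.stride n) i j) = E a i j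

theorem Holds'.of_reg {n cap N : ℕ} {E E' : Env n} {s s' : State} {k : ℕ} (h : Holds' n cap N E s)
    (hr : ∀ r, (r % 2 = 0 ∨ r < slot k) → s'.reg r = s.reg r)
    (hm : ∀ (a : Src) (i j : Fin n), s'.mem (addr n a.c1 a.c2 (a.stride n) i j) = E' a i j) :
    Holds' n cap N E' s' := by
  refine ⟨?_, ?_, ?_, fun x => ?_, ?_, ?_, hm⟩
  · rw [hr 0 (by simp), h.dim]
  · rw [hr 1 (by unfold slot; omega), h.one]
  · rw [hr 9 (by unfold slot; omega), h.zero]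
  · rw [hr _ (by unfold ixr; omega), h.ix]
  · rw [hr 2 (by unfold slot; omega), h.guesses]
  · rw [hr 3 (by unfold slot; omega), h.cap]

theorem addr_arr_ne {n d2 : ℕ} (hd : 1 ≤ d2) (a : Src) (ha : ∀ b, a = Src.arr b → b + 2 ≠ d2)
    (i j i' j' : Fin n) : addr n a.c1 a.c2 (a.stride n) i j ≠ addr n 2 d2 n i' j' := by
  have m1 : ∀ x : Fin n, (x : ℕ) * n + n ≤ n * n := fun x => by
    have := Nat.mul_le_mul_right n (show (x : ℕ) + 1 ≤ n from x.2)
    rwa [Nat.add_mul, one_mul] at this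
  have h1 := m1 i
  have h2 := m1 i'
  have h3 := i.2; have h4 := j.2; have h5 := j'.2
  have h6 : 1 * (n * n) ≤ d2 * (n * n) := Nat.mul_le_mul_right _ hd
  unfold addr
  cases a with
  | arr b =>
    have hb := ha b rfl
    simp only [Src.c1, Src.c2, Src.stride]
    rcases lt_or_gt_of_ne hb with h | h
    · have := Nat.mul_le_mul_right (n * n) (show b + 2 + 1 ≤ d2 from h)
      ring_nf at *; omega
    · have := Nat.mul_le_mul_right (n * n) (show d2 + 1 ≤ b + 2 from h)
      ring_nf at *; omega
  | inM => simp only [Src.c1, Src.c2, Src.stride]; ring_nf at *; omega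
  | inK => simp only [Src.c1, Src.c2, Src.stride]; ring_nf at *; omega
  | inS => simp only [Src.c1, Src.c2, Src.stride]; ring_nf at *; omega

theorem addr_lt_cells {n c d m : ℕ} (hd : d + 1 ≤ c) (i j : Fin n)
    (h : (c * n + 2) * n + 1 ≤ m) : addr n 2 d n i j < m := by
  have h1 := Nat.mul_le_mul_right n (show (i : ℕ) + 1 ≤ n from i.2)
  have h2 := Nat.mul_le_mul_right (n * n) hd
  have h3 := j.2
  unfold addr
  ring_nf at *; omega

/-- Entries remain below `2 ^ v` throughout by `Cmd.sem_lt`, so the limits depend only on the size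
of the code and not on the number of rounds. Both kinds of loops are covered by `loop`, with the
number of rounds in register `0` or `2`. -/
theorem Cmd.runs_comp {L : Limits} {n v cap N : ℕ} (hn0 : 0 < n) (hv : 1 ≤ v) (hn : n < 2 ^ v)
    (hcap : cap < 2 ^ v) (c : Cmd) :
    ∀ (k : ℕ) (E : Env n) (s : State), (∀ a i j, E a i j < 2 ^ v) → s.Within L →
      Holds' n cap N E s → c.sz * v ≤ L.bits → 2 * (k + c.sz) + 24 ≤ L.regs →
      (c.sz * n + 2) * n + 1 ≤ L.cells →
      ∃ s', Runs L (c.comp k) s s' (c.steps n N) ∧ Holds' n cap N (c.sem cap N E) s' ∧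
        ∀ r, (r % 2 = 0 ∨ r < slot k) → s'.reg r = s.reg r := by
  have loop : ∀ (k : ℕ) (c : Cmd) (x M : ℕ), (x = 0 ∨ x = 2) →
      (∀ (E : Env n) (s : State), (∀ a i j, E a i j < 2 ^ v) → s.Within L →
        Holds' n cap N E s →
        ∃ s', Runs L (c.comp (k + 1)) s s' (c.steps n N) ∧ Holds' n cap N (c.sem cap N E) s' ∧
          ∀ r, (r % 2 = 0 ∨ r < slot (k + 1)) → s'.reg r = s.reg r) →
      2 * k + 24 ≤ L.regs → ∀ (E : Env n) (s : State), (∀ a i j, E a i j < 2 ^ v) → s.Within L →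
        Holds' n cap N E s → s.reg x = M →
        ∃ s', Runs L ((block [Instr.copy (slot k) x]).seq (Prog.loop (slot k)
          ((comp (k + 1) c).seq (block [Instr.sub (slot k) (slot k) 1])))) s s'
          (2 + (M * (c.steps n N + 2 + 1) + 1)) ∧ Holds' n cap N ((c.sem cap N)^[M] E) s' ∧
        ∀ r, (r % 2 = 0 ∨ r < slot k) → s'.reg r = s.reg r := by
    intro k c x M hx ih hr E s hE hs hH hM
    have e1 : Runs L (block [Instr.copy (slot k) x]) s (s.setReg (slot k) M) 2 := by
      have := runs_block (L := L) (is := [Instr.copy (slot k) x]) hs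
        ⟨by simp only [Instr.Safe, slot]; omega, trivial⟩
      simpa [runBlock, Instr.run, hM] using this
    set J : ℕ → State → Prop := fun j t => j ≤ M ∧
      Holds' n cap N ((c.sem cap N)^[M - j] E) t ∧
      ∀ r, (r % 2 = 0 ∨ r < slot k) → t.reg r = s.reg r with hJ
    obtain ⟨s₂, hr₂, ⟨-, h₂, h₃⟩, -⟩ := Runs.countdown (L := L) (x := slot k)
      (P := (comp (k + 1) c).seq (block [Instr.sub (slot k) (slot k) 1]))
      (T := c.steps n N + 2) J
      (by
        rintro j t ht ⟨hj, hHt, hrt⟩ hjx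
        have hEt : ∀ a i j', ((c.sem cap N)^[M - (j + 1)] E) a i j' < 2 ^ v := by
          generalize M - (j + 1) = m
          induction m with
          | zero => exact hE
          | succ m ihm =>
            rw [Function.iterate_succ_apply']; exact Cmd.sem_lt hcap c _ ihm
        obtain ⟨t₁, q1, q2, q3⟩ := ih _ t hEt ht hHt
        have q4 := runs_block (L := L) (is := [Instr.sub (slot k) (slot k) 1]) q1.1
          ⟨by simp only [Instr.Safe, slot]; omega, trivial⟩
        refine ⟨_, (q1.seq q4).mono (by simp), ⟨by omega, ?_, ?_⟩, ?_⟩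
        · have hMj : M - j = (M - (j + 1)) + 1 := by omega
          rw [hMj, Function.iterate_succ_apply']
          refine q2.of_reg (k := k) (fun r hr => ?_) (fun a i j => q2.mem a i j)
          simp only [runBlock, Instr.run, State.setReg_reg]
          rw [if_neg (by unfold slot at *; omega)]
        · intro r hr
          simp only [runBlock, Instr.run, State.setReg_reg]
          rw [if_neg (by unfold slot at *; omega), q3 r (by unfold slot at *; omega), hrt r hr]
        · simp only [runBlock, Instr.run, State.setReg_reg, if_true]
          rw [q3 _ (by unfold slot; omega), q2.one, hjx]; omega)
      M (s.setReg (slot k) M) e1.1 ⟨le_rfl, by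
        rw [Nat.sub_self]
        refine hH.of_reg (k := k) (fun r hr => ?_) (fun a i j => hH.mem a i j)
        simp only [State.setReg_reg]
        rw [if_neg (by unfold slot at *; omega)], by
        intro r hr
        simp only [State.setReg_reg]
        rw [if_neg (by unfold slot at *; omega)]⟩ (by simp)
    exact ⟨s₂, e1.seq hr₂, h₂, h₃⟩
  induction c with
  | set a e =>
    intro k E s hE hs hH hb hr hcells
    simp only [Cmd.sz] at hb hr hcells
    have hb' : e.sz * v + (a + 10) * v ≤ L.bits := by rw [← Nat.add_mul]; convert hb using 2; omega
    have hav : 0 ≤ a * v := Nat.zero_le _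
    have hb1 : (2 + 1 + 4) * v ≤ L.bits := by nlinarith
    have hb2 : (2 + (a + 2) + 4) * v ≤ L.bits := by nlinarith
    have hb3 : e.sz * v ≤ L.bits := by omega
    obtain ⟨s₁, r₁, g₁, m₁, f₁⟩ := runs_storeLoop (L := L) (v := v) (k := k) (c1 := 2) (c2 := 1)
      (T := e.steps.eval n + 3) (body := (e.comp 2 (k + 2)).seq
      (block [Instr.sub (slot (k + 3)) (slot (k + 2)) 3,
        Instr.sub (slot (k + 2)) (slot (k + 2)) (slot (k + 3))])) (s₀ := s)
      (fun i j => min (e.ev E 2 (entryIdx i j)) cap) hn0 hv hn hb1 (by omega)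
      (fun i j => addr_lt_cells (by omega) i j hcells) hs hH.dim hH.one (hH.ix 0) (hH.ix 1)
      (by
        intro i j t ht hreg hi hj hm
        have hHt : Holds n E (entryIdx i j) t := by
          refine ⟨?_, ?_, ?_, fun x => ?_, fun b i' j' => ?_⟩
          · rw [hreg 0 (by unfold ixr; omega) (by unfold ixr; omega) (by simp), hH.dim]
          · rw [hreg 1 (by unfold ixr; omega) (by unfold ixr; omega) (by unfold slot; omega), hH.one]
          · rw [hreg 9 (by unfold ixr; omega) (by unfold ixr; omega) (by unfold slot; omega),
              hH.zero]
          · by_cases h1 : x = 1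
            · subst h1; simp [entryIdx, hj]
            · by_cases h0 : x = 0
              · subst h0; simp [entryIdx, hi]
              · rw [hreg _ (by unfold ixr; omega) (by unfold ixr; omega) (by unfold ixr; omega),
                  hH.ix]
                simp [entryIdx, h0, h1]
          · rw [hm _ (addr_arr_ne le_rfl b (fun _ _ => by omega) i' j'), hH.mem]
        obtain ⟨t₁, q1, q2, q3⟩ := Expr.runs_comp hn0 hv hn hE e 2 (k + 2) (entryIdx i j) t ht hHt
          (by
            intro x hx
            simp [entryIdx, show x ≠ 1 by omega, show x ≠ 0 by omega]) hb3 (by omega)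
        have hc : t₁.reg 3 = cap := by
          rw [q3.reg 3 (by unfold slot; omega), hreg 3 (by unfold ixr; omega) (by unfold ixr; omega)
            (by unfold slot; omega), hH.cap]
        have q4 := runs_block (L := L) (is := [Instr.sub (slot (k + 3)) (slot (k + 2)) 3,
          Instr.sub (slot (k + 2)) (slot (k + 2)) (slot (k + 3))]) q1.1
          ⟨by simp only [Instr.Safe, slot]; omega, by simp only [Instr.Safe, slot]; omega, trivial⟩
        refine ⟨_, q1.seq q4, ?_, q3.trans ⟨rfl, ?_⟩⟩
        · simp only [runBlock, Instr.run, State.setReg_reg, if_true]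
          rw [if_neg (by unfold slot; omega), q2, hc]; omega
        · intro r hr
          simp only [runBlock, Instr.run, State.setReg_reg]
          rw [if_neg (by unfold slot at *; omega), if_neg (by unfold slot at *; omega)])
    obtain ⟨s₂, r₂, g₂, m₂, f₂⟩ := runs_copyArray (L := L) (v := v) (k := k) (c1 := 2)
      (c2 := a + 2) (d1 := 2) (d2 := 1) (s₀ := s₁) hn0 hv hn hb2 hb1 (by omega)
      (fun i j => addr_lt_cells (by omega) i j hcells)
      (by
        intro i j i' j' h
        have h1 := Nat.mul_le_mul_right n (show (i : ℕ) + 1 ≤ n from i.2)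
        have h2 := Nat.mul_le_mul_right (n * n) (show 2 ≤ a + 2 by omega)
        have h3 := j.2
        unfold addr at h
        ring_nf at *; omega) r₁.1
      (by rw [g₁ 0 (by simp), hH.dim]) (by rw [g₁ 1 (by unfold slot; omega), hH.one])
      (by rw [g₁ _ (by unfold ixr; omega), hH.ix]) (by rw [g₁ _ (by unfold ixr; omega), hH.ix])
    have hreg : ∀ r, (r % 2 = 0 ∨ r < slot k) → s₂.reg r = s.reg r := fun r hr => by
      rw [g₂ r hr, g₁ r hr]
    refine ⟨s₂, r₁.seq r₂, hH.of_reg hreg fun b i j => ?_, hreg⟩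
    have hne : ∀ b : Src, b ≠ Src.arr a → s₂.mem (addr n b.c1 b.c2 (b.stride n) i j) = E b i j := by
      intro b hb
      rw [f₂ _ (addr_arr_ne (by omega) b (fun c hc h => hb (by rw [hc]; congr; omega)) i j),
        f₁ _ (addr_arr_ne le_rfl b (fun _ _ => by omega) i j), hH.mem]
    cases b with
    | arr b =>
      simp only [Cmd.sem, Env.set]
      split_ifs with hba
      · subst hba
        exact (m₂ i j).trans (m₁ i j)
      · exact hne (Src.arr b) (fun h => hba (by injection h))
    | inM => exact hne _ (by simp)
    | inK => exact hne _ (by simp)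
    | inS => exact hne _ (by simp)
  | seq c₁ c₂ h₁ h₂ =>
    intro k E s hE hs hH hb hr hcells
    simp only [Cmd.sz] at hb hr hcells
    have z1 := Nat.mul_le_mul_right v (show c₁.sz ≤ c₁.sz + c₂.sz by omega)
    have z2 := Nat.mul_le_mul_right v (show c₂.sz ≤ c₁.sz + c₂.sz by omega)
    have z3 := Nat.mul_le_mul_right (n * n) (show c₁.sz ≤ c₁.sz + c₂.sz by omega)
    have z4 := Nat.mul_le_mul_right (n * n) (show c₂.sz ≤ c₁.sz + c₂.sz by omega)
    obtain ⟨s₁, r₁, q₁, g₁⟩ := h₁ k E s hE hs hH (by omega) (by omega) (by nlinarith)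
    obtain ⟨s₂, r₂, q₂, g₂⟩ := h₂ k _ s₁ (Cmd.sem_lt hcap c₁ _ hE) r₁.1 q₁ (by omega) (by omega)
      (by nlinarith)
    exact ⟨s₂, r₁.seq r₂, q₂, fun r hr => by rw [g₂ r hr, g₁ r hr]⟩
  | forN c ih =>
    intro k E s hE hs hH hb hr hcells
    simp only [Cmd.sz] at hb hr hcells
    have z1 := Nat.mul_le_mul_right v (show c.sz ≤ c.sz + 1 by omega)
    have z3 := Nat.mul_le_mul_right (n * n) (show c.sz ≤ c.sz + 1 by omega)
    exact loop k c 0 n (Or.inl rfl) (fun E s hE hs hH => ih (k + 1) E s hE hs hH (by omega)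
      (by omega) (by nlinarith)) (by omega) E s hE hs hH hH.dim
  | forG c ih =>
    intro k E s hE hs hH hb hr hcells
    simp only [Cmd.sz] at hb hr hcells
    have z1 := Nat.mul_le_mul_right v (show c.sz ≤ c.sz + 1 by omega)
    have z3 := Nat.mul_le_mul_right (n * n) (show c.sz ≤ c.sz + 1 by omega)
    exact loop k c 2 N (Or.inr rfl) (fun E s hE hs hH => ih (k + 1) E s hE hs hH (by omega)
      (by omega) (by nlinarith)) (by omega) E s hE hs hH hH.guesses

end LogRAM

/-! ## Trees in a weighted graph -/

/-- `TreeIn G w v X c`: there is a tree in `G` with root `v`, vertex set `X` and weight `c`. -/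
inductive TreeIn {V : Type*} [DecidableEq V] (G : SimpleGraph V) (w : Sym2 V → ℕ) :
    V → Finset V → ℕ → Prop where
  | single (v : V) : TreeIn G w v {v} 0
  | step {v u : V} {X : Finset V} {c : ℕ} (h : G.Adj v u) (hT : TreeIn G w u X c)
      (hv : v ∉ X) : TreeIn G w v (insert v X) (c + w s(v, u))
  | join {v : V} {X Y : Finset V} {c d : ℕ} (hX : TreeIn G w v X c)
      (hY : TreeIn G w v Y d) (h : X ∩ Y = {v}) : TreeIn G w v (X ∪ Y) (c + d)

section

set_option linter.unusedSectionVars false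

variable {V : Type*} [DecidableEq V] {G : SimpleGraph V} {w : Sym2 V → ℕ}

theorem TreeIn.root_mem {v : V} {X : Finset V} {c : ℕ} (h : TreeIn G w v X c) :
    v ∈ X := by
  induction h with
  | single v => simp
  | step h hT hv ih => simp
  | join hX hY h ihX ihY => exact Finset.mem_union_left _ ihX

/-- The root is moved along one edge at a time. What hangs at the old root is carried along as `Y`:
when the root moves from `v` to its child, `Y` is extended by the edge between them and hung at the
child. Carrying `Y` is what makes the induction work; `TreeIn.reroot` is the case of a single
vertex. -/
theorem TreeIn.reroot_join {v : V} {X : Finset V} {c : ℕ} (h : TreeIn G w v X c) :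
    ∀ {u : V}, u ∈ X → ∀ {Y : Finset V} {d : ℕ}, TreeIn G w v Y d → X ∩ Y = {v} →
      TreeIn G w u (X ∪ Y) (c + d) := by
  induction h with
  | single v =>
    intro u hu Y d hY hXY
    rw [Finset.mem_singleton] at hu
    subst hu
    rw [Finset.union_eq_right.2 (by simpa using hY.root_mem), zero_add]
    exact hY
  | @step v v₁ X c hadj hT hv ih =>
    intro u hu Y d hY hXY
    by_cases huv : u = v
    · subst huv; exact (TreeIn.step hadj hT hv).join hY hXY
    · have hu' : u ∈ X := (Finset.mem_insert.1 hu).resolve_left huv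
      have h1 := hT.root_mem
      have hd : ∀ x ∈ X, x ∉ Y := by
        intro x hx hxY
        have : x ∈ insert v X ∩ Y := by simp [hx, hxY]
        rw [hXY, Finset.mem_singleton] at this
        exact hv (this ▸ hx)
      have := ih hu' (TreeIn.step hadj.symm hY (hd _ h1)) (by
        ext x
        simp only [Finset.mem_inter, Finset.mem_insert, Finset.mem_singleton]
        constructor
        · rintro ⟨hx, rfl | hx'⟩
          · rfl
          · exact absurd hx' (hd x hx)
        · rintro rfl; exact ⟨h1, Or.inl rfl⟩)
      have e1 : X ∪ insert v₁ Y = insert v X ∪ Y := by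
        ext x
        simp only [Finset.mem_union, Finset.mem_insert]
        constructor
        · rintro (h | rfl | h)
          · exact Or.inl (Or.inr h)
          · exact Or.inl (Or.inr h1)
          · exact Or.inr h
        · rintro ((rfl | h) | h)
          · exact Or.inr (Or.inr hY.root_mem)
          · exact Or.inl h
          · exact Or.inr (Or.inr h)
      rw [e1] at this
      have e2 : c + (d + w s(v₁, v)) = c + w s(v, v₁) + d := by rw [Sym2.eq_swap]; ring
      rwa [e2] at this
  | @join v X₁ X₂ c₁ c₂ hX hY h ih₁ ih₂ =>
    intro u hu Y d hYd hXY
    have key : ∀ x, x ∈ X₁ ∪ X₂ → x ∈ Y → x = v := by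
      intro x hx hxY
      have : x ∈ (X₁ ∪ X₂) ∩ Y := Finset.mem_inter.2 ⟨hx, hxY⟩
      rwa [hXY, Finset.mem_singleton] at this
    have key' : ∀ x, x ∈ X₁ → x ∈ X₂ → x = v := by
      intro x hx hxY
      have : x ∈ X₁ ∩ X₂ := Finset.mem_inter.2 ⟨hx, hxY⟩
      rwa [h, Finset.mem_singleton] at this
    have m1 := hX.root_mem
    have m2 := hY.root_mem
    have m3 := hYd.root_mem
    rcases Finset.mem_union.1 hu with hu | hu
    · have j := hY.join hYd (by
        ext x; simp only [Finset.mem_inter, Finset.mem_singleton]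
        exact ⟨fun hx => key x (by simp [hx.1]) hx.2, by rintro rfl; exact ⟨m2, m3⟩⟩)
      have := ih₁ hu j (by
        ext x; simp only [Finset.mem_inter, Finset.mem_singleton, Finset.mem_union]
        exact ⟨fun hx => hx.2.elim (key' x hx.1) (key x (by simp [hx.1])),
          by rintro rfl; exact ⟨m1, Or.inl m2⟩⟩)
      rwa [← Finset.union_assoc, ← add_assoc] at this
    · have j := hX.join hYd (by
        ext x; simp only [Finset.mem_inter, Finset.mem_singleton]
        exact ⟨fun hx => key x (by simp [hx.1]) hx.2, by rintro rfl; exact ⟨m1, m3⟩⟩)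
      have := ih₂ hu j (by
        ext x; simp only [Finset.mem_inter, Finset.mem_singleton, Finset.mem_union]
        exact ⟨fun hx => hx.2.elim (fun h => key' x h hx.1) (key x (by simp [hx.1])),
          by rintro rfl; exact ⟨m2, Or.inl m1⟩⟩)
      rw [← Finset.union_assoc, Finset.union_comm X₂ X₁] at this
      rwa [show c₁ + c₂ + d = c₂ + (c₁ + d) by ring]

theorem TreeIn.reroot {v u : V} {X : Finset V} {c : ℕ} (h : TreeIn G w v X c)
    (hu : u ∈ X) : TreeIn G w u X c := by
  have := h.reroot_join hu (TreeIn.single v) (by simpa using h.root_mem)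
  rwa [Finset.union_eq_left.2 (by simpa using h.root_mem), add_zero] at this

theorem TreeIn.grow {v x y : V} {X : Finset V} {c : ℕ} (h : TreeIn G w v X c)
    (hx : x ∈ X) (hy : y ∉ X) (hxy : G.Adj x y) :
    TreeIn G w v (insert y X) (c + w s(x, y)) := by
  have e : TreeIn G w x {x, y} (w s(x, y)) := by
    have := TreeIn.step (w := w) hxy (TreeIn.single y) (by simpa using hxy.ne)
    rwa [zero_add] at this
  have := (h.reroot hx).join e (by
    ext z; simp only [Finset.mem_inter, Finset.mem_insert, Finset.mem_singleton]
    constructor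
    · rintro ⟨hz, rfl | rfl⟩
      · rfl
      · exact absurd hz hy
    · rintro rfl; exact ⟨hx, Or.inl rfl⟩)
  have e2 : X ∪ {x, y} = insert y X := by
    ext z; simp only [Finset.mem_union, Finset.mem_insert, Finset.mem_singleton]
    constructor
    · rintro (h | rfl | h)
      · exact Or.inr h
      · exact Or.inr hx
      · exact Or.inl h
    · rintro (h | h)
      · exact Or.inr (Or.inr h)
      · exact Or.inl h
  rw [e2] at this
  exact this.reroot (Finset.mem_insert_of_mem h.root_mem)

open Classical in
/-- Total weight of the edges of a subgraph. -/
noncomputable def edgeWeight {V : Type*} [Fintype V] {G : SimpleGraph V} (w : Sym2 V → ℕ)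
    (H : G.Subgraph) : ℕ := ∑ e ∈ H.edgeSet.toFinset, w e

open Classical in
/-- A connected subgraph contains a spanning tree. -/
theorem exists_rootedTree [Fintype V] {G' : SimpleGraph V} {H : G'.Subgraph} (hH : H.Connected)
    (hG : ∀ u v, H.Adj u v → G.Adj u v) {v : V} (hv : v ∈ H.verts) :
    ∃ c, TreeIn G w v H.verts.toFinset c ∧ c ≤ edgeWeight w H := by
  -- Grow a tree along boundary edges. Its weight is charged only to edges of `H` inside `X`; an
  -- edge leaving `X` is not yet among these, so no edge is charged twice.
  have key : ∀ k, k + 1 ≤ H.verts.toFinset.card → ∃ (X : Finset V) (c : ℕ),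
      TreeIn G w v X c ∧ X ⊆ H.verts.toFinset ∧ X.card = k + 1 ∧
      c ≤ ∑ e ∈ H.edgeSet.toFinset with ∀ x ∈ e, x ∈ X, w e := by
    intro k
    induction k with
    | zero => exact fun _ => ⟨{v}, 0, .single v, by simpa using hv, by simp, Nat.zero_le _⟩
    | succ k ih =>
      intro hk
      obtain ⟨X, c, hT, hsub, hcard, hc⟩ := ih (by omega)
      obtain ⟨y, hyH, hyX⟩ : ∃ y ∈ H.verts.toFinset, y ∉ X := by
        by_contra! hcon
        have := Finset.card_le_card (show H.verts.toFinset ⊆ X from hcon)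
        omega
      have hyH' : y ∈ H.verts := by simpa using hyH
      obtain ⟨p⟩ := hH.coe.preconnected ⟨v, hv⟩ ⟨y, hyH'⟩
      obtain ⟨d, -, hd1, hd2⟩ := p.exists_boundary_dart {z | z.1 ∈ X} hT.root_mem hyX
      have hadj : H.Adj d.fst.1 d.snd.1 := d.adj
      refine ⟨insert d.snd.1 X, _, hT.grow hd1 hd2 (hG _ _ hadj), ?_, ?_, ?_⟩
      · intro z hz
        rcases Finset.mem_insert.1 hz with rfl | hz
        · simp
        · exact hsub hz
      · rw [Finset.card_insert_of_notMem hd2, hcard]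
      · have hmem : s(d.fst.1, d.snd.1) ∉
            H.edgeSet.toFinset.filter (fun e => ∀ x ∈ e, x ∈ X) := by
          simp only [Finset.mem_filter, not_and]
          intro _ hcon
          exact hd2 (hcon d.snd.1 (by simp))
        calc c + w s(d.fst.1, d.snd.1)
            ≤ ∑ e ∈ insert s(d.fst.1, d.snd.1)
                (H.edgeSet.toFinset.filter (fun e => ∀ x ∈ e, x ∈ X)), w e := by
              rw [Finset.sum_insert hmem, add_comm]; omega
          _ ≤ _ := by
              refine Finset.sum_le_sum_of_subset ?_
              intro e he
              rcases Finset.mem_insert.1 he with rfl | he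
              · simp only [Finset.mem_filter, Set.mem_toFinset, SimpleGraph.Subgraph.mem_edgeSet,
                  Sym2.mem_iff, Finset.mem_insert]
                refine ⟨hadj, ?_⟩
                rintro x (rfl | rfl)
                · exact Or.inr hd1
                · exact Or.inl rfl
              · simp only [Finset.mem_filter] at he ⊢
                exact ⟨he.1, fun x hx => Finset.mem_insert_of_mem (he.2 x hx)⟩
  have hpos : 1 ≤ H.verts.toFinset.card := Finset.card_pos.2 ⟨v, by simpa using hv⟩
  obtain ⟨X, c, hT, hsub, hcard, hc⟩ := key (H.verts.toFinset.card - 1) (by omega)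
  have hX : X = H.verts.toFinset := Finset.eq_of_subset_of_card_le hsub (by omega)
  subst hX
  exact ⟨c, hT, hc.trans (Finset.sum_le_sum_of_subset (Finset.filter_subset _ _))⟩

/-- There is a connected subgraph of `G` that contains `A` and has weight at most `c`. -/
def Connects [Fintype V] (G : SimpleGraph V) (w : Sym2 V → ℕ) (A : Finset V) (c : ℕ) : Prop :=
  ∃ H : (⊤ : SimpleGraph V).Subgraph, H.Connected ∧ (∀ v ∈ A, v ∈ H.verts) ∧
    (∀ u v, H.Adj u v → G.Adj u v) ∧ edgeWeight w H ≤ c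

variable [Fintype V]

theorem Connects.mono {A A' : Finset V} {c c' : ℕ} (h : Connects G w A c) (hA : A' ⊆ A)
    (hc : c ≤ c') : Connects G w A' c' := by
  obtain ⟨H, h1, h2, h3, h4⟩ := h
  exact ⟨H, h1, fun v hv => h2 v (hA hv), h3, h4.trans hc⟩

/-- The witness is a subgraph of the complete graph with its edges required to lie in `G`, so the
same witness serves when the graph changes. -/
theorem Connects.mono_graph {G' : SimpleGraph V} {A : Finset V} {c : ℕ} (h : Connects G w A c)
    (hG : G ≤ G') : Connects G' w A c := by
  obtain ⟨H, h1, h2, h3, h4⟩ := h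
  exact ⟨H, h1, h2, fun u v huv => hG (h3 u v huv), h4⟩

theorem Connects.union {A A' : Finset V} {c c' : ℕ} {v : V} (h : Connects G w A c)
    (h' : Connects G w A' c') (hv : v ∈ A) (hv' : v ∈ A') :
    Connects G w (A ∪ A') (c + c') := by
  classical
  obtain ⟨H, h1, h2, h3, h4⟩ := h
  obtain ⟨H', h1', h2', h3', h4'⟩ := h'
  refine ⟨H ⊔ H', SimpleGraph.Subgraph.connected_sup h1.preconnected h1'.preconnected
    ⟨v, h2 v hv, h2' v hv'⟩, ?_, ?_, ?_⟩
  · intro x hx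
    rcases Finset.mem_union.1 hx with hx | hx
    · exact Or.inl (h2 x hx)
    · exact Or.inr (h2' x hx)
  · rintro x y (hxy | hxy)
    · exact h3 x y hxy
    · exact h3' x y hxy
  · refine le_trans ?_ (Nat.add_le_add h4 h4')
    unfold edgeWeight
    rw [← Finset.sum_union_inter]
    refine le_trans (Finset.sum_le_sum_of_subset ?_) (Nat.le_add_right _ _)
    intro e he
    simpa using he

theorem connects_singleton (v : V) : Connects G w {v} 0 := by
  classical
  refine ⟨(⊤ : SimpleGraph V).singletonSubgraph v, SimpleGraph.Subgraph.singletonSubgraph_connected,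
    by simp, by simp, ?_⟩
  unfold edgeWeight
  refine (Finset.sum_eq_zero fun e he => ?_).le
  simp at he

theorem connects_pair {u v : V} (h : G.Adj u v) : Connects G w {u, v} (w s(u, v)) := by
  classical
  refine ⟨(⊤ : SimpleGraph V).subgraphOfAdj (show (⊤ : SimpleGraph V).Adj u v from h.ne),
    SimpleGraph.Subgraph.subgraphOfAdj_connected _, by simp, ?_, ?_⟩
  · intro x y hxy
    have hxy' : s(u, v) = s(x, y) := hxy
    rcases Sym2.eq_iff.1 hxy' with ⟨rfl, rfl⟩ | ⟨rfl, rfl⟩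
    · exact h
    · exact h.symm
  · unfold edgeWeight
    have : (((⊤ : SimpleGraph V).subgraphOfAdj
        (show (⊤ : SimpleGraph V).Adj u v from h.ne)).edgeSet).toFinset = {s(u, v)} := by
      ext e; simp [SimpleGraph.edgeSet_subgraphOfAdj]
    rw [this, Finset.sum_singleton]

end

/-! ## Assembling trees from partial trees at the vertices of a multiway cut -/

/-- For every living slot (a vertex of the cut), `X v u` is the weight of the partial tree of slot
`v` when extended to the vertex `u`. -/
structure Core (V : Type*) where
  al : Finset V
  X : V → V → ℕ

/-- Operations: drop slot `v`; merge the partial tree of slot `v` into that of slot `u`; complete the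
partial tree of slot `u`, containing the terminal `t` or no terminal outside the cut. -/
inductive Op (V : Type*) where
  | skip
  | drop (v : V)
  | merge (v u : V)
  | close (u : V)
  | closeT (u t : V)

/-- Weight of the union of two partial trees, extended to a vertex, and capped at `B`. -/
def closure₂ {V : Type*} [Fintype V] (B : ℕ) (D : V → V → ℕ) (f g : V → ℕ) (v : V) : ℕ :=
  Finset.univ.fold min B fun u => f u + g u + D u v

section

set_option linter.unusedSectionVars false

variable {V : Type*} [DecidableEq V] [Fintype V] (B : ℕ) (D : V → V → ℕ)

/-- Completing a tree makes the slot fresh again, with `D u` as its partial weights. The new state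
does not depend on the terminal of `closeT`; the exchange argument for terminals rests on this. -/
def Core.app (σ : Core V) : Op V → Core V
  | .skip => σ
  | .drop v => ⟨σ.al.erase v, σ.X⟩
  | .merge v u => ⟨σ.al.erase v, Function.update σ.X u (closure₂ B D (σ.X v) (σ.X u))⟩
  | .close u => ⟨σ.al, Function.update σ.X u (D u)⟩
  | .closeT u _ => ⟨σ.al, Function.update σ.X u (D u)⟩

def Core.Allows (σ : Core V) : Op V → Prop
  | .skip => True
  | .drop v => v ∈ σ.al
  | .merge v u => v ∈ σ.al ∧ u ∈ σ.al ∧ v ≠ u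
  | .close u => u ∈ σ.al
  | .closeT u _ => u ∈ σ.al

/-- Weight of the tree completed by an operation. -/
def Core.cost (σ : Core V) : Op V → ℕ
  | .skip => 0
  | .drop _ => 0
  | .merge _ _ => 0
  | .close u => σ.X u u
  | .closeT u t => σ.X u t

def Core.run (σ : Core V) : List (Op V) → Core V
  | [] => σ
  | o :: l => Core.run (σ.app B D o) l

def Core.AllowsAll (σ : Core V) : List (Op V) → Prop
  | [] => True
  | o :: l => σ.Allows o ∧ Core.AllowsAll (σ.app B D o) l

def Core.gain (σ : Core V) : List (Op V) → ℕ
  | [] => 0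
  | o :: l => σ.cost o + Core.gain (σ.app B D o) l

/-- The terminals chosen in a list of operations. -/
def Op.terms : List (Op V) → List V
  | [] => []
  | .closeT _ t :: l => t :: terms l
  | .skip :: l => terms l
  | .drop _ :: l => terms l
  | .merge _ _ :: l => terms l
  | .close _ :: l => terms l

/-- The operations into which a tree is decomposed. All drops precede them, and `skip` is only
padding. -/
def Op.IsProper : Op V → Prop
  | .skip => False
  | .drop _ => False
  | .merge _ _ => True
  | .close _ => True
  | .closeT _ _ => True

variable {B D}

theorem Core.run_append (σ : Core V) (l l' : List (Op V)) :
    σ.run B D (l ++ l') = (σ.run B D l).run B D l' := by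
  induction l generalizing σ with
  | nil => rfl
  | cons o l ih => exact ih _

theorem Core.allowsAll_append {σ : Core V} {l l' : List (Op V)} (h : σ.AllowsAll B D l)
    (h' : (σ.run B D l).AllowsAll B D l') : σ.AllowsAll B D (l ++ l') := by
  induction l generalizing σ with
  | nil => exact h'
  | cons o l ih => exact ⟨h.1, ih h.2 h'⟩

theorem Core.gain_append (σ : Core V) (l l' : List (Op V)) :
    σ.gain B D (l ++ l') = σ.gain B D l + (σ.run B D l).gain B D l' := by
  induction l generalizing σ with
  | nil => simp [Core.gain, Core.run]
  | cons o l ih => simp only [List.cons_append, Core.gain, Core.run, ih, add_assoc]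

theorem Op.terms_append (l l' : List (Op V)) : Op.terms (l ++ l') = Op.terms l ++ Op.terms l' := by
  induction l with
  | nil => rfl
  | cons o l ih => cases o <;> simp [Op.terms, ih]

theorem closure₂_le_iff {f g : V → ℕ} {v : V} {c : ℕ} :
    closure₂ B D f g v ≤ c ↔ B ≤ c ∨ ∃ u, f u + g u + D u v ≤ c := by
  simp [closure₂, Finset.fold_min_le]

theorem closure₂_lip (htri : ∀ u x v, D u v ≤ D u x + D x v) (f g : V → ℕ) (x y : V) :
    closure₂ B D f g y ≤ closure₂ B D f g x + D x y := by
  rw [closure₂_le_iff]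
  rcases closure₂_le_iff.1 (le_refl (closure₂ B D f g x)) with h | ⟨u, h⟩
  · left; omega
  · right; exact ⟨u, by have := htri u x y; omega⟩

variable (B D) in
/-- From fresh slots `A`, merging yields, at slot `p`, a partial tree of weight at most `c` when
extended to `t`. -/
def Mergeable (t : V) (A : Finset V) (c : ℕ) : Prop :=
  ∀ p ∈ A, ∀ σ : Core V, (∀ b ∈ A, b ∈ σ.al ∧ σ.X b = D b) → ∃ l : List (Op V),
    σ.AllowsAll B D l ∧ (∀ o ∈ l, o.IsProper) ∧ Op.terms l = [] ∧ σ.gain B D l = 0 ∧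
    l.length + 1 = A.card ∧ (σ.run B D l).al = σ.al \ A.erase p ∧
    (∀ b ∉ A, (σ.run B D l).X b = σ.X b) ∧
    (∀ x y, (σ.run B D l).X p y ≤ (σ.run B D l).X p x + D x y) ∧ (σ.run B D l).X p t ≤ c

theorem Mergeable.mono {t : V} {A : Finset V} {c c' : ℕ} (h : Mergeable B D t A c) (hc : c ≤ c') :
    Mergeable B D t A c' := by
  intro p hp σ hσ
  obtain ⟨l, h1, h2, h3, h4, h5, h6, h7, h8, h9⟩ := h p hp σ hσ
  exact ⟨l, h1, h2, h3, h4, h5, h6, h7, h8, h9.trans hc⟩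

/-- This is the purpose of the Lipschitz clause in `Mergeable`: a partial tree that reaches `u` can
be prolonged to `t` by a shortest path. -/
theorem Mergeable.move {t u : V} {A : Finset V} {c : ℕ} (h : Mergeable B D u A c) :
    Mergeable B D t A (c + D u t) := by
  intro p hp σ hσ
  obtain ⟨l, h1, h2, h3, h4, h5, h6, h7, h8, h9⟩ := h p hp σ hσ
  exact ⟨l, h1, h2, h3, h4, h5, h6, h7, h8, (h8 u t).trans (Nat.add_le_add_right h9 _)⟩

theorem mergeable_single (htri : ∀ u x v, D u v ≤ D u x + D x v) (b t : V) :
    Mergeable B D t {b} (D b t) := by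
  intro p hp σ hσ
  rw [Finset.mem_singleton] at hp
  subst hp
  have := (hσ p (by simp)).2
  refine ⟨[], trivial, by simp, rfl, rfl, by simp, by simp [Core.run], fun _ _ => rfl, ?_, ?_⟩
  · intro x y; simpa [Core.run, this] using htri p x y
  · simp [Core.run, this]

/-- The two lists act on disjoint slots and can be run one after the other. Then the survivor `q` of
`A'` is merged into the survivor `p` of `A`, with `t` as meeting vertex. The numbers of merges add
up as `(|A| - 1) + (|A'| - 1) + 1`. -/
theorem Mergeable.union_left (htri : ∀ u x v, D u v ≤ D u x + D x v) (h0 : ∀ v, D v v = 0) {t : V}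
    {A A' : Finset V} {c c' : ℕ} (h : Mergeable B D t A c) (h' : Mergeable B D t A' c')
    (hd : Disjoint A A') (hA' : A'.Nonempty) {p : V} (hp : p ∈ A) {σ : Core V}
    (hσ : ∀ b ∈ A ∪ A', b ∈ σ.al ∧ σ.X b = D b) : ∃ l : List (Op V),
    σ.AllowsAll B D l ∧ (∀ o ∈ l, o.IsProper) ∧ Op.terms l = [] ∧ σ.gain B D l = 0 ∧
    l.length + 1 = (A ∪ A').card ∧ (σ.run B D l).al = σ.al \ (A ∪ A').erase p ∧
    (∀ b ∉ A ∪ A', (σ.run B D l).X b = σ.X b) ∧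
    (∀ x y, (σ.run B D l).X p y ≤ (σ.run B D l).X p x + D x y) ∧
    (σ.run B D l).X p t ≤ c + c' := by
  obtain ⟨q, hq⟩ := hA'
  have hdis : ∀ x, x ∈ A → x ∉ A' := fun _ h => Finset.disjoint_left.1 hd h
  obtain ⟨l, h1, h2, h3, h4, h5, h6, h7, h8, h9⟩ :=
    h p hp σ (fun b hb => hσ b (Finset.mem_union_left _ hb))
  have hfresh : ∀ b ∈ A', b ∈ (σ.run B D l).al ∧ (σ.run B D l).X b = D b := by
    intro b hb
    have hbA : b ∉ A := fun h => hdis b h hb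
    have := hσ b (Finset.mem_union_right _ hb)
    rw [h6, h7 b hbA]
    simp [this.1, this.2, hbA]
  obtain ⟨l', k1, k2, k3, k4, k5, k6, k7, k8, k9⟩ := h' q hq _ hfresh
  set τ := (σ.run B D l).run B D l' with hτ
  have hpA' : p ∉ A' := hdis p hp
  have hpq : q ≠ p := fun e => hpA' (e ▸ hq)
  have hXp : τ.X p = (σ.run B D l).X p := k7 p hpA'
  have hrun : σ.run B D (l ++ (l' ++ [Op.merge q p])) = τ.app B D (.merge q p) := by
    rw [Core.run_append, Core.run_append]; rfl
  have hXnew : (τ.app B D (.merge q p)).X p = closure₂ B D (τ.X q) (τ.X p) := by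
    simp [Core.app]
  refine ⟨l ++ (l' ++ [Op.merge q p]), ?_, ?_, ?_, ?_, ?_, ?_, ?_, ?_, ?_⟩
  · refine Core.allowsAll_append h1 (Core.allowsAll_append k1 ⟨⟨?_, ?_, hpq⟩, trivial⟩)
    · rw [k6, h6]
      simp [(hσ q (by simp [hq])).1, show q ∉ A from fun h => hdis q h hq]
    · rw [k6, h6]
      simp [(hσ p (by simp [hp])).1, hpA']
  · intro o ho
    simp only [List.mem_append, List.mem_singleton] at ho
    rcases ho with ho | ho | rfl
    · exact h2 o ho
    · exact k2 o ho
    · trivial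
  · simp [Op.terms_append, h3, k3, Op.terms]
  · simp [Core.gain_append, h4, k4, Core.gain, Core.cost]
  · rw [Finset.card_union_of_disjoint hd]
    simp only [List.length_append, List.length_singleton]; omega
  · rw [hrun]
    simp only [Core.app]
    rw [k6, h6]
    ext x
    simp only [Finset.mem_erase, Finset.mem_sdiff, Finset.mem_union]
    by_cases hxq : x = q
    · subst hxq; simp [hpq, hq]
    · by_cases hxp : x = p
      · subst hxp; simp [hxq, hpA']
      · simp only [ne_eq, hxq, not_false_eq_true, hxp, true_and]; tauto
  · intro b hb
    rw [Finset.mem_union, not_or] at hb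
    have hbp : b ≠ p := fun e => hb.1 (e ▸ hp)
    rw [hrun]
    simp only [Core.app, Function.update_of_ne hbp]
    rw [k7 b hb.2, h7 b hb.1]
  · intro x y
    rw [hrun, hXnew]
    exact closure₂_lip htri _ _ x y
  · rw [hrun, hXnew, closure₂_le_iff]
    right
    refine ⟨t, ?_⟩
    rw [hXp, h0]; omega

theorem Mergeable.union (htri : ∀ u x v, D u v ≤ D u x + D x v) (h0 : ∀ v, D v v = 0) {t : V}
    {A A' : Finset V} {c c' : ℕ} (h : Mergeable B D t A c) (h' : Mergeable B D t A' c')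
    (hd : Disjoint A A') (hA : A.Nonempty) (hA' : A'.Nonempty) :
    Mergeable B D t (A ∪ A') (c + c') := by
  intro p hp σ hσ
  rcases Finset.mem_union.1 hp with hp | hp
  · exact Mergeable.union_left htri h0 h h' hd hA' hp hσ
  · rw [Finset.union_comm] at hσ ⊢
    rw [add_comm]
    exact Mergeable.union_left htri h0 h' h hd.symm hA hp hσ

variable {G : SimpleGraph V} {w : Sym2 V → ℕ}

/-- A subset of the vertices of a tree can be merged within the weight of the tree. -/
theorem TreeIn.mergeable (htri : ∀ u x v, D u v ≤ D u x + D x v) (h0 : ∀ v, D v v = 0)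
    (hadj : ∀ u v, G.Adj u v → D u v ≤ w s(u, v)) {t : V} {X : Finset V} {c : ℕ}
    (hT : TreeIn G w t X c) : ∀ A : Finset V, A ⊆ X → A.Nonempty → Mergeable B D t A c := by
  induction hT with
  | single v =>
    intro A hA hne
    rw [(Finset.subset_singleton_iff.1 hA).resolve_left hne.ne_empty]
    exact (mergeable_single htri v v).mono (h0 v).le
  | @step v u X c h hT hv ih =>
    intro A hA hne
    have hsub : A.erase v ⊆ X := by
      intro x hx
      rw [Finset.mem_erase] at hx
      exact (Finset.mem_insert.1 (hA hx.2)).resolve_left hx.1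
    have hD : D u v ≤ w s(v, u) := by rw [Sym2.eq_swap]; exact hadj u v h.symm
    -- If the new root is a slot itself, it is merged for free, since its fresh partial tree has
    -- weight `D v v = 0` at `v`.
    by_cases hvA : v ∈ A
    · by_cases hne' : (A.erase v).Nonempty
      · have := ((mergeable_single (B := B) htri v v).union htri h0 ((ih _ hsub hne').move (t := v))
          (by simp) (by simp) hne')
        rw [← Finset.insert_eq, Finset.insert_erase hvA] at this
        exact this.mono (by rw [h0]; omega)
      · rw [Finset.not_nonempty_iff_eq_empty, Finset.erase_eq_empty_iff] at hne'
        rw [hne'.resolve_left hne.ne_empty]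
        exact (mergeable_single htri v v).mono (by rw [h0]; omega)
    · rw [Finset.erase_eq_of_notMem hvA] at hsub
      exact (ih A hsub hne).move.mono (by omega)
  | @join v X Y c d hX hY h ihX ihY =>
    intro A hA hne
    -- The common root may be a slot; splitting `A` into `A ∩ X` and `A \ X` assigns it to only one
    -- side.
    have hsub : A \ X ⊆ Y := by
      intro x hx
      rw [Finset.mem_sdiff] at hx
      exact (Finset.mem_union.1 (hA hx.1)).resolve_left hx.2
    by_cases h1 : (A ∩ X).Nonempty
    · by_cases h2 : (A \ X).Nonempty
      · have := (ihX _ Finset.inter_subset_right h1).union htri h0 (ihY _ hsub h2)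
          (by
            rw [Finset.disjoint_left]
            intro x hx hx'
            exact (Finset.mem_sdiff.1 hx').2 (Finset.mem_inter.1 hx).2) h1 h2
        have e : A ∩ X ∪ A \ X = A := by ext x; simp; tauto
        rwa [e] at this
      · rw [Finset.not_nonempty_iff_eq_empty, Finset.sdiff_eq_empty_iff_subset] at h2
        exact (ihX A h2 hne).mono (by omega)
    · rw [Finset.not_nonempty_iff_eq_empty, ← Finset.disjoint_iff_inter_eq_empty] at h1
      rw [Finset.sdiff_eq_self_of_disjoint h1] at hsub
      exact (ihY A hsub hne).mono (by omega)

/-- Needed for pieces with a single slot, whose terminal is attached by a shortest path instead of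
by an operation. -/
theorem TreeIn.dist_le (htri : ∀ u x v, D u v ≤ D u x + D x v) (h0 : ∀ v, D v v = 0)
    (hadj : ∀ u v, G.Adj u v → D u v ≤ w s(u, v)) {v : V} {X : Finset V} {c : ℕ}
    (hT : TreeIn G w v X c) : ∀ x ∈ X, D v x ≤ c := by
  induction hT with
  | single v => intro x hx; rw [Finset.mem_singleton.1 hx, h0]
  | @step v u X c h hT hv ih =>
    intro x hx
    rcases Finset.mem_insert.1 hx with rfl | hx
    · rw [h0]; omega
    · have := ih x hx
      have := htri v u x
      have := hadj v u h
      omega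
  | join hX hY h ihX ihY =>
    intro x hx
    rcases Finset.mem_union.1 hx with hx | hx
    · have := ihX x hx; omega
    · have := ihY x hx; omega

variable (B D) in
/-- The operations `l` use up the slots `Z` and connect the terminals `T` to the remaining slots, at
total weight `c`; terminals that are not chosen by the operations are connected at weight `d`. -/
structure Handles (d : V → ℕ) (σ : Core V) (Z T : Finset V) (l : List (Op V)) (c : ℕ) : Prop where
  allows : σ.AllowsAll B D l
  proper : ∀ o ∈ l, o.IsProper
  al : (σ.run B D l).al = σ.al \ Z
  rest : ∀ b ∉ Z, (σ.run B D l).X b = σ.X b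
  nodup : (Op.terms l).Nodup
  terms : ∀ t ∈ Op.terms l, t ∈ T
  cost : σ.gain B D l + ∑ t ∈ T \ (Op.terms l).toFinset, d t ≤ c
  length : l.length ≤ 2 * Z.card
  length_terms : (Op.terms l).length ≤ Z.card

variable {d : V → ℕ}

theorem handles_nil (σ : Core V) (T : Finset V) : Handles B D d σ ∅ T [] (∑ t ∈ T, d t) :=
  ⟨trivial, by simp, by simp [Core.run], fun _ _ => rfl, by simp [Op.terms], by simp [Op.terms],
    by simp [Op.terms, Core.gain], by simp, by simp [Op.terms]⟩

/-- Operations on disjoint sets of slots do not interfere, so all costs add up. The second list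
starts from the state that the first one leaves. -/
theorem Handles.append {σ : Core V} {Z T Z' T' : Finset V} {l l' : List (Op V)} {c c' : ℕ}
    (h : Handles B D d σ Z T l c) (h' : Handles B D d (σ.run B D l) Z' T' l' c')
    (hZ : Disjoint Z Z') (hT : Disjoint T T') :
    Handles B D d σ (Z ∪ Z') (T ∪ T') (l ++ l') (c + c') := by
  refine ⟨Core.allowsAll_append h.allows h'.allows, ?_, ?_, ?_, ?_, ?_, ?_, ?_, ?_⟩
  · intro o ho
    rcases List.mem_append.1 ho with ho | ho
    · exact h.proper o ho
    · exact h'.proper o ho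
  · rw [Core.run_append, h'.al, h.al]
    ext x; simp only [Finset.mem_sdiff, Finset.mem_union]; tauto
  · intro b hb
    rw [Finset.mem_union, not_or] at hb
    rw [Core.run_append, h'.rest b hb.2, h.rest b hb.1]
  · rw [Op.terms_append]
    refine List.Nodup.append h.nodup h'.nodup ?_
    intro x hx hx'
    exact Finset.disjoint_left.1 hT (h.terms x hx) (h'.terms x hx')
  · intro t ht
    rw [Op.terms_append, List.mem_append] at ht
    rcases ht with ht | ht
    · exact Finset.mem_union_left _ (h.terms t ht)
    · exact Finset.mem_union_right _ (h'.terms t ht)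
  · have e : ((T ∪ T') \ (Op.terms (l ++ l')).toFinset) ⊆
        (T \ (Op.terms l).toFinset) ∪ (T' \ (Op.terms l').toFinset) := by
      intro x
      simp only [Op.terms_append, List.toFinset_append, Finset.mem_sdiff, Finset.mem_union]
      tauto
    have h1 := Finset.sum_le_sum_of_subset (f := d) e
    have h2 := Finset.sum_union_inter (s₁ := T \ (Op.terms l).toFinset)
      (s₂ := T' \ (Op.terms l').toFinset) (f := d)
    have h3 := h.cost
    have h4 := h'.cost
    rw [Core.gain_append]
    omega
  · rw [Finset.card_union_of_disjoint hZ, List.length_append]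
    have := h.length; have := h'.length; omega
  · rw [Finset.card_union_of_disjoint hZ, Op.terms_append, List.length_append]
    have := h.length_terms; have := h'.length_terms; omega

/-- Merge slots and complete the resulting tree. -/
theorem Mergeable.handles {σ : Core V} {A T : Finset V} {r v : V} {c : ℕ} (o : Op V)
    (ho : (o = .close v ∧ r = v ∧ T = ∅) ∨ (o = .closeT v r ∧ T = {r}))
    (h : Mergeable B D r A c) (hv : v ∈ A) (hA : 2 ≤ A.card)
    (hσ : ∀ b ∈ A, b ∈ σ.al ∧ σ.X b = D b) :
    ∃ l, Handles B D d σ (A.erase v) T l c := by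
  obtain ⟨l, h1, h2, h3, h4, h5, h6, h7, h8, h9⟩ := h v hv σ hσ
  have hcard : (A.erase v).card + 1 = A.card := Finset.card_erase_add_one hv
  have hal : v ∈ (σ.run B D l).al := by rw [h6]; simp [(hσ v hv).1]
  have happ : (σ.run B D l).app B D o =
      ⟨(σ.run B D l).al, Function.update (σ.run B D l).X v (D v)⟩ := by
    rcases ho with ⟨rfl, -⟩ | ⟨rfl, -⟩ <;> rfl
  have hrun : σ.run B D (l ++ [o]) =
      ⟨(σ.run B D l).al, Function.update (σ.run B D l).X v (D v)⟩ := by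
    rw [Core.run_append, ← happ]; rfl
  refine ⟨l ++ [o], Core.allowsAll_append h1 ⟨?_, trivial⟩, ?_, ?_, ?_, ?_, ?_, ?_, ?_, ?_⟩
  · rcases ho with ⟨rfl, -⟩ | ⟨rfl, -⟩ <;> exact hal
  · intro o' ho'
    rcases List.mem_append.1 ho' with ho' | ho'
    · exact h2 o' ho'
    · rw [List.mem_singleton.1 ho']
      rcases ho with ⟨rfl, -⟩ | ⟨rfl, -⟩ <;> trivial
  · rw [hrun]; exact h6
  · intro b hb
    rw [hrun]
    by_cases hbv : b = v
    · subst hbv; simp [(hσ b hv).2]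
    · have hbA : b ∉ A := fun h => hb (Finset.mem_erase.2 ⟨hbv, h⟩)
      simp [Function.update_of_ne hbv, h7 b hbA]
  · rw [Op.terms_append, h3]
    rcases ho with ⟨rfl, -⟩ | ⟨rfl, -⟩ <;> simp [Op.terms]
  · rw [Op.terms_append, h3]
    rcases ho with ⟨rfl, -⟩ | ⟨rfl, -, rfl⟩ <;> simp [Op.terms]
  · rw [Core.gain_append, h4, Op.terms_append, h3]
    rcases ho with ⟨rfl, rfl, rfl⟩ | ⟨rfl, rfl⟩
    · simpa [Op.terms, Core.gain, Core.cost] using h9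
    · simpa [Op.terms, Core.gain, Core.cost] using h9
  -- There are `A.card - 1` merges and one completing operation. The sum is at most `2 * (A.card -
  -- 1)` because `A` has at least two slots.
  · rw [List.length_append, List.length_singleton]; omega
  · rw [Op.terms_append, h3]
    rcases ho with ⟨rfl, -⟩ | ⟨rfl, -, rfl⟩ <;>
      simp only [Op.terms, List.nil_append, List.length_nil, List.length_singleton] <;> omega

theorem sdiff_union_inter_eq {X X₀ S : Finset V} {v : V} (h : X₀ ⊆ X) (hv : v ∉ X) :
    (X ∩ S) \ X₀ ∪ X₀ ∩ S = (insert v X ∩ S) \ {v} := by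
  ext x
  simp only [Finset.mem_union, Finset.mem_sdiff, Finset.mem_inter, Finset.mem_insert,
    Finset.mem_singleton]
  grind

theorem inter_sdiff_union_eq {X X₀ U : Finset V} {v : V} (h : X₀ ⊆ X) (hv : v ∉ X) :
    U ∩ (X \ X₀) ∪ U ∩ X₀ = U ∩ (insert v X \ {v}) := by
  ext x
  simp only [Finset.mem_union, Finset.mem_sdiff, Finset.mem_inter, Finset.mem_insert,
    Finset.mem_singleton]
  grind

theorem sdiff_union_sdiff_eq {X X₀ Y Y₀ S : Finset V} (h : X₀ ⊆ X) (h' : Y₀ ⊆ Y)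
    (hXY : X ∩ Y ⊆ X₀ ∩ Y₀) : (X ∩ S) \ X₀ ∪ (Y ∩ S) \ Y₀ = ((X ∪ Y) ∩ S) \ (X₀ ∪ Y₀) := by
  ext x
  have h1 := @hXY x
  simp only [Finset.mem_union, Finset.mem_sdiff, Finset.mem_inter] at *
  grind

theorem inter_sdiff_union_sdiff_eq {X X₀ Y Y₀ U : Finset V} (h : X₀ ⊆ X) (h' : Y₀ ⊆ Y)
    (hXY : X ∩ Y ⊆ X₀ ∩ Y₀) :
    U ∩ (X \ X₀) ∪ U ∩ (Y \ Y₀) = U ∩ ((X ∪ Y) \ (X₀ ∪ Y₀)) := by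
  ext x
  have h1 := @hXY x
  simp only [Finset.mem_union, Finset.mem_sdiff, Finset.mem_inter] at *
  grind

/-- Every tree whose slots are fresh decomposes into a part at its root that meets only one
component of the graph without the cut, and a part that is handled by operations. -/
theorem TreeIn.decompose (htri : ∀ u x v, D u v ≤ D u x + D x v) (h0 : ∀ v, D v v = 0)
    (hadj : ∀ u v, G.Adj u v → D u v ≤ w s(u, v)) {S U : Finset V} (hUS : ∀ t ∈ U, t ∉ S)
    (hcut : ∀ v t t', t ∈ U → t' ∈ U →
      Relation.ReflTransGen (fun x y => G.Adj x y ∧ x ∉ S ∧ y ∉ S) v t →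
      Relation.ReflTransGen (fun x y => G.Adj x y ∧ x ∉ S ∧ y ∉ S) v t' → t = t')
    {v : V} {X : Finset V} {c : ℕ} (hT : TreeIn G w v X c) :
    ∀ σ : Core V, (∀ b ∈ X ∩ S, b ∈ σ.al ∧ σ.X b = D b) →
      (∀ s ∈ X ∩ S, ∀ t, d t ≤ D s t) →
      ∃ (X₀ : Finset V) (c₀ c₁ : ℕ) (l : List (Op V)), X₀ ⊆ X ∧ TreeIn G w v X₀ c₀ ∧
        (v ∈ S → X₀ = {v}) ∧ (v ∉ S → ∀ x ∈ X₀, x ∉ S →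
          Relation.ReflTransGen (fun x y => G.Adj x y ∧ x ∉ S ∧ y ∉ S) v x) ∧
        Handles B D d σ ((X ∩ S) \ X₀) (U ∩ (X \ X₀)) l c₁ ∧ c₁ + c₀ ≤ c := by
  induction hT with
  | single v =>
    intro σ hσ hd
    refine ⟨{v}, 0, 0, [], subset_rfl, .single v, fun _ => rfl, ?_, ?_, le_rfl⟩
    · intro _ x hx _
      rw [Finset.mem_singleton.1 hx]
    · have e1 : ({v} ∩ S) \ {v} = (∅ : Finset V) := by ext; simp; tauto
      have e2 : U ∩ ({v} \ {v}) = (∅ : Finset V) := by simp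
      rw [e1, e2]
      simpa using handles_nil (B := B) (D := D) (d := d) σ ∅
  | @step v u X c h hT hv ih =>
    intro σ hσ hd
    have hsubS : X ∩ S ⊆ insert v X ∩ S :=
      Finset.inter_subset_inter_right (Finset.subset_insert _ _)
    obtain ⟨X₀, c₀, c₁, l, h1, h2, h3, h4, h5, h6⟩ := ih σ (fun b hb => hσ b (hsubS hb))
      (fun s hs => hd s (hsubS hs))
    have hv₀ : v ∉ X₀ := fun h => hv (h1 h)
    -- At a vertex of the cut the piece below, with the edge to `v`, is finished and gets handled.
    -- At any other vertex, `v` is added to the open piece.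
    by_cases hvS : v ∈ S
    · have hσv := hσ v (by simp [hvS])
      have hP := TreeIn.step h h2 hv₀
      -- The terminals of the piece outside `S` are all reachable from `u` in `G - S`, so the
      -- multiway cut leaves at most one of them. If `u` lies in `S`, then `X₀ = {u}` contains none.
      have hres : (U ∩ X₀ = ∅ ∨ ∃ t, U ∩ X₀ = {t}) := by
        rcases (U ∩ X₀).eq_empty_or_nonempty with he | ⟨t, ht⟩
        · exact Or.inl he
        · refine Or.inr ⟨t, ?_⟩
          ext t'
          rw [Finset.mem_singleton]
          rw [Finset.mem_inter] at ht
          by_cases huS : u ∈ S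
          · rw [h3 huS, Finset.mem_singleton] at ht
            exact absurd huS (ht.2 ▸ hUS t ht.1)
          constructor
          · intro ht'
            rw [Finset.mem_inter] at ht'
            exact hcut u _ _ ht'.1 ht.1 (h4 huS _ ht'.2 (hUS _ ht'.1)) (h4 huS _ ht.2 (hUS _ ht.1))
          · rintro rfl; exact Finset.mem_inter.2 ht
      have hfin : ∃ l', Handles B D d (σ.run B D l) (X₀ ∩ S) (U ∩ X₀) l' (c₀ + w s(v, u)) := by
        -- Without slots besides `v` there is nothing to merge and no slot to pay for an operation.
        -- A terminal of the piece is left unchosen; its distance from `v` is at most the weight of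
        -- the piece.
        rcases (X₀ ∩ S).eq_empty_or_nonempty with he | hne
        · rw [he]
          refine ⟨[], ?_⟩
          have hn := handles_nil (B := B) (D := D) (d := d) (σ.run B D l) (U ∩ X₀)
          refine { hn with cost := ?_ }
          refine hn.cost.trans ?_
          rcases hres with hr | ⟨t, hr⟩
          · rw [hr]; simp
          · rw [hr, Finset.sum_singleton]
            refine (hd v (by simp [hvS]) t).trans (hP.dist_le htri h0 hadj t ?_)
            have : t ∈ U ∩ X₀ := by rw [hr]; simp
            exact Finset.mem_insert_of_mem (Finset.mem_inter.1 this).2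
        · have hA : insert v (X₀ ∩ S) ⊆ insert v X₀ :=
            Finset.insert_subset_insert _ Finset.inter_subset_left
          have hvn : v ∉ X₀ ∩ S := fun h => hv₀ (Finset.mem_inter.1 h).1
          have hcard : 2 ≤ (insert v (X₀ ∩ S)).card := by
            rw [Finset.card_insert_of_notMem hvn]
            have := hne.card_pos; omega
          have hfresh : ∀ b ∈ insert v (X₀ ∩ S),
              b ∈ (σ.run B D l).al ∧ (σ.run B D l).X b = D b := by
            intro b hb
            have hbZ : b ∉ (X ∩ S) \ X₀ := by
              rcases Finset.mem_insert.1 hb with rfl | hb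
              · simp [hv]
              · simp [(Finset.mem_inter.1 hb).1]
            have hbσ := hσ b (by
              rcases Finset.mem_insert.1 hb with rfl | hb
              · simp [hvS]
              · rw [Finset.mem_inter] at hb
                simp [h1 hb.1, hb.2])
            rw [h5.al, h5.rest b hbZ]
            exact ⟨Finset.mem_sdiff.2 ⟨hbσ.1, hbZ⟩, hbσ.2⟩
          have her : (insert v (X₀ ∩ S)).erase v = X₀ ∩ S := Finset.erase_insert hvn
          rcases hres with hr | ⟨t, hr⟩
          · have hm := hP.mergeable (B := B) htri h0 hadj _ hA (Finset.insert_nonempty _ _)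
            have := hm.handles (d := d) (T := ∅) (.close v) (Or.inl ⟨rfl, rfl, rfl⟩) (by simp)
              hcard hfresh
            rw [hr]
            rwa [her] at this
          · have ht : t ∈ U ∩ X₀ := by rw [hr]; simp
            -- `closeT` pays for the partial tree extended to `t`, so the piece is rooted at `t` for
            -- the merging.
            have hm := (hP.reroot (Finset.mem_insert_of_mem (Finset.mem_inter.1 ht).2)).mergeable
              (B := B) htri h0 hadj _ hA (Finset.insert_nonempty _ _)
            have := hm.handles (d := d) (T := {t}) (.closeT v t) (Or.inr ⟨rfl, rfl⟩) (by simp)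
              hcard hfresh
            rw [hr]
            rwa [her] at this
      obtain ⟨l', hl'⟩ := hfin
      have happ := h5.append hl'
        (by
          rw [Finset.disjoint_left]; intro x; simp only [Finset.mem_sdiff, Finset.mem_inter]; tauto)
        (by
          rw [Finset.disjoint_left]; intro x; simp only [Finset.mem_sdiff, Finset.mem_inter]; tauto)
      rw [sdiff_union_inter_eq h1 hv, inter_sdiff_union_eq h1 hv] at happ
      exact ⟨{v}, 0, _, _, by simp, .single v, fun _ => rfl, fun h => absurd hvS h, happ, by omega⟩
    · refine ⟨insert v X₀, _, c₁, l, Finset.insert_subset_insert _ h1, TreeIn.step h h2 hv₀,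
        fun h => absurd h hvS, ?_, ?_, by omega⟩
      · intro _ x hx hxS
        rcases Finset.mem_insert.1 hx with rfl | hx
        · exact .refl
        · have huS : u ∉ S := by
            intro huS
            rw [h3 huS, Finset.mem_singleton] at hx
            exact hxS (hx ▸ huS)
          exact .head ⟨h, hvS, huS⟩ (h4 huS x hx hxS)
      · have e1 : (insert v X ∩ S) \ insert v X₀ = (X ∩ S) \ X₀ := by
          ext x
          simp only [Finset.mem_sdiff, Finset.mem_inter, Finset.mem_insert]
          by_cases hxv : x = v
          · subst hxv; simp [hv]
          · simp [hxv]
        have e2 : U ∩ (insert v X \ insert v X₀) = U ∩ (X \ X₀) := by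
          ext x
          simp only [Finset.mem_sdiff, Finset.mem_inter, Finset.mem_insert]
          by_cases hxv : x = v
          · subst hxv; simp [hv]
          · simp [hxv]
        rw [e1, e2]
        exact h5
  | @join v X Y c c' hX hY h ihX ihY =>
    intro σ hσ hd
    have hXS : X ∩ S ⊆ (X ∪ Y) ∩ S := Finset.inter_subset_inter_right Finset.subset_union_left
    have hYS : Y ∩ S ⊆ (X ∪ Y) ∩ S := Finset.inter_subset_inter_right Finset.subset_union_right
    obtain ⟨X₀, c₀, c₁, l, h1, h2, h3, h4, h5, h6⟩ := ihX σ (fun b hb => hσ b (hXS hb))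
      (fun s hs => hd s (hXS hs))
    have hXY : ∀ x, x ∈ X → x ∈ Y → x = v := by
      intro x hx hx'
      have : x ∈ X ∩ Y := Finset.mem_inter.2 ⟨hx, hx'⟩
      rwa [h, Finset.mem_singleton] at this
    have hv₁ := h2.root_mem
    -- The slots of `Y` are still fresh after the operations for `X`: only `v` can be common to both
    -- sides, and being in `X₀` it has not been used up.
    obtain ⟨Y₀, c₀', c₁', l', k1, k2, k3, k4, k5, k6⟩ := ihY (σ.run B D l)
      (by
        intro b hb
        have hbZ : b ∉ (X ∩ S) \ X₀ := by
          simp only [Finset.mem_sdiff, Finset.mem_inter, not_and, not_not]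
          rintro ⟨hbX, -⟩
          rw [hXY b hbX (Finset.mem_inter.1 hb).1]; exact hv₁
        rw [h5.al, h5.rest b hbZ]
        have := hσ b (hYS hb)
        exact ⟨Finset.mem_sdiff.2 ⟨this.1, hbZ⟩, this.2⟩)
      (fun s hs => hd s (hYS hs))
    have hv₂ := k2.root_mem
    have happ := h5.append k5
      (by
        rw [Finset.disjoint_left]; intro x
        simp only [Finset.mem_sdiff, Finset.mem_inter]
        rintro ⟨⟨a1, -⟩, a2⟩ ⟨⟨b1, -⟩, -⟩
        exact a2 (hXY x a1 b1 ▸ hv₁))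
      (by
        rw [Finset.disjoint_left]; intro x
        simp only [Finset.mem_sdiff, Finset.mem_inter]
        rintro ⟨-, a1, a2⟩ ⟨-, b1, -⟩
        exact a2 (hXY x a1 b1 ▸ hv₁))
    have hvX : X ∩ Y ⊆ X₀ ∩ Y₀ := by
      rw [h, Finset.singleton_subset_iff]; exact Finset.mem_inter.2 ⟨hv₁, hv₂⟩
    rw [sdiff_union_sdiff_eq h1 k1 hvX, inter_sdiff_union_sdiff_eq h1 k1 hvX] at happ
    refine ⟨X₀ ∪ Y₀, _, _, _, Finset.union_subset_union h1 k1, h2.join k2 ?_, ?_, ?_, happ, by omega⟩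
    · ext x
      simp only [Finset.mem_inter, Finset.mem_singleton]
      exact ⟨fun hx => hXY x (h1 hx.1) (k1 hx.2), by rintro rfl; exact ⟨hv₁, hv₂⟩⟩
    · intro hvS; rw [h3 hvS, k3 hvS]; simp
    · intro hvS x hx hxS
      rcases Finset.mem_union.1 hx with hx | hx
      · exact h4 hvS x hx hxS
      · exact k4 hvS x hx hxS

end

/-! ### Exchange argument: the chosen terminals may have small rank. -/

section

variable {n : ℕ} {B : ℕ} {D : Fin n → Fin n → ℕ}

/-- Terminal `t'` profits more than `t` from being chosen instead of being connected separately. -/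
def Before (d h : Fin n → ℕ) (t' t : Fin n) : Prop :=
  h t' + d t < h t + d t' ∨ h t' + d t = h t + d t' ∧ t' < t

instance (d h : Fin n → ℕ) (t' t : Fin n) : Decidable (Before d h t' t) := by
  unfold Before; infer_instance

/-- A guess names a terminal by its rank. Far fewer ranks than terminals need to be considered, by
`Core.exists_rankBound`; ties are broken by index, so ranks determine terminals (`rank_injOn`). -/
def rank (U : Finset (Fin n)) (d h : Fin n → ℕ) (t : Fin n) : ℕ := (U.filter (Before d h · t)).card

theorem Before.trans {d h : Fin n → ℕ} {a b c : Fin n} (h₁ : Before d h a b)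
    (h₂ : Before d h b c) : Before d h a c := by
  unfold Before at *
  rcases h₁ with h₁ | ⟨h₁, h₁'⟩ <;> rcases h₂ with h₂ | ⟨h₂, h₂'⟩
  · left; omega
  · left; omega
  · left; omega
  · right; exact ⟨by omega, h₁'.trans h₂'⟩

theorem Before.irrefl (d h : Fin n → ℕ) (a : Fin n) : ¬ Before d h a a := by
  simp [Before]

theorem rank_lt_rank {U : Finset (Fin n)} {d h : Fin n → ℕ} {t t' : Fin n} (ht : t' ∈ U)
    (hb : Before d h t' t) : rank U d h t' < rank U d h t := by
  refine Finset.card_lt_card ((Finset.ssubset_iff_of_subset ?_).2 ⟨t', ?_, ?_⟩)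
  · intro x hx
    rw [Finset.mem_filter] at hx ⊢
    exact ⟨hx.1, hx.2.trans hb⟩
  · exact Finset.mem_filter.2 ⟨ht, hb⟩
  · simp [Before.irrefl]

theorem rank_injOn {U : Finset (Fin n)} {d h : Fin n → ℕ} {t t' : Fin n} (ht : t ∈ U) (ht' : t' ∈ U)
    (he : rank U d h t = rank U d h t') : t = t' := by
  by_contra hne
  have : Before d h t t' ∨ Before d h t' t := by
    unfold Before
    rcases lt_trichotomy (h t + d t') (h t' + d t) with h1 | h1 | h1
    · exact Or.inl (Or.inl h1)
    · rcases lt_or_gt_of_ne hne with h2 | h2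
      · exact Or.inl (Or.inr ⟨h1, h2⟩)
      · exact Or.inr (Or.inr ⟨h1.symm, h2⟩)
    · exact Or.inr (Or.inl h1)
  rcases this with h1 | h1
  · exact (rank_lt_rank ht h1).ne he
  · exact (rank_lt_rank ht' h1).ne he.symm

variable (B D) in
/-- All chosen terminals have rank less than `r`. -/
def Core.RankBound (U : Finset (Fin n)) (d : Fin n → ℕ) (r : ℕ) :
    Core (Fin n) → List (Op (Fin n)) → Prop
  | _, [] => True
  | σ, o :: l => (∀ u t, o = .closeT u t → rank U d (σ.X u) t < r) ∧
      Core.RankBound U d r (σ.app B D o) l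

variable (B D) in
/-- Sum of the ranks of the chosen terminals. -/
def Core.ranks (U : Finset (Fin n)) (d : Fin n → ℕ) : Core (Fin n) → List (Op (Fin n)) → ℕ
  | _, [] => 0
  | σ, .closeT u t :: l => rank U d (σ.X u) t + Core.ranks U d (σ.app B D (.closeT u t)) l
  | σ, .skip :: l => Core.ranks U d (σ.app B D .skip) l
  | σ, .drop v :: l => Core.ranks U d (σ.app B D (.drop v)) l
  | σ, .merge v u :: l => Core.ranks U d (σ.app B D (.merge v u)) l
  | σ, .close u :: l => Core.ranks U d (σ.app B D (.close u)) l

/-- A terminal of large rank can be replaced. -/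
theorem Core.exists_replace {U : Finset (Fin n)} {d : Fin n → ℕ} {r : ℕ} {l : List (Op (Fin n))} :
    ∀ σ : Core (Fin n), σ.AllowsAll B D l → (∀ o ∈ l, o.IsProper) →
      ¬ Core.RankBound B D U d r σ l →
      ∃ (h : Fin n → ℕ) (t : Fin n) (l₁ l₂ : List (Fin n)), r ≤ rank U d h t ∧
        Op.terms l = l₁ ++ t :: l₂ ∧ ∀ t', ∃ l', l'.length = l.length ∧ σ.AllowsAll B D l' ∧
          (∀ o ∈ l', o.IsProper) ∧ σ.run B D l' = σ.run B D l ∧ Op.terms l' = l₁ ++ t' :: l₂ ∧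
          σ.gain B D l' + h t = σ.gain B D l + h t' ∧
          Core.ranks B D U d σ l' + rank U d h t = Core.ranks B D U d σ l + rank U d h t' := by
  induction l with
  | nil => intro σ _ _ hb; exact absurd trivial hb
  | cons o l ih =>
    intro σ hal hp hb
    have hp' : ∀ o ∈ l, o.IsProper := fun o ho => hp o (List.mem_cons_of_mem _ ho)
    by_cases ho : ∀ u t, o = .closeT u t → rank U d (σ.X u) t < r
    · have hb' : ¬ Core.RankBound B D U d r (σ.app B D o) l := fun h => hb ⟨ho, h⟩
      obtain ⟨h, t, l₁, l₂, h1, h2, h3⟩ := ih _ hal.2 hp' hb'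
      have hterm : ∃ l₀, ∀ l', Op.terms (o :: l') = l₀ ++ Op.terms l' := by
        cases o
        case closeT u t => exact ⟨[t], fun _ => rfl⟩
        all_goals exact ⟨[], fun _ => rfl⟩
      have hrank : ∃ m, ∀ l', Core.ranks B D U d σ (o :: l') =
          m + Core.ranks B D U d (σ.app B D o) l' := by
        cases o
        case closeT u t => exact ⟨rank U d (σ.X u) t, fun _ => rfl⟩
        all_goals exact ⟨0, fun _ => (zero_add _).symm⟩
      obtain ⟨l₀, hl₀⟩ := hterm
      obtain ⟨m, hm⟩ := hrank
      refine ⟨h, t, l₀ ++ l₁, l₂, h1, by rw [hl₀, h2, List.append_assoc], fun t' => ?_⟩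
      obtain ⟨l', k1, k2, k3, k4, k5, k6, k7⟩ := h3 t'
      refine ⟨o :: l', by simp [k1], ⟨hal.1, k2⟩, ?_, k4, ?_, ?_, ?_⟩
      · intro o' ho'
        rcases List.mem_cons.1 ho' with rfl | ho'
        · exact hp _ (by simp)
        · exact k3 o' ho'
      · rw [hl₀, k5, List.append_assoc]
      · simp only [Core.gain]; omega
      · rw [hm, hm]; omega
    · push Not at ho
      -- `closeT u t` and `closeT u t'` produce the same state, so the rest of the list is kept and
      -- only the cost and the rank at this place change.
      obtain ⟨u, t, rfl, hr⟩ := ho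
      refine ⟨σ.X u, t, [], Op.terms l, hr, rfl, fun t' => ⟨.closeT u t' :: l, rfl, hal, ?_, rfl, rfl,
        ?_, ?_⟩⟩
      · intro o' ho'
        rcases List.mem_cons.1 ho' with rfl | ho'
        · trivial
        · exact hp' o' ho'
      · simp only [Core.gain, Core.cost]
        have : σ.app B D (.closeT u t') = σ.app B D (.closeT u t) := rfl
        rw [this]; omega
      · simp only [Core.ranks]
        have : σ.app B D (.closeT u t') = σ.app B D (.closeT u t) := rfl
        rw [this]; omega

theorem sum_sdiff_terms {U : Finset (Fin n)} {d : Fin n → ℕ} {l : List (Fin n)} (hl : l.Nodup)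
    (hU : ∀ t ∈ l, t ∈ U) : ∑ t ∈ U \ l.toFinset, d t + (l.map d).sum = ∑ t ∈ U, d t := by
  rw [← List.sum_toFinset _ hl]
  exact Finset.sum_sdiff (fun t ht => hU t (List.mem_toFinset.1 ht))

/-- The chosen terminals may be assumed to have small rank. -/
theorem Core.exists_rankBound {U : Finset (Fin n)} {d : Fin n → ℕ} {r : ℕ} {σ : Core (Fin n)} :
    ∀ (m : ℕ) (l : List (Op (Fin n))), Core.ranks B D U d σ l = m → σ.AllowsAll B D l →
      (∀ o ∈ l, o.IsProper) → (Op.terms l).Nodup → (∀ t ∈ Op.terms l, t ∈ U) →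
      (Op.terms l).length ≤ r →
      ∃ l', l'.length = l.length ∧ σ.AllowsAll B D l' ∧ (∀ o ∈ l', o.IsProper) ∧
        σ.run B D l' = σ.run B D l ∧ (Op.terms l').Nodup ∧ (∀ t ∈ Op.terms l', t ∈ U) ∧
        Core.RankBound B D U d r σ l' ∧
        σ.gain B D l' + ∑ t ∈ U \ (Op.terms l').toFinset, d t ≤
          σ.gain B D l + ∑ t ∈ U \ (Op.terms l).toFinset, d t := by
  intro m
  induction m using Nat.strong_induction_on with
  | _ m ih =>
    intro l hm hal hp hnd hU hlen
    by_cases hb : Core.RankBound B D U d r σ l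
    · exact ⟨l, rfl, hal, hp, rfl, hnd, hU, hb, le_rfl⟩
    · obtain ⟨h, t, l₁, l₂, h1, h2, h3⟩ := Core.exists_replace σ hal hp hb
      -- At least `r` terminals come before `t`, but at most `r - 1` other terminals are chosen in
      -- the list, so one that comes before `t` is free.
      obtain ⟨t', ht'U, ht't, ht'l⟩ : ∃ t' ∈ U, Before d h t' t ∧ t' ∉ l₁ ++ l₂ := by
        by_contra! hcon
        have hsub : U.filter (Before d h · t) ⊆ (l₁ ++ l₂).toFinset := by
          intro x hx
          rw [Finset.mem_filter] at hx
          exact List.mem_toFinset.2 (hcon x hx.1 hx.2)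
        have c1 := Finset.card_le_card hsub
        have c2 := List.toFinset_card_le (l₁ ++ l₂)
        rw [h2] at hlen
        simp only [List.length_append, List.length_cons] at hlen c2
        unfold rank at h1
        omega
      obtain ⟨l', k1, k2, k3, k4, k5, k6, k7⟩ := h3 t'
      have hnd₀ := hnd
      rw [h2, List.nodup_middle, List.nodup_cons] at hnd
      have hnd' : (Op.terms l').Nodup := by
        rw [k5, List.nodup_middle, List.nodup_cons]; exact ⟨ht'l, hnd.2⟩
      have hU' : ∀ t ∈ Op.terms l', t ∈ U := by
        intro x hx
        rw [k5, List.mem_append, List.mem_cons] at hx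
        rcases hx with hx | rfl | hx
        · exact hU x (by rw [h2]; simp [hx])
        · exact ht'U
        · exact hU x (by rw [h2]; simp [hx])
      -- Replacing `t` by `t'` lowers the sum of the ranks, which is the induction measure, and does
      -- not increase the total weight.
      have hrk := rank_lt_rank ht'U ht't
      obtain ⟨l'', m1, m2, m3, m4, m5, m6, m7, m8⟩ := ih _ (show Core.ranks B D U d σ l' < m by omega)
        l' rfl k2 k3 hnd' hU' (by rw [k5]; rw [h2] at hlen; simpa using hlen)
      refine ⟨l'', m1.trans k1, m2, m3, m4.trans k4, m5, m6, m7, m8.trans ?_⟩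
      have s1 := sum_sdiff_terms (d := d) hnd₀ hU
      have s2 := sum_sdiff_terms (d := d) hnd' hU'
      rw [h2] at s1 ⊢
      rw [k5] at s2 ⊢
      simp only [List.map_append, List.map_cons, List.sum_append, List.sum_cons] at s1 s2
      have hle : h t' + d t ≤ h t + d t' := by
        rcases ht't with h | h
        · exact h.le
        · exact h.1.le
      omega

end

/-! ## Guesses -/

/-- State of the evaluation of a guess: additionally the dropped slots, the chosen terminals, and the
total weight of the completed trees. -/
structure Guess (n : ℕ) extends Core (Fin n) where
  dr : Finset (Fin n)
  us : Finset (Fin n)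
  tot : ℕ

section

variable {n : ℕ} (B : ℕ) (D : Fin n → Fin n → ℕ) (K S : Finset (Fin n))

def Op.dropped : Op (Fin n) → Finset (Fin n)
  | .drop v => {v}
  | _ => ∅

def Op.used : Op (Fin n) → Finset (Fin n)
  | .closeT _ t => {t}
  | _ => ∅

/-- The cap on the total keeps the stored number bounded. It loses nothing, as a guess that reaches
`B` is no longer of interest. -/
def Guess.app (σ : Guess n) (o : Op (Fin n)) : Guess n :=
  { σ.toCore.app B D o with
    dr := σ.dr ∪ o.dropped
    us := σ.us ∪ o.used
    tot := min B (σ.tot + σ.toCore.cost o) }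

def Guess.run (σ : Guess n) : List (Op (Fin n)) → Guess n
  | [] => σ
  | o :: l => Guess.run (σ.app B D o) l

/-- The operation may be performed. -/
def Guess.Valid (σ : Guess n) (o : Op (Fin n)) : Prop :=
  -- Drops are admitted only while no slot has been merged away and no terminal has been chosen.
  -- Then dropping a slot cannot lose anything else that its partial tree is responsible for.
  σ.toCore.Allows o ∧ (∀ v, o = .drop v → v ∉ K ∧ S ⊆ σ.al ∪ σ.dr ∧ σ.us = ∅) ∧
    ∀ u t, o = .closeT u t → t ∈ K \ S ∧ t ∉ σ.us

/-- Weight of connecting a vertex to the slots that have not been dropped. -/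
def Guess.dist (σ : Guess n) (t : Fin n) : ℕ :=
  Finset.univ.fold min B fun s => if s ∈ S ∧ s ∉ σ.dr then D s t else B

/-- Weight of the tree that a guess describes. -/
def Guess.value (σ : Guess n) : ℕ :=
  if σ.al.card = 1 then
    σ.tot + ∑ a ∈ σ.al, σ.X a a + ∑ t ∈ (K \ S) \ σ.us, σ.dist B D S t
  else B

def Guess.init : Guess n := ⟨⟨S, D⟩, ∅, ∅, 0⟩

/-- The operations of the list may be performed one after the other, and choose terminals of rank
less than `|S|`. -/
def Guess.Feasible : Guess n → List (Op (Fin n)) → Prop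
  | _, [] => True
  | σ, o :: l => (σ.Valid K S o ∧ o ≠ .skip ∧
      ∀ u t, o = .closeT u t → rank (K \ S) (σ.dist B D S) (σ.X u) t < S.card) ∧
      Guess.Feasible (σ.app B D o) l

variable {B D K S}

theorem Guess.run_append (σ : Guess n) (l l' : List (Op (Fin n))) :
    σ.run B D (l ++ l') = (σ.run B D l).run B D l' := by
  induction l generalizing σ with
  | nil => rfl
  | cons o l ih => exact ih _

theorem Guess.feasible_append {σ : Guess n} {l l' : List (Op (Fin n))}
    (h : σ.Feasible B D K S l) (h' : (σ.run B D l).Feasible B D K S l') :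
    σ.Feasible B D K S (l ++ l') := by
  induction l generalizing σ with
  | nil => exact h'
  | cons o l ih => exact ⟨h.1, ih h.2 h'⟩

theorem Guess.run_drops (l : List (Fin n)) : ∀ σ : Guess n, l.Nodup →
    (∀ v ∈ l, v ∈ σ.al ∧ v ∉ K) → S ⊆ σ.al ∪ σ.dr → σ.us = ∅ → σ.tot = 0 →
    σ.Feasible B D K S (l.map .drop) ∧
      σ.run B D (l.map .drop) = ⟨⟨σ.al \ l.toFinset, σ.X⟩, σ.dr ∪ l.toFinset, ∅, 0⟩ := by
  induction l with
  | nil =>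
    intro σ _ _ _ hus htot
    refine ⟨trivial, ?_⟩
    rcases σ with ⟨⟨al, X⟩, dr, us, tot⟩
    simp only at hus htot
    subst hus htot
    simp [Guess.run]
  | cons v l ih =>
    intro σ hnd hv hS hus htot
    rw [List.nodup_cons] at hnd
    obtain ⟨h1, h2⟩ := ih (σ.app B D (.drop v)) hnd.2
      (by
        intro x hx
        have hxv : x ≠ v := fun e => hnd.1 (e ▸ hx)
        have := hv x (by simp [hx])
        exact ⟨Finset.mem_erase.2 ⟨hxv, this.1⟩, this.2⟩)
      (by
        intro x hx
        have := hS hx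
        simp only [Guess.app, Core.app, Op.dropped, Finset.mem_union, Finset.mem_erase,
          Finset.mem_singleton] at this ⊢
        tauto)
      (by simp [Guess.app, hus, Op.used]) (by simp [Guess.app, htot, Core.cost])
    have hv' := hv v (by simp)
    refine ⟨⟨⟨⟨hv'.1, ?_, ?_⟩, by simp, by simp⟩, h1⟩, ?_⟩
    · intro v' h
      injection h with h
      subst h
      exact ⟨hv'.2, hS, hus⟩
    · intro _ _ h; cases h
    · rw [List.map_cons, Guess.run, h2]
      simp only [Guess.app, Core.app, Op.dropped, List.toFinset_cons, Guess.mk.injEq, Core.mk.injEq,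
        and_true]
      constructor
      · ext x; simp; tauto
      · ext x; simp

/-- A list of proper operations drops no slot, so the distances `σ.dist B D S`, and with them the
meaning of ranks, are the same at every step. -/
theorem Guess.run_proper {d : Fin n → ℕ} (l : List (Op (Fin n))) : ∀ σ : Guess n,
    σ.toCore.AllowsAll B D l → (∀ o ∈ l, o.IsProper) → (Op.terms l).Nodup →
    (∀ t ∈ Op.terms l, t ∈ K \ S ∧ t ∉ σ.us) → σ.dist B D S = d →
    Core.RankBound B D (K \ S) d S.card σ.toCore l →
    σ.Feasible B D K S l ∧ (σ.run B D l).toCore = σ.toCore.run B D l ∧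
      (σ.run B D l).dr = σ.dr ∧ (σ.run B D l).us = σ.us ∪ (Op.terms l).toFinset ∧
      (σ.run B D l).tot ≤ σ.tot + σ.toCore.gain B D l := by
  induction l with
  | nil => intro σ _ _ _ _ _ _; exact ⟨trivial, rfl, rfl, by simp [Guess.run, Op.terms], le_rfl⟩
  | cons o l ih =>
    intro σ hal hp hnd ht hd hr
    have hpo := hp o (by simp)
    have hdrop : o.dropped = ∅ := by cases o <;> first | rfl | exact absurd hpo id
    have hterms : (Op.terms (o :: l)).toFinset = o.used ∪ (Op.terms l).toFinset := by
      cases o <;> simp [Op.terms, Op.used]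
    have hnd' : (Op.terms l).Nodup ∧ ∀ t ∈ o.used, t ∉ Op.terms l := by
      cases o <;> simp_all [Op.terms, Op.used]
    have hdr : (σ.app B D o).dr = σ.dr := by simp [Guess.app, hdrop]
    have hall : ∀ t, t ∈ o.used ∨ t ∈ Op.terms l → t ∈ K \ S ∧ t ∉ σ.us := by
      intro t h
      refine ht t ?_
      rw [← List.mem_toFinset, hterms]
      simpa using h
    obtain ⟨h1, h2, h3, h4, h5⟩ := ih (σ.app B D o) hal.2 (fun o ho => hp o (by simp [ho])) hnd'.1
      (by
        intro t htl
        refine ⟨(hall t (Or.inr htl)).1, ?_⟩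
        simp only [Guess.app, Finset.mem_union, not_or]
        exact ⟨(hall t (Or.inr htl)).2, fun h => hnd'.2 t h htl⟩)
      (by rw [← hd]; unfold Guess.dist; rw [hdr]) hr.2
    refine ⟨⟨⟨⟨hal.1, ?_, ?_⟩, ?_, ?_⟩, h1⟩, h2, h3.trans hdr, ?_, ?_⟩
    · rintro v rfl; exact absurd hpo id
    · rintro u t rfl; exact hall t (Or.inl (by simp [Op.used]))
    · rintro rfl; exact hpo
    · rw [hd]; exact hr.1
    · rw [Guess.run, h4, hterms]
      simp [Guess.app, Finset.union_assoc]
    · rw [Guess.run]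
      refine h5.trans ?_
      simp only [Guess.app, Core.gain]
      have := min_le_right B (σ.tot + σ.toCore.cost o)
      omega

/-- Every tree that contains all terminals and a vertex of the cut is described by a guess. -/
theorem TreeIn.exists_guess {G : SimpleGraph (Fin n)} {w : Sym2 (Fin n) → ℕ}
    (htri : ∀ u x v, D u v ≤ D u x + D x v) (h0 : ∀ v, D v v = 0)
    (hadj : ∀ u v, G.Adj u v → D u v ≤ w s(u, v))
    (hcut : ∀ v t t', t ∈ K \ S → t' ∈ K \ S →
      Relation.ReflTransGen (fun x y => G.Adj x y ∧ x ∉ S ∧ y ∉ S) v t →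
      Relation.ReflTransGen (fun x y => G.Adj x y ∧ x ∉ S ∧ y ∉ S) v t' → t = t')
    {v : Fin n} {X : Finset (Fin n)} {c : ℕ} (hT : TreeIn G w v X c) (hv : v ∈ S) (hK : K ⊆ X) :
    ∃ l : List (Op (Fin n)), l.length ≤ 2 * S.card ∧ (Guess.init D S).Feasible B D K S l ∧
      ((Guess.init D S).run B D l).value B D K S ≤ c := by
  obtain ⟨f1, f2⟩ := Guess.run_drops (B := B) (D := D) (K := K) (S := S) (S \ X).toList
    (Guess.init D S) (Finset.nodup_toList _)
    (by
      intro x hx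
      rw [Finset.mem_toList, Finset.mem_sdiff] at hx
      exact ⟨hx.1, fun h => hx.2 (hK h)⟩)
    (by intro x hx; exact Finset.mem_union_left _ hx) rfl rfl
  set σ : Guess n := (Guess.init D S).run B D ((S \ X).toList.map .drop) with hσ
  have hal : σ.al = X ∩ S := by
    rw [f2]; simp only [Guess.init, Finset.toList_toFinset]; ext x; simp; tauto
  have hX : σ.X = D := by rw [f2]; rfl
  have hdr : σ.dr = S \ X := by rw [f2]; simp [Guess.init]
  have hus : σ.us = ∅ := by rw [f2]
  have htot : σ.tot = 0 := by rw [f2]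
  obtain ⟨X₀, c₀, c₁, l, h1, h2, h3, h4, h5, h6⟩ := hT.decompose (B := B) (S := S) (U := K \ S)
    (d := σ.dist B D S) htri h0 hadj (fun t ht => (Finset.mem_sdiff.1 ht).2) hcut σ.toCore
    (by intro b hb; rw [hal, hX]; exact ⟨hb, rfl⟩)
    (by
      intro s hs t
      unfold Guess.dist
      rw [Finset.fold_min_le]
      right
      refine ⟨s, Finset.mem_univ _, ?_⟩
      rw [Finset.mem_inter] at hs
      rw [if_pos ⟨hs.2, by rw [hdr]; simp [hs.1]⟩])
  -- The root is a vertex of the cut, so the open piece is `{v}` and everything else has been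
  -- handled.
  rw [h3 hv] at h5
  have hvX := hT.root_mem
  have hUT : (K \ S) ∩ (X \ {v}) = K \ S := by
    rw [Finset.inter_eq_left]
    intro t ht
    rw [Finset.mem_sdiff] at ht
    rw [Finset.mem_sdiff, Finset.mem_singleton]
    exact ⟨hK ht.1, fun e => ht.2 (e ▸ hv)⟩
  rw [hUT] at h5
  have hcardXS : ((X ∩ S) \ {v}).card + 1 = (X ∩ S).card := by
    rw [Finset.sdiff_singleton_eq_erase]
    exact Finset.card_erase_add_one (Finset.mem_inter.2 ⟨hvX, hv⟩)
  have hcardS : (S \ X).card + (X ∩ S).card = S.card := by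
    rw [Finset.inter_comm]; exact Finset.card_sdiff_add_card_inter S X
  -- At most `|X ∩ S| - 1` terminals are chosen, so the rank bound `|S|` is available. Together with
  -- the drops there are at most `|S \ X| + 2 * (|X ∩ S| - 1)` operations.
  obtain ⟨l', g1, g2, g3, g4, g5, g6, g7, g8⟩ := Core.exists_rankBound (d := σ.dist B D S)
    (r := S.card) _ l rfl h5.allows h5.proper h5.nodup h5.terms
    (h5.length_terms.trans (by omega))
  obtain ⟨k1, k2, k3, k4, k5⟩ := Guess.run_proper (K := K) (S := S) l' σ g2 g3 g5
    (fun t ht => ⟨g6 t ht, by rw [hus]; simp⟩) rfl g7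
  refine ⟨(S \ X).toList.map .drop ++ l', ?_, Guess.feasible_append f1 k1, ?_⟩
  · have := h5.length
    simp only [List.length_append, List.length_map, Finset.length_toList, g1]
    omega
  · rw [Guess.run_append, ← hσ]
    have hal' : (σ.run B D l').al = {v} := by
      rw [k2, g4, h5.al, hal, sdiff_sdiff_right_self]
      ext x
      simp only [Finset.inf_eq_inter, Finset.mem_inter, Finset.mem_singleton]
      constructor
      · exact fun h => h.2
      · rintro rfl; exact ⟨⟨hvX, hv⟩, rfl⟩
    have hXv : (σ.run B D l').X v = D v := by
      rw [k2, g4, h5.rest v (by simp), hX]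
    have hdist : (σ.run B D l').dist B D S = σ.dist B D S := by
      unfold Guess.dist; rw [k3]
    unfold Guess.value
    rw [hal', if_pos (by simp), Finset.sum_singleton, hXv, h0, hdist, k4, hus, Finset.empty_union]
    have := h5.cost
    rw [htot] at k5
    omega

/-! ### Guesses describe connected subgraphs -/

/-- Invariant of the evaluation of a guess, with respect to a predicate that says whether sets of
vertices can be connected at a given weight. -/
def Guess.Sound (Cn : Finset (Fin n) → ℕ → Prop) (B : ℕ) (K S : Finset (Fin n)) (σ : Guess n) :
    Prop :=
  (∀ s ∈ σ.dr, s ∉ K) ∧ (B ≤ σ.tot ∨ ∃ (τ : Fin n → ℕ) (Cov : Fin n → Finset (Fin n)),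
    (∀ a ∈ σ.al, a ∈ Cov a ∧ ∀ x, Cn (insert x (Cov a)) (τ a + σ.X a x)) ∧
    ∑ a ∈ σ.al, τ a ≤ σ.tot ∧ (∀ s ∈ S, s ∉ σ.dr → ∃ a ∈ σ.al, s ∈ Cov a) ∧
    ∀ t ∈ σ.us, ∃ a ∈ σ.al, t ∈ Cov a)

variable {Cn : Finset (Fin n) → ℕ → Prop}

theorem Guess.sound_init (hD : ∀ u v, Cn {u, v} (D u v)) :
    (Guess.init D S).Sound Cn B K S := by
  refine ⟨by simp [Guess.init], Or.inr ⟨fun _ => 0, fun a => {a}, ?_, by simp, ?_, ?_⟩⟩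
  · intro a _
    refine ⟨by simp, fun x => ?_⟩
    rw [zero_add, Finset.pair_comm]
    exact hD a x
  · intro s hs _; exact ⟨s, hs, by simp⟩
  · intro t ht; simp [Guess.init] at ht

/-- For a living slot `a`, the set `Cov a` consists of the vertices already tied to `a`, and `τ a`
is the weight of the trees completed for it. A merge adds both up; a completion shifts the partial
weight into `τ`. Once the total has reached `B`, nothing remains to be shown about connections. -/
theorem Guess.Sound.app (hmono : ∀ {A A' : Finset (Fin n)} {c c' : ℕ}, Cn A c → A' ⊆ A → c ≤ c' →
      Cn A' c')
    (hunion : ∀ {A A' : Finset (Fin n)} {c c' : ℕ} {v : Fin n}, Cn A c → Cn A' c' → v ∈ A →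
      v ∈ A' → Cn (A ∪ A') (c + c'))
    (hB : ∀ A c, B ≤ c → Cn A c) (hD : ∀ u v, Cn {u, v} (D u v)) {σ : Guess n} {o : Op (Fin n)}
    (h : σ.Sound Cn B K S) (hv : σ.Valid K S o) : (σ.app B D o).Sound Cn B K S := by
  obtain ⟨hK, h⟩ := h
  obtain ⟨ho, hod, hot⟩ := hv
  refine ⟨?_, ?_⟩
  · intro s hs
    rcases Finset.mem_union.1 hs with hs | hs
    · exact hK s hs
    · cases o with
      | drop v => rw [Op.dropped, Finset.mem_singleton] at hs; rw [hs]; exact (hod v rfl).1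
      | _ => simp [Op.dropped] at hs
  rcases le_or_gt B (σ.tot + σ.toCore.cost o) with hle | hlt
  · left; simp [Guess.app, hle]
  right
  have htot : (σ.app B D o).tot = σ.tot + σ.toCore.cost o := by
    simp only [Guess.app]; exact min_eq_right hlt.le
  rw [htot]
  obtain ⟨τ, Cov, h1, h2, h3, h4⟩ := h.resolve_left (by omega)
  -- Common to both kinds of completion: the partial tree of weight `g` becomes part of what is held
  -- by `u`, and further extensions start afresh from `u`.
  have hclose : ∀ (u : Fin n) (A : Finset (Fin n)) (g : ℕ), u ∈ σ.al → Cov u ⊆ A →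
      Cn A (τ u + g) → ∃ (τ' : Fin n → ℕ) (Cov' : Fin n → Finset (Fin n)),
      (∀ a ∈ σ.al, a ∈ Cov' a ∧
        ∀ x, Cn (insert x (Cov' a)) (τ' a + Function.update σ.X u (D u) a x)) ∧
      ∑ a ∈ σ.al, τ' a ≤ σ.tot + g ∧ (∀ a, Cov a ⊆ Cov' a) ∧ Cov' u = A := by
    intro u A g hu hA hCn
    refine ⟨Function.update τ u (τ u + g), Function.update Cov u A, ?_, ?_, ?_, by simp⟩
    · intro a ha
      by_cases hau : a = u
      · subst hau
        simp only [Function.update_self]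
        refine ⟨hA (h1 a ha).1, fun x => ?_⟩
        refine hmono (hunion hCn (hD a x) (hA (h1 a ha).1) (by simp)) ?_ le_rfl
        intro y hy
        rcases Finset.mem_insert.1 hy with rfl | hy
        · simp
        · simp [hy]
      · simp only [Function.update_of_ne hau]
        exact h1 a ha
    · rw [← Finset.add_sum_erase _ _ hu] at h2 ⊢
      have : ∑ x ∈ σ.al.erase u, Function.update τ u (τ u + g) x = ∑ x ∈ σ.al.erase u, τ x :=
        Finset.sum_congr rfl fun x hx => Function.update_of_ne (Finset.ne_of_mem_erase hx) _ _
      rw [this, Function.update_self]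
      omega
    · intro a
      by_cases hau : a = u
      · subst hau; simpa using hA
      · simp [Function.update_of_ne hau]
  cases o with
  | skip =>
    refine ⟨τ, Cov, h1, h2, ?_, ?_⟩
    · simpa [Guess.app, Core.app, Op.dropped] using h3
    · simpa [Guess.app, Core.app, Op.used] using h4
  | drop v =>
    obtain ⟨-, hS, hus⟩ := hod v rfl
    have hsub : (σ.app B D (.drop v)).al ⊆ σ.al := Finset.erase_subset _ _
    refine ⟨τ, Cov, fun a ha => h1 a (hsub ha), ?_, ?_, ?_⟩
    · exact (Finset.sum_le_sum_of_subset hsub).trans (by simpa [Core.cost] using h2)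
    · intro s hs hsd
      simp only [Guess.app, Op.dropped, Finset.mem_union, Finset.mem_singleton, not_or] at hsd
      -- No slot has been merged away so far, hence each undropped vertex of the cut is covered by
      -- its own slot.
      have hsal : s ∈ σ.al := (Finset.mem_union.1 (hS hs)).resolve_right hsd.1
      exact ⟨s, Finset.mem_erase.2 ⟨hsd.2, hsal⟩, (h1 s hsal).1⟩
    · intro t ht
      simp [Guess.app, Op.used, hus] at ht
  | merge v u =>
    obtain ⟨hv, hu, hvu⟩ := ho
    have hu' : u ∈ σ.al.erase v := Finset.mem_erase.2 ⟨hvu.symm, hu⟩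
    have hcov : ∀ x, (∃ a ∈ σ.al, x ∈ Cov a) →
        ∃ a ∈ σ.al.erase v, x ∈ Function.update Cov u (Cov v ∪ Cov u) a := by
      rintro x ⟨a, ha, hx⟩
      by_cases hav : a = v
      · subst hav; exact ⟨u, hu', by simp [hx]⟩
      · refine ⟨a, Finset.mem_erase.2 ⟨hav, ha⟩, ?_⟩
        by_cases hau : a = u
        · subst hau; simp [hx]
        · rwa [Function.update_of_ne hau]
    refine ⟨Function.update τ u (τ v + τ u), Function.update Cov u (Cov v ∪ Cov u), ?_, ?_, ?_, ?_⟩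
    · intro a ha
      have ha' : a ∈ σ.al := Finset.mem_of_mem_erase ha
      by_cases hau : a = u
      · subst hau
        simp only [Function.update_self, Guess.app, Core.app]
        refine ⟨Finset.mem_union_right _ (h1 a ha').1, fun x => ?_⟩
        rcases closure₂_le_iff.1 (le_refl (closure₂ B D (σ.X v) (σ.X a) x)) with hc | ⟨y, hc⟩
        · exact hB _ _ (by omega)
        · have e1 := hunion (v := y) ((h1 v hv).2 y) ((h1 a ha').2 y) (by simp) (by simp)
          have e2 := hunion e1 (hD y x) (v := y) (by simp) (by simp)
          refine hmono e2 ?_ (by omega)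
          intro z hz
          simp only [Finset.mem_insert, Finset.mem_union, Finset.mem_singleton] at hz ⊢
          tauto
      · simp only [Function.update_of_ne hau, Guess.app, Core.app]
        exact h1 a ha'
    · simp only [Guess.app, Core.app, Core.cost, add_zero]
      rw [← Finset.add_sum_erase _ _ hv, ← Finset.add_sum_erase _ _ hu'] at h2
      rw [← Finset.add_sum_erase _ _ hu', Function.update_self]
      have : ∑ x ∈ (σ.al.erase v).erase u, Function.update τ u (τ v + τ u) x =
          ∑ x ∈ (σ.al.erase v).erase u, τ x :=
        Finset.sum_congr rfl fun x hx => Function.update_of_ne (Finset.ne_of_mem_erase hx) _ _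
      rw [this]; omega
    · intro s hs hsd
      simp only [Guess.app, Op.dropped, Finset.union_empty] at hsd
      exact hcov s (h3 s hs hsd)
    · intro t ht
      simp only [Guess.app, Op.used, Finset.union_empty] at ht
      exact hcov t (h4 t ht)
  | close u =>
    have hu : u ∈ σ.al := ho
    obtain ⟨τ', Cov', k1, k2, k3, -⟩ := hclose u (Cov u) (σ.X u u) hu subset_rfl
      (hmono ((h1 u hu).2 u) (Finset.subset_insert _ _) le_rfl)
    refine ⟨τ', Cov', k1, k2, ?_, ?_⟩
    · intro s hs hsd
      simp only [Guess.app, Op.dropped, Finset.union_empty] at hsd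
      obtain ⟨a, ha, hsa⟩ := h3 s hs hsd
      exact ⟨a, ha, k3 a hsa⟩
    · intro t ht
      simp only [Guess.app, Op.used, Finset.union_empty] at ht
      obtain ⟨a, ha, hsa⟩ := h4 t ht
      exact ⟨a, ha, k3 a hsa⟩
  | closeT u t =>
    have hu : u ∈ σ.al := ho
    obtain ⟨τ', Cov', k1, k2, k3, k4⟩ := hclose u (insert t (Cov u)) (σ.X u t) hu
      (Finset.subset_insert _ _) ((h1 u hu).2 t)
    refine ⟨τ', Cov', k1, k2, ?_, ?_⟩
    · intro s hs hsd
      simp only [Guess.app, Op.dropped, Finset.union_empty] at hsd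
      obtain ⟨a, ha, hsa⟩ := h3 s hs hsd
      exact ⟨a, ha, k3 a hsa⟩
    · intro x hx
      simp only [Guess.app, Op.used, Finset.mem_union, Finset.mem_singleton] at hx
      rcases hx with hx | rfl
      · obtain ⟨a, ha, hsa⟩ := h4 x hx
        exact ⟨a, ha, k3 a hsa⟩
      · exact ⟨u, hu, by rw [k4]; simp⟩

/-- The last living slot covers all chosen terminals and all undropped vertices of `S`; these
include the terminals in `S`, which are never dropped. Each remaining terminal is attached to an
undropped vertex of `S`, thus to the same connected set. -/
theorem Guess.Sound.value (hmono : ∀ {A A' : Finset (Fin n)} {c c' : ℕ}, Cn A c → A' ⊆ A →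
      c ≤ c' → Cn A' c')
    (hunion : ∀ {A A' : Finset (Fin n)} {c c' : ℕ} {v : Fin n}, Cn A c → Cn A' c' → v ∈ A →
      v ∈ A' → Cn (A ∪ A') (c + c'))
    (hB : ∀ A c, B ≤ c → Cn A c) (hD : ∀ u v, Cn {u, v} (D u v)) {σ : Guess n}
    (h : σ.Sound Cn B K S) : Cn K (σ.value B D K S) := by
  unfold Guess.value
  split_ifs with hcard
  swap
  · exact hB _ _ le_rfl
  obtain ⟨a, ha⟩ := Finset.card_eq_one.1 hcard
  obtain ⟨hK, h⟩ := h
  rcases h with h | ⟨τ, Cov, h1, h2, h3, h4⟩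
  · exact hB _ _ (by omega)
  rw [ha] at h1 h2 h3 h4 ⊢
  simp only [Finset.mem_singleton, forall_eq, exists_eq_left, Finset.sum_singleton] at h1 h2 h3 h4 ⊢
  have key : ∀ T : Finset (Fin n),
      Cn (Cov a ∪ T) (τ a + σ.X a a + ∑ t ∈ T, σ.dist B D S t) := by
    intro T
    induction T using Finset.induction_on with
    | empty => simpa using hmono (h1.2 a) (Finset.subset_insert _ _) le_rfl
    | insert t T htT ih =>
      rw [Finset.sum_insert htT]
      have hd := le_refl (σ.dist B D S t)
      conv at hd => lhs; unfold Guess.dist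
      rw [Finset.fold_min_le] at hd
      rcases hd with hd | ⟨s, -, hd⟩
      · exact hB _ _ (by omega)
      · split_ifs at hd with hs
        · have := hunion ih (hD s t) (v := s) (by simp [h3 s hs.1 hs.2]) (by simp)
          refine hmono this ?_ (by omega)
          intro x hx
          simp only [Finset.mem_insert, Finset.mem_union, Finset.mem_singleton] at hx ⊢
          tauto
        · exact hB _ _ (by omega)
  refine hmono (key ((K \ S) \ σ.us)) ?_ (by omega)
  intro t ht
  by_cases htS : t ∈ S
  · exact Finset.mem_union_left _ (h3 t htS (fun h => hK t h ht))
  · by_cases htu : t ∈ σ.us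
    · exact Finset.mem_union_left _ (h4 t htu)
    · exact Finset.mem_union_right _ (by simp [ht, htS, htu])

end

section

variable {n : ℕ}

/-! ## Numbers as guesses -/

/-- Position of a vertex of `S`, counted from `1`, and `0` for other vertices. -/
def slotIndex (S : Finset (Fin n)) (v : Fin n) : ℕ :=
  if v ∈ S then 1 + (S.filter (· < v)).card else 0

theorem slotIndex_pos {S : Finset (Fin n)} {v : Fin n} (hv : v ∈ S) : 0 < slotIndex S v := by
  rw [slotIndex, if_pos hv]; omega

theorem slotIndex_le (S : Finset (Fin n)) (v : Fin n) : slotIndex S v ≤ S.card := by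
  unfold slotIndex
  split_ifs with hv
  · have : (S.filter (· < v)).card < S.card :=
      Finset.card_lt_card ((Finset.ssubset_iff_of_subset (Finset.filter_subset _ _)).2
        ⟨v, hv, by simp⟩)
    omega
  · omega

theorem slotIndex_injOn {S : Finset (Fin n)} {u v : Fin n} (hu : u ∈ S) (hv : v ∈ S)
    (h : slotIndex S u = slotIndex S v) : u = v := by
  have key : ∀ {u v : Fin n}, u ∈ S → v ∈ S → u < v → slotIndex S u < slotIndex S v := by
    intro u v hu hv huv
    rw [slotIndex, slotIndex, if_pos hu, if_pos hv]
    have : (S.filter (· < u)).card < (S.filter (· < v)).card :=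
      Finset.card_lt_card ((Finset.ssubset_iff_of_subset (by
        intro x hx
        rw [Finset.mem_filter] at hx ⊢
        exact ⟨hx.1, hx.2.trans huv⟩)).2 ⟨u, by simp [hu, huv], by simp⟩)
    omega
  rcases lt_trichotomy u v with h1 | h1 | h1
  · exact absurd h (key hu hv h1).ne
  · exact h1
  · exact absurd h (key hv hu h1).ne'

open Classical in
/-- The element of a set with exactly one element. -/
noncomputable def pick (A : Finset (Fin n)) : Option (Fin n) :=
  if h : ∃ v, A = {v} then some h.choose else none

@[simp] theorem pick_singleton (v : Fin n) : pick ({v} : Finset (Fin n)) = some v := by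
  have h : ∃ u, ({v} : Finset (Fin n)) = {u} := ⟨v, rfl⟩
  rw [pick, dif_pos h]
  exact congrArg some (Finset.singleton_injective h.choose_spec).symm

@[simp] theorem pick_empty : pick (∅ : Finset (Fin n)) = none := by
  rw [pick, dif_neg]
  rintro ⟨v, h⟩
  exact Finset.singleton_ne_empty v h.symm

theorem pick_eq_some {A : Finset (Fin n)} {v : Fin n} (h : pick A = some v) : A = {v} := by
  unfold pick at h
  split_ifs at h with h'
  have := h'.choose_spec
  rw [Option.some.inj h] at this
  exact this

namespace Guess

variable (B : ℕ) (D : Fin n → Fin n → ℕ) (K S : Finset (Fin n))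

/-- The living slot with a given number. -/
def slotAt (σ : Guess n) (i : ℕ) : Finset (Fin n) := σ.al.filter (slotIndex S · = i)

/-- The unused terminal of the rank encoded by `k`, for the partial trees of the slots `J`. -/
def termAt (σ : Guess n) (J : Finset (Fin n)) (k : ℕ) : Finset (Fin n) :=
  ((K \ S) \ σ.us).filter fun t =>
    rank (K \ S) (σ.dist B D S) (fun x => ∑ v ∈ J, σ.X v x) t + 3 = k

/-- The operation encoded by the last digits of a number. -/
noncomputable def decode (σ : Guess n) (g : ℕ) : Op (Fin n) :=
  -- The first digit is the kind of the operation: `0`, `1`, `2` for dropping, merging and closing,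
  -- and the rank increased by `3` for closing with a terminal. Ranks below `|S|` thus need base
  -- `|S| + 3`, in which slot numbers up to `|S|` fit as well.
  let q := S.card + 3
  let k := g % q
  let I := σ.slotAt S (g / q % q)
  let J := σ.slotAt S (g / q / q % q)
  if k = 0 then
    match pick I with
    | some v => if v ∉ K ∧ S ⊆ σ.al ∪ σ.dr ∧ σ.us = ∅ then .drop v else .skip
    | none => .skip
  else if k = 1 then
    match pick I, pick J with
    | some v, some u => if v ≠ u then .merge v u else .skip
    | _, _ => .skip
  else if k = 2 then
    match pick J with
    | some u => .close u
    | none => .skip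
  else
    match pick J, pick (σ.termAt B D K S J k) with
    | some u, some t => .closeT u t
    | _, _ => .skip

variable {B D K S}

theorem valid_skip (σ : Guess n) : σ.Valid K S .skip :=
  ⟨trivial, fun _ h => (by cases h), fun _ _ h => (by cases h)⟩

theorem mem_of_pick_slotAt {σ : Guess n} {i : ℕ} {v : Fin n} (h : pick (σ.slotAt S i) = some v) :
    v ∈ σ.al := by
  have : v ∈ σ.slotAt S i := by rw [pick_eq_some h]; simp
  exact (Finset.mem_filter.1 this).1

/-- Whatever cannot be performed is decoded as `skip`. So every number is a sound guess, and the
minimum over all numbers cannot fall below the optimum. -/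
theorem valid_decode (σ : Guess n) (g : ℕ) : σ.Valid K S (σ.decode B D K S g) := by
  unfold decode
  simp only
  split_ifs with h0 h1 h2
  · split
    · next v hv =>
      split_ifs with h
      · refine ⟨mem_of_pick_slotAt hv, ?_, fun _ _ h => (by cases h)⟩
        intro v' h'
        injection h' with h'
        subst h'
        exact h
      · exact valid_skip σ
    · exact valid_skip σ
  · split
    · next v u hv hu =>
      split_ifs with h
      · exact ⟨⟨mem_of_pick_slotAt hv, mem_of_pick_slotAt hu, h⟩, fun _ h => (by cases h),
          fun _ _ h => (by cases h)⟩
      · exact valid_skip σ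
    · exact valid_skip σ
  · split
    · next u hu =>
      exact ⟨mem_of_pick_slotAt hu, fun _ h => (by cases h), fun _ _ h => (by cases h)⟩
    · exact valid_skip σ
  · split
    · next u t hu ht =>
      refine ⟨mem_of_pick_slotAt hu, fun _ h => (by cases h), ?_⟩
      intro u' t' h
      injection h with h h'
      subst h h'
      have : t ∈ {t} := Finset.mem_singleton_self t
      rw [← pick_eq_some ht] at this
      exact Finset.mem_sdiff.1 (Finset.mem_filter.1 this).1
    · exact valid_skip σ

variable (B D K S) in
/-- The code of an operation. -/
def code (σ : Guess n) : Op (Fin n) → ℕ × ℕ × ℕ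
  | .skip => (0, 0, 0)
  | .drop v => (0, slotIndex S v, 0)
  | .merge v u => (1, slotIndex S v, slotIndex S u)
  | .close u => (2, 0, slotIndex S u)
  | .closeT u t => (rank (K \ S) (σ.dist B D S) (σ.X u) t + 3, 0, slotIndex S u)

theorem slotAt_slotIndex {σ : Guess n} (hal : σ.al ⊆ S) {v : Fin n} (hv : v ∈ σ.al) :
    σ.slotAt S (slotIndex S v) = {v} := by
  ext x
  simp only [slotAt, Finset.mem_filter, Finset.mem_singleton]
  constructor
  · rintro ⟨hx, h⟩; exact slotIndex_injOn (hal hx) (hal hv) h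
  · rintro rfl; exact ⟨hv, rfl⟩

theorem decode_code {σ : Guess n} {o : Op (Fin n)} (hal : σ.al ⊆ S) (hv : σ.Valid K S o)
    (hskip : o ≠ .skip) {g : ℕ} (h1 : g % (S.card + 3) = (σ.code B D K S o).1)
    (h2 : g / (S.card + 3) % (S.card + 3) = (σ.code B D K S o).2.1)
    (h3 : g / (S.card + 3) / (S.card + 3) % (S.card + 3) = (σ.code B D K S o).2.2) :
    σ.decode B D K S g = o := by
  obtain ⟨ha, hd, ht⟩ := hv
  unfold decode
  simp only [h1, h2, h3]
  cases o with
  | skip => exact absurd rfl hskip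
  | drop v =>
    have hv : v ∈ σ.al := ha
    simp only [code, slotAt_slotIndex hal hv, pick_singleton, if_true]
    rw [if_pos (hd v rfl)]
  | merge v u =>
    obtain ⟨hv, hu, hvu⟩ := ha
    simp only [code, slotAt_slotIndex hal hv, slotAt_slotIndex hal hu, pick_singleton]
    simp [hvu]
  | close u =>
    have hu : u ∈ σ.al := ha
    simp only [code, slotAt_slotIndex hal hu, pick_singleton]
    simp
  | closeT u t =>
    have hu : u ∈ σ.al := ha
    obtain ⟨htU, htus⟩ := ht u t rfl
    have hT : σ.termAt B D K S {u} (rank (K \ S) (σ.dist B D S) (σ.X u) t + 3) = {t} := by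
      ext x
      simp only [termAt, Finset.mem_filter, Finset.mem_singleton, Finset.sum_singleton,
        Nat.add_right_cancel_iff]
      constructor
      · rintro ⟨hx, h⟩
        exact rank_injOn (Finset.mem_sdiff.1 hx).1 htU h
      · rintro rfl
        exact ⟨Finset.mem_sdiff.2 ⟨htU, htus⟩, rfl⟩
    simp only [code, slotAt_slotIndex hal hu, pick_singleton, hT]
    simp

variable (B D K S)

/-- One step of the evaluation of a guess. -/
noncomputable def step (p : Guess n × ℕ) : Guess n × ℕ :=
  (p.1.app B D (p.1.decode B D K S p.2), p.2 / (S.card + 3) / (S.card + 3) / (S.card + 3))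

/-- The number that encodes a list of operations. -/
def encode : Guess n → List (Op (Fin n)) → ℕ
  | _, [] => 0
  | σ, o :: l => (σ.code B D K S o).1 + (S.card + 3) * ((σ.code B D K S o).2.1 + (S.card + 3) *
      ((σ.code B D K S o).2.2 + (S.card + 3) * encode (σ.app B D o) l))

/-- Weight of the tree that is described by a number. -/
noncomputable def valueOf (g : ℕ) : ℕ :=
  ((step B D K S)^[2 * n] (Guess.init D S, g)).1.value B D K S

/-- Minimum of the values of the first `N` guesses, and of `b`. -/
noncomputable def best (b : ℕ) : ℕ → ℕ
  | 0 => b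
  | N + 1 => min (best b N) (valueOf B D K S N)

variable {B D K S}

theorem app_al_subset (σ : Guess n) (o : Op (Fin n)) : (σ.app B D o).al ⊆ σ.al := by
  cases o <;> simp [app, Core.app, Finset.erase_subset]

theorem digits {q k i j r : ℕ} (hk : k < q) (hi : i < q) (hj : j < q) :
    (k + q * (i + q * (j + q * r))) % q = k ∧ (k + q * (i + q * (j + q * r))) / q % q = i ∧
      (k + q * (i + q * (j + q * r))) / q / q % q = j ∧
      (k + q * (i + q * (j + q * r))) / q / q / q = r := by
  have hq : 0 < q := by omega
  refine ⟨?_, ?_, ?_, ?_⟩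
  · rw [Nat.add_mul_mod_self_left, Nat.mod_eq_of_lt hk]
  · rw [Nat.add_mul_div_left _ _ hq, Nat.div_eq_of_lt hk, zero_add, Nat.add_mul_mod_self_left,
      Nat.mod_eq_of_lt hi]
  · rw [Nat.add_mul_div_left _ _ hq, Nat.div_eq_of_lt hk, zero_add, Nat.add_mul_div_left _ _ hq,
      Nat.div_eq_of_lt hi, zero_add, Nat.add_mul_mod_self_left, Nat.mod_eq_of_lt hj]
  · rw [Nat.add_mul_div_left _ _ hq, Nat.div_eq_of_lt hk, zero_add, Nat.add_mul_div_left _ _ hq,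
      Nat.div_eq_of_lt hi, zero_add, Nat.add_mul_div_left _ _ hq, Nat.div_eq_of_lt hj, zero_add]

theorem code_lt {σ : Guess n} {o : Op (Fin n)}
    (hr : ∀ u t, o = .closeT u t → rank (K \ S) (σ.dist B D S) (σ.X u) t < S.card) :
    (σ.code B D K S o).1 < S.card + 3 ∧ (σ.code B D K S o).2.1 < S.card + 3 ∧
      (σ.code B D K S o).2.2 < S.card + 3 := by
  have := fun v => slotIndex_le S v
  cases o with
  | skip => simp [code]
  | drop v => have := this v; simp only [code]; omega
  | merge v u => have h1 := this v; have h2 := this u; simp only [code]; omega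
  | close u => have := this u; simp only [code]; omega
  | closeT u t => have h1 := this u; have h2 := hr u t rfl; simp only [code]; omega

theorem app_skip {σ : Guess n} (h : σ.tot ≤ B) : σ.app B D .skip = σ := by
  rcases σ with ⟨⟨al, X⟩, dr, us, tot⟩
  simp only at h
  simp [app, Core.app, Op.dropped, Op.used, Core.cost, h]

/-- Slots are numbered from `1`, so the digit `0` names no slot and the number `0` decodes to
`skip`. Guesses of any length can therefore be run for the same number `2 * n` of steps. -/
theorem step_zero {σ : Guess n} (hal : σ.al ⊆ S) (ht : σ.tot ≤ B) :
    step B D K S (σ, 0) = (σ, 0) := by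
  have hI : σ.slotAt S 0 = ∅ := by
    rw [slotAt, Finset.filter_eq_empty_iff]
    intro v hv
    exact (slotIndex_pos (hal hv)).ne'
  have : σ.decode B D K S 0 = .skip := by
    unfold decode
    simp [hI]
  simp [step, this, app_skip ht]

theorem iterate_encode : ∀ (m : ℕ) (l : List (Op (Fin n))) (σ : Guess n), l.length ≤ m →
    σ.Feasible B D K S l → σ.al ⊆ S → σ.tot ≤ B →
    (step B D K S)^[m] (σ, encode B D K S σ l) = (σ.run B D l, 0) := by
  intro m
  induction m with
  | zero =>
    intro l σ hl _ _ _
    rw [List.length_eq_zero_iff.1 (Nat.le_zero.1 hl)]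
    rfl
  | succ m ih =>
    intro l σ hl hf hal ht
    rw [Function.iterate_succ_apply]
    cases l with
    | nil =>
      rw [encode, step_zero hal ht]
      exact ih [] σ (by simp) trivial hal ht
    | cons o l =>
      obtain ⟨⟨hv, hs, hr⟩, hf⟩ := hf
      obtain ⟨c1, c2, c3⟩ := code_lt hr
      obtain ⟨d1, d2, d3, d4⟩ := digits (r := encode B D K S (σ.app B D o) l) c1 c2 c3
      have hdec : σ.decode B D K S (encode B D K S σ (o :: l)) = o :=
        decode_code hal hv hs d1 d2 d3
      have hstep : step B D K S (σ, encode B D K S σ (o :: l)) =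
          (σ.app B D o, encode B D K S (σ.app B D o) l) := by
        unfold step
        rw [hdec]
        exact Prod.ext rfl d4
      rw [hstep]
      exact ih l _ (by simpa using hl) hf ((app_al_subset σ o).trans hal) (min_le_left _ _)

theorem encode_lt : ∀ (l : List (Op (Fin n))) (σ : Guess n), σ.Feasible B D K S l →
    encode B D K S σ l < (S.card + 3) ^ (3 * l.length) := by
  intro l
  induction l with
  | nil => intro σ _; simp [encode]
  | cons o l ih =>
    intro σ hf
    obtain ⟨⟨hv, hs, hr⟩, hf⟩ := hf
    obtain ⟨c1, c2, c3⟩ := code_lt hr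
    have h := ih _ hf
    have key : ∀ {a b q m : ℕ}, a < q → b < m → a + q * b < q * m := by
      intro a b q m ha hb
      calc a + q * b < q * (b + 1) := by rw [Nat.mul_add]; omega
        _ ≤ q * m := Nat.mul_le_mul_left _ hb
    have := key c1 (key c2 (key c3 h))
    rw [encode]
    refine this.trans_le (le_of_eq ?_)
    rw [List.length_cons]
    ring

theorem best_le_init (b N : ℕ) : best B D K S b N ≤ b := by
  induction N with
  | zero => exact le_rfl
  | succ N ih => exact (min_le_left _ _).trans ih

theorem best_le_value {b N g : ℕ} (h : g < N) : best B D K S b N ≤ valueOf B D K S g := by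
  induction N with
  | zero => omega
  | succ N ih =>
    rcases Nat.lt_succ_iff_lt_or_eq.1 h with h | rfl
    · exact (min_le_left _ _).trans (ih h)
    · exact min_le_right _ _

/-- A tree gives at most `2 * |S|` operations of three digits each; this is the exponent `6 * |S|`.
-/
theorem best_le_of_tree {G : SimpleGraph (Fin n)} {w : Sym2 (Fin n) → ℕ}
    (htri : ∀ u x v, D u v ≤ D u x + D x v) (h0 : ∀ v, D v v = 0)
    (hadj : ∀ u v, G.Adj u v → D u v ≤ w s(u, v))
    (hcut : ∀ v t t', t ∈ K \ S → t' ∈ K \ S →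
      Relation.ReflTransGen (fun x y => G.Adj x y ∧ x ∉ S ∧ y ∉ S) v t →
      Relation.ReflTransGen (fun x y => G.Adj x y ∧ x ∉ S ∧ y ∉ S) v t' → t = t')
    {v : Fin n} {X : Finset (Fin n)} {b c : ℕ} (hT : TreeIn G w v X c) (hv : v ∈ S) (hK : K ⊆ X) :
    best B D K S b ((S.card + 3) ^ (6 * S.card)) ≤ c := by
  obtain ⟨l, h1, h2, h3⟩ := hT.exists_guess (B := B) htri h0 hadj hcut hv hK
  have hcard : S.card ≤ n := by simpa using Finset.card_le_univ S
  have he := iterate_encode (2 * n) l (Guess.init D S) (by omega) h2 subset_rfl (Nat.zero_le _)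
  have hlt : encode B D K S (Guess.init D S) l < (S.card + 3) ^ (6 * S.card) :=
    (encode_lt l _ h2).trans_le (Nat.pow_le_pow_right (by omega) (by omega))
  refine (best_le_value hlt).trans ?_
  unfold valueOf
  rw [he]
  exact h3

theorem best_sound {Cn : Finset (Fin n) → ℕ → Prop}
    (hmono : ∀ {A A' : Finset (Fin n)} {c c' : ℕ}, Cn A c → A' ⊆ A → c ≤ c' → Cn A' c')
    (hunion : ∀ {A A' : Finset (Fin n)} {c c' : ℕ} {v : Fin n}, Cn A c → Cn A' c' → v ∈ A →
      v ∈ A' → Cn (A ∪ A') (c + c'))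
    (hB : ∀ A c, B ≤ c → Cn A c) (hD : ∀ u v, Cn {u, v} (D u v)) {b : ℕ} (hb : Cn K b) (N : ℕ) :
    Cn K (best B D K S b N) := by
  have hval : ∀ g, Cn K (valueOf B D K S g) := by
    intro g
    have : ∀ m, ((step B D K S)^[m] (Guess.init D S, g)).1.Sound Cn B K S := by
      intro m
      induction m with
      | zero => exact Guess.sound_init hD
      | succ m ih =>
        rw [Function.iterate_succ_apply']
        exact ih.app hmono hunion hB hD (valid_decode _ _)
    exact (this _).value hmono hunion hB hD
  induction N with
  | zero => exact hb
  | succ N ih =>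
    rw [best]
    rcases min_choice (best B D K S b N) (valueOf B D K S N) with h | h <;> rw [h]
    · exact ih
    · exact hval N

end Guess

/-! ## Shortest paths -/

/-- The algorithm of Floyd and Warshall on a matrix with entry `0` for a non-edge and `c + 1` for an
edge of weight `c`; non-edges get weight `B`. -/
def shortest (B : ℕ) (C : Fin n → Fin n → ℕ) : ℕ → Fin n → Fin n → ℕ
  | 0 => fun u v => if u = v then 0 else if C u v ≠ 0 then C u v - 1 else B
  | k + 1 => fun u v => if h : k < n then min (shortest B C k u v)
      (shortest B C k u ⟨k, h⟩ + shortest B C k ⟨k, h⟩ v) else shortest B C k u v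

section

variable {B : ℕ} {C : Fin n → Fin n → ℕ}

theorem shortest_succ_le (k : ℕ) (u v : Fin n) : shortest B C (k + 1) u v ≤ shortest B C k u v := by
  simp only [shortest]; split_ifs
  · exact min_le_left _ _
  · exact le_rfl

theorem shortest_le_zero (k : ℕ) (u v : Fin n) : shortest B C k u v ≤ shortest B C 0 u v := by
  induction k with
  | zero => exact le_rfl
  | succ k ih => exact (shortest_succ_le k u v).trans ih

theorem shortest_self (k : ℕ) (v : Fin n) : shortest B C k v v = 0 := by
  have := shortest_le_zero (B := B) (C := C) k v v
  rw [show shortest B C 0 v v = 0 by simp [shortest]] at this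
  omega

theorem shortest_le_bound (hC : ∀ u v, C u v ≤ B) (k : ℕ) (u v : Fin n) :
    shortest B C k u v ≤ B := by
  refine (shortest_le_zero k u v).trans ?_
  have := hC u v
  simp only [shortest]; split_ifs <;> omega

/-- The inequality holds through all vertices processed so far. A round preserves it for the earlier
vertices and adds it for its own vertex, whose distance to itself is zero. No paths have to be
considered. -/
theorem shortest_triangle_of_lt (k : ℕ) (hk : k ≤ n) : ∀ u v x : Fin n, x.1 < k →
    shortest B C k u v ≤ shortest B C k u x + shortest B C k x v := by
  induction k with
  | zero => intro u v x hx; omega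
  | succ k ih =>
    intro u v x hx
    have hkn : k < n := by omega
    have ih := ih (by omega)
    simp only [shortest, dif_pos hkn]
    generalize hd : shortest B C k = d at *
    have hself : ∀ v, d v v = 0 := fun v => hd ▸ shortest_self k v
    rcases Nat.lt_succ_iff_lt_or_eq.1 hx with hx | hx
    · have h1 := ih u v x hx
      have h2 := ih u ⟨k, hkn⟩ x hx
      have h3 := ih ⟨k, hkn⟩ v x hx
      omega
    · have hxk : x = ⟨k, hkn⟩ := Fin.ext hx
      subst hxk
      have h1 := hself ⟨k, hkn⟩
      omega

theorem shortest_triangle (u x v : Fin n) :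
    shortest B C n u v ≤ shortest B C n u x + shortest B C n x v :=
  shortest_triangle_of_lt n le_rfl u v x x.2

theorem shortest_sound {Cn : Finset (Fin n) → ℕ → Prop}
    (hmono : ∀ {A A' : Finset (Fin n)} {c c' : ℕ}, Cn A c → A' ⊆ A → c ≤ c' → Cn A' c')
    (hunion : ∀ {A A' : Finset (Fin n)} {c c' : ℕ} {v : Fin n}, Cn A c → Cn A' c' → v ∈ A →
      v ∈ A' → Cn (A ∪ A') (c + c'))
    (hB : ∀ A c, B ≤ c → Cn A c) (hone : ∀ v, Cn {v} 0)
    (hedge : ∀ u v, C u v ≠ 0 → Cn {u, v} (C u v - 1)) (k : ℕ) :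
    ∀ u v, Cn {u, v} (shortest B C k u v) := by
  induction k with
  | zero =>
    intro u v
    simp only [shortest]; split_ifs with h h'
    · subst h; simpa using hone u
    · exact hedge u v h'
    · exact hB _ _ le_rfl
  | succ k ih =>
    intro u v
    simp only [shortest]; split_ifs with h
    · rcases min_choice (shortest B C k u v)
        (shortest B C k u ⟨k, h⟩ + shortest B C k ⟨k, h⟩ v) with h' | h' <;> rw [h']
      · exact ih u v
      · refine hmono (hunion (ih u ⟨k, h⟩) (ih ⟨k, h⟩ v) (v := ⟨k, h⟩) (by simp) (by simp)) ?_ le_rfl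
        intro x hx
        simp only [Finset.mem_insert, Finset.mem_singleton] at hx
        rcases hx with rfl | rfl <;> simp
    · exact ih u v

end

/-! ## The weight of a minimum Steiner tree -/

open Classical in
/-- Weighted adjacency matrix, with entry `0` for a non-edge and `c + 1` for an edge of weight `c`. -/
noncomputable def weightMatrix (G : SimpleGraph (Fin n)) (w : Sym2 (Fin n) → ℕ) (u v : Fin n) : ℕ :=
  if G.Adj u v then w s(u, v) + 1 else 0

/-- The minimum weight that the algorithm computes. -/
noncomputable def treeWeight (B : ℕ) (K S : Finset (Fin n)) (C : Fin n → Fin n → ℕ) : ℕ :=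
  Guess.best B (shortest B C n) K S (if 1 < K.card then B else 0) ((S.card + 3) ^ (6 * S.card))

theorem reachable_of_reflTransGen {G : SimpleGraph (Fin n)} {S : Finset (Fin n)} {v t : Fin n}
    (h : Relation.ReflTransGen (fun x y => G.Adj x y ∧ x ∉ S ∧ y ∉ S) v t) (hv : v ∉ S) :
    ∃ ht : t ∉ S, (G.induce {v | v ∉ S}).Reachable ⟨v, hv⟩ ⟨t, ht⟩ := by
  induction h with
  | refl => exact ⟨hv, SimpleGraph.Reachable.refl _⟩
  | @tail x y _ hxy ih =>
    obtain ⟨hx, hr⟩ := ih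
    refine ⟨hxy.2.2, hr.trans (SimpleGraph.Adj.reachable ?_)⟩
    exact hxy.1

theorem IsMultiwayCut.eq_of_reflTransGen {G : SimpleGraph (Fin n)} {K S : Finset (Fin n)}
    (h : IsMultiwayCut G K S) (v t t' : Fin n) (ht : t ∈ K \ S) (ht' : t' ∈ K \ S)
    (hr : Relation.ReflTransGen (fun x y => G.Adj x y ∧ x ∉ S ∧ y ∉ S) v t)
    (hr' : Relation.ReflTransGen (fun x y => G.Adj x y ∧ x ∉ S ∧ y ∉ S) v t') : t = t' := by
  rw [Finset.mem_sdiff] at ht ht'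
  by_cases hv : v ∈ S
  · rcases hr.cases_head with rfl | ⟨x, hx, -⟩
    · exact absurd hv ht.2
    · exact absurd hv hx.2.1
  · obtain ⟨h1, h2⟩ := reachable_of_reflTransGen hr hv
    obtain ⟨h1', h2'⟩ := reachable_of_reflTransGen hr' hv
    have := h ((G.induce {v | v ∉ S}).connectedComponentMk ⟨v, hv⟩)
      (x := ⟨t, h1⟩) ⟨SimpleGraph.ConnectedComponent.sound h2.symm, ht.1⟩
      (y := ⟨t', h1'⟩) ⟨SimpleGraph.ConnectedComponent.sound h2'.symm, ht'.1⟩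
    exact congrArg Subtype.val this

theorem TreeIn.reflTransGen {G : SimpleGraph (Fin n)} {w : Sym2 (Fin n) → ℕ} {S : Finset (Fin n)}
    {v : Fin n} {X : Finset (Fin n)} {c : ℕ} (h : TreeIn G w v X c) : (∀ x ∈ X, x ∉ S) →
    ∀ x ∈ X, Relation.ReflTransGen (fun x y => G.Adj x y ∧ x ∉ S ∧ y ∉ S) v x := by
  induction h with
  | single v => intro _ x hx; rw [Finset.mem_singleton.1 hx]
  | @step v u X c h hT hv ih =>
    intro hS x hx
    have ih := ih fun x hx => hS x (Finset.mem_insert_of_mem hx)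
    rcases Finset.mem_insert.1 hx with rfl | hx
    · exact .refl
    · exact .head ⟨h, hS v (by simp), hS u (Finset.mem_insert_of_mem hT.root_mem)⟩ (ih x hx)
  | join hX hY h ihX ihY =>
    intro hS x hx
    rcases Finset.mem_union.1 hx with hx | hx
    · exact ihX (fun x hx => hS x (Finset.mem_union_left _ hx)) x hx
    · exact ihY (fun x hx => hS x (Finset.mem_union_right _ hx)) x hx

/-- The predicate that `c` is at least `B` or suffices to connect `A` is monotone and closed under
unions with a common vertex, which is all that soundness of distances and guesses requires. -/
theorem treeWeight_sound (hn : 0 < n) {B : ℕ} {K S : Finset (Fin n)} {G : SimpleGraph (Fin n)}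
    {w : Sym2 (Fin n) → ℕ} :
    B ≤ treeWeight B K S (weightMatrix G w) ∨
      Connects G w K (treeWeight B K S (weightMatrix G w)) := by
  set Cn : Finset (Fin n) → ℕ → Prop := fun A c => B ≤ c ∨ Connects G w A c with hCn
  have hmono : ∀ {A A' : Finset (Fin n)} {c c' : ℕ}, Cn A c → A' ⊆ A → c ≤ c' → Cn A' c' := by
    rintro A A' c c' (h | h) hA hc
    · exact Or.inl (h.trans hc)
    · exact Or.inr (h.mono hA hc)
  have hunion : ∀ {A A' : Finset (Fin n)} {c c' : ℕ} {v : Fin n}, Cn A c → Cn A' c' → v ∈ A →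
      v ∈ A' → Cn (A ∪ A') (c + c') := by
    rintro A A' c c' v (h | h) (h' | h') hv hv'
    · left; omega
    · left; omega
    · left; omega
    · exact Or.inr (h.union h' hv hv')
  have hB : ∀ A c, B ≤ c → Cn A c := fun A c h => Or.inl h
  refine Guess.best_sound (Cn := Cn) hmono hunion hB (shortest_sound hmono hunion hB
    (fun v => Or.inr (connects_singleton v)) ?_ n) ?_ _
  · intro u v huv
    unfold weightMatrix at huv ⊢
    split_ifs at huv ⊢ with h
    · exact Or.inr (by simpa using connects_pair h)
    · exact absurd rfl huv
  · split_ifs with h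
    · exact Or.inl le_rfl
    · right
      rcases K.eq_empty_or_nonempty with rfl | ⟨v, hv⟩
      · exact (connects_singleton ⟨0, hn⟩).mono (Finset.empty_subset _) le_rfl
      · refine (connects_singleton v).mono ?_ le_rfl
        intro x hx
        rw [Finset.mem_singleton]
        exact Finset.card_le_one.1 (not_lt.1 h) x hx v hv

/-- With two terminals or more, a connected subgraph that avoids `S` would join two of them within
one component; so there is a vertex of `S` at which a spanning tree can be rooted. The multiway cut
is one for a larger graph `G₀`, because the weight is also needed after deletions of edges. -/
theorem treeWeight_le {B c : ℕ} {K S : Finset (Fin n)} {G₀ G : SimpleGraph (Fin n)}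
    {w : Sym2 (Fin n) → ℕ} (hcut : IsMultiwayCut G₀ K S) (hG : G ≤ G₀)
    (h : Connects G w K c) : treeWeight B K S (weightMatrix G w) ≤ c := by
  classical
  by_cases hK : 1 < K.card
  swap
  · refine (Guess.best_le_init _ _).trans ?_
    rw [if_neg hK]; exact Nat.zero_le _
  obtain ⟨H, h1, h2, h3, h4⟩ := h
  have hcut' : ∀ v t t', t ∈ K \ S → t' ∈ K \ S →
      Relation.ReflTransGen (fun x y => G.Adj x y ∧ x ∉ S ∧ y ∉ S) v t →
      Relation.ReflTransGen (fun x y => G.Adj x y ∧ x ∉ S ∧ y ∉ S) v t' → t = t' := by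
    intro v t t' ht ht' hr hr'
    exact hcut.eq_of_reflTransGen v t t' ht ht'
      (Relation.ReflTransGen.mono (fun _ _ h => ⟨hG h.1, h.2⟩) _ _ hr)
      (Relation.ReflTransGen.mono (fun _ _ h => ⟨hG h.1, h.2⟩) _ _ hr')
  obtain ⟨x, y, hx, hy, hxy⟩ := Finset.one_lt_card_iff.1 hK
  obtain ⟨v, hvH, hvS⟩ : ∃ v ∈ H.verts, v ∈ S := by
    by_contra! hcon
    obtain ⟨c, hT, -⟩ := exists_rootedTree (w := w) h1 h3 (h2 x hx)
    have hr := hT.reflTransGen (S := S) (by simpa using hcon)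
    exact hxy (hcut' x x y (by simp [hx, hcon x (h2 x hx)]) (by simp [hy, hcon y (h2 y hy)])
      (hr x hT.root_mem) (hr y (by simpa using h2 y hy)))
  obtain ⟨c', hT, hc'⟩ := exists_rootedTree (w := w) h1 h3 hvH
  refine (Guess.best_le_of_tree shortest_triangle (shortest_self n) ?_ hcut' hT hvS ?_).trans
    (hc'.trans h4)
  · intro u v huv
    refine (shortest_le_zero n u v).trans ?_
    simp [shortest, weightMatrix, huv, huv.ne]
  · intro t ht
    simpa using h2 t ht

end

/-- Characteristic vector. -/
def indic {n : ℕ} (A : Finset (Fin n)) (v : Fin n) : ℕ := if v ∈ A then 1 else 0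

section

variable {n : ℕ}

theorem indic_le_one (A : Finset (Fin n)) (v : Fin n) : indic A v ≤ 1 := by
  unfold indic; split_ifs <;> omega

theorem sum_indic_mul (A : Finset (Fin n)) (f : Fin n → ℕ) :
    ∑ v, indic A v * f v = ∑ v ∈ A, f v := by
  simp [indic, Finset.sum_ite_mem]

theorem sum_indic (A : Finset (Fin n)) : ∑ v, indic A v = A.card := by
  simpa using sum_indic_mul A fun _ => 1

end

/-! ### Derived expressions and the meaning of assignments. -/

namespace LogRAM

namespace Expr

protected def plus (a b : Expr) : Expr := bin .add a b
protected def minus (a b : Expr) : Expr := bin .sub a b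
protected def times (a b : Expr) : Expr := bin .mul a b
protected def quot (a b : Expr) : Expr := bin .div a b
protected def remainder (a b : Expr) : Expr := a.minus (b.times (a.quot b))
protected def less (a b : Expr) : Expr := ite (b.minus a) (lit 1) (lit 0)
protected def same (a b : Expr) : Expr := ite ((a.minus b).plus (b.minus a)) (lit 0) (lit 1)
protected def no (a : Expr) : Expr := ite a (lit 0) (lit 1)
protected def least (a b : Expr) : Expr := ite (a.less b) a b
protected def total (a : Expr) : Expr := agg .add (lit 0) a
/-- Entry of an array that depends only on the first index. -/
protected def vec (a x : ℕ) : Expr := rd (.arr a) x x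
/-- Value of an array all of whose entries are equal. -/
protected def const (a : ℕ) : Expr := rd (.arr a) 0 0

section

variable {n : ℕ} (E : Env n) (d : ℕ) (ρ : ℕ → Fin n)

@[simp] theorem ev_lit (c : ℕ) : (lit c).ev E d ρ = c := (rfl)
@[simp] theorem ev_dim : dim.ev E d ρ = n := (rfl)
@[simp] theorem ev_idx (x : ℕ) : (idx x).ev E d ρ = ρ x := (rfl)
@[simp] theorem ev_rd (a : Src) (x y : ℕ) : (rd a x y).ev E d ρ = E a (ρ x) (ρ y) := (rfl)
@[simp] theorem ev_ite (c t e : Expr) :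
    (ite c t e).ev E d ρ = if c.ev E d ρ = 0 then e.ev E d ρ else t.ev E d ρ := by
  simp [Expr.ev]
@[simp] theorem ev_plus (a b : Expr) : (a.plus b).ev E d ρ = a.ev E d ρ + b.ev E d ρ := (rfl)
@[simp] theorem ev_minus (a b : Expr) : (a.minus b).ev E d ρ = a.ev E d ρ - b.ev E d ρ := (rfl)
@[simp] theorem ev_times (a b : Expr) : (a.times b).ev E d ρ = a.ev E d ρ * b.ev E d ρ := (rfl)
@[simp] theorem ev_quot (a b : Expr) : (a.quot b).ev E d ρ = a.ev E d ρ / b.ev E d ρ := (rfl)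
@[simp] theorem ev_remainder (a b : Expr) :
    (a.remainder b).ev E d ρ = a.ev E d ρ % b.ev E d ρ := by
  simp [Expr.remainder, Nat.mod_eq_sub]
@[simp] theorem ev_less (a b : Expr) :
    (a.less b).ev E d ρ = if a.ev E d ρ < b.ev E d ρ then 1 else 0 := by
  simp only [Expr.less, ev_ite, ev_minus, ev_lit]
  by_cases h : a.ev E d ρ < b.ev E d ρ
  · rw [if_pos h, if_neg (by omega)]
  · rw [if_neg h, if_pos (by omega)]
@[simp] theorem ev_same (a b : Expr) :
    (a.same b).ev E d ρ = if a.ev E d ρ = b.ev E d ρ then 1 else 0 := by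
  simp only [Expr.same, ev_ite, ev_minus, ev_plus, ev_lit]
  by_cases h : a.ev E d ρ = b.ev E d ρ
  · rw [if_pos h, if_pos (by omega)]
  · rw [if_neg h, if_neg (by omega)]
@[simp] theorem ev_no (a : Expr) : a.no.ev E d ρ = if a.ev E d ρ = 0 then 1 else 0 := by
  simp [Expr.no]
@[simp] theorem ev_least (a b : Expr) : (a.least b).ev E d ρ = min (a.ev E d ρ) (b.ev E d ρ) := by
  simp only [Expr.least, ev_ite, ev_less]
  by_cases h : a.ev E d ρ < b.ev E d ρ
  · simp [h, h.le]
  · simp [h, not_lt.1 h]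
@[simp] theorem ev_total (a : Expr) :
    a.total.ev E d ρ = ∑ v, a.ev E (d + 1) (Function.update ρ d v) := by
  simp [Expr.total, Expr.ev, AggOp.ev]
@[simp] theorem ev_min (a b : Expr) : (agg .min a b).ev E d ρ =
    Finset.univ.fold Min.min (a.ev E d ρ) fun v => b.ev E (d + 1) (Function.update ρ d v) := (rfl)
@[simp] theorem ev_vec (a x : ℕ) : (Expr.vec a x).ev E d ρ = E (.arr a) (ρ x) (ρ x) := (rfl)
@[simp] theorem ev_const (a : ℕ) : (Expr.const a).ev E d ρ = E (.arr a) (ρ 0) (ρ 0) := (rfl)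

end

end Expr

@[simp] theorem entryIdx_zero {n : ℕ} (i j : Fin n) : entryIdx i j 0 = i := by simp [entryIdx]

@[simp] theorem entryIdx_one {n : ℕ} (i j : Fin n) : entryIdx i j 1 = j := by simp [entryIdx]

section

variable {n cap N : ℕ}

@[simp] theorem Env.set_arr (E : Env n) (a : ℕ) (f : Fin n → Fin n → ℕ) (b : ℕ) :
    E.set a f (.arr b) = if b = a then f else E (.arr b) := rfl
@[simp] theorem Env.set_inM (E : Env n) (a : ℕ) (f : Fin n → Fin n → ℕ) :
    E.set a f .inM = E .inM := rfl
@[simp] theorem Env.set_inK (E : Env n) (a : ℕ) (f : Fin n → Fin n → ℕ) :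
    E.set a f .inK = E .inK := rfl
@[simp] theorem Env.set_inS (E : Env n) (a : ℕ) (f : Fin n → Fin n → ℕ) :
    E.set a f .inS = E .inS := rfl

theorem Cmd.sem_set (a : ℕ) {e : Expr} {E : Env n} (f : Fin n → Fin n → ℕ)
    (h : ∀ i j, e.ev E 2 (entryIdx i j) = f i j) (hc : ∀ i j, f i j ≤ cap) :
    (Cmd.set a e).sem cap N E = E.set a f := by
  simp only [Cmd.sem]
  congr 1
  funext i j
  rw [h, min_eq_left (hc i j)]

theorem Cmd.sem_seq (c₁ c₂ : Cmd) (E : Env n) :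
    (c₁.seq c₂).sem cap N E = c₂.sem cap N (c₁.sem cap N E) := rfl

/-- The command assigns only to arrays with numbers from `m` on. -/
def Cmd.From (m : ℕ) : Cmd → Prop
  | set a _ => m ≤ a
  | seq c₁ c₂ => From m c₁ ∧ From m c₂
  | forN c => From m c
  | forG c => From m c

/-- Two environments agree on the input and on the arrays with numbers less than `m`. -/
def Env.Agree (m : ℕ) (E E' : Env n) : Prop :=
  E' .inM = E .inM ∧ E' .inK = E .inK ∧ E' .inS = E .inS ∧ ∀ a < m, E' (.arr a) = E (.arr a)

theorem Env.Agree.refl (m : ℕ) (E : Env n) : E.Agree m E := ⟨rfl, rfl, rfl, fun _ _ => rfl⟩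

theorem Env.Agree.trans {m : ℕ} {E₁ E₂ E₃ : Env n} (h : E₁.Agree m E₂) (h' : E₂.Agree m E₃) :
    E₁.Agree m E₃ :=
  ⟨h'.1.trans h.1, h'.2.1.trans h.2.1, h'.2.2.1.trans h.2.2.1,
    fun a ha => (h'.2.2.2 a ha).trans (h.2.2.2 a ha)⟩

/-- Framing by array numbers: arrays below `10` belong to the main program, those from `10` to the
evaluation of a graph, those from `20` to the evaluation of a single guess. -/
theorem Cmd.agree_sem {m : ℕ} (c : Cmd) : ∀ E : Env n, c.From m → E.Agree m (c.sem cap N E) := by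
  have hit : ∀ f : Env n → Env n, (∀ E : Env n, E.Agree m (f E)) → ∀ (k : ℕ) (E : Env n),
      E.Agree m (f^[k] E) := by
    intro f hf k
    induction k with
    | zero => exact Env.Agree.refl m
    | succ k ih => intro E; rw [Function.iterate_succ_apply']; exact (ih E).trans (hf _)
  induction c with
  | set a e =>
    refine fun E h => ⟨rfl, rfl, rfl, fun b hb => ?_⟩
    have h : m ≤ a := h
    simp only [Cmd.sem, Env.set_arr]
    rw [if_neg (by omega)]
  | seq c₁ c₂ h₁ h₂ => exact fun E h => (h₁ E h.1).trans (h₂ _ h.2)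
  | forN c ih => exact fun E h => hit _ (fun E => ih E h) n E
  | forG c ih => exact fun E h => hit _ (fun E => ih E h) N E

end

open LogRAM.Cmd LogRAM.Expr in
/-- The algorithm of Floyd and Warshall: from array `0` to array `10`. -/
def shortestCmd : Cmd :=
  (set 10 (ite ((idx 0).same (idx 1)) (lit 0)
    (ite (rd (.arr 0) 0 1) ((rd (.arr 0) 0 1).minus (lit 1)) (Expr.const 4)))).seq <|
  (set 11 (lit 0)).seq <|
  forN <|
  (set 10 ((rd (.arr 10) 0 1).least
    -- Arrays are read only at index variables, so the vertex with the number in array `11` is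
    -- selected by a sum in which all other terms vanish.
    (((idx 2).same (Expr.const 11)).times ((rd (.arr 10) 0 2).plus (rd (.arr 10) 2 1))).total)).seq
  (set 11 ((Expr.const 11).plus (lit 1)))

/-- The number of vertices, the number of guesses and the bound on the weight of trees are compatible
with the cap. -/
structure Fits (n cap N B : ℕ) : Prop where
  sq : n * n ≤ cap
  guesses : N ≤ cap
  bound : (n + 2) * B ≤ cap
  card : n + 3 ≤ cap

theorem Fits.bound_le {n cap N B : ℕ} (h : Fits n cap N B) : B ≤ cap := by
  have := h.bound
  nlinarith [Nat.zero_le (n * B)]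

section

variable {n cap N B : ℕ}

theorem shortestCmd_sem (hf : Fits n cap N B) {E : Env n} {C : Fin n → Fin n → ℕ}
    (hB : E (.arr 4) = fun _ _ => B) (hC : E (.arr 0) = C) (hle : ∀ i j, C i j ≤ B) :
    (shortestCmd.sem cap N E) (.arr 10) = shortest B C n := by
  have hBc := hf.bound_le
  have hn := hf.card
  set body : Cmd := (Cmd.set 10 ((Expr.rd (.arr 10) 0 1).least
    (((Expr.idx 2).same (Expr.const 11)).times
      ((Expr.rd (.arr 10) 0 2).plus (Expr.rd (.arr 10) 2 1))).total)).seq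
    (Cmd.set 11 ((Expr.const 11).plus (Expr.lit 1))) with hbody
  have hstep : ∀ k < n, ∀ F : Env n, F (.arr 10) = shortest B C k → F (.arr 11) = (fun _ _ => k) →
      (body.sem cap N F) (.arr 10) = shortest B C (k + 1) ∧
      (body.sem cap N F) (.arr 11) = fun _ _ => k + 1 := by
    intro k hk F h1 h2
    rw [hbody, Cmd.sem_seq, Cmd.sem_set 10 (shortest B C (k + 1)),
      Cmd.sem_set 11 (fun _ _ => k + 1)]
    · simp
    · simp [h2]
    · intro _ _; omega
    · intro i j
      simp only [Expr.ev_least, Expr.ev_rd, Expr.ev_total, Expr.ev_times, Expr.ev_same,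
        Expr.ev_plus, Expr.ev_idx, Expr.ev_const, h1, h2, entryIdx_zero, entryIdx_one,
        Function.update_self, ne_eq, OfNat.zero_ne_ofNat, OfNat.one_ne_ofNat, not_false_eq_true,
        Function.update_of_ne, shortest, dif_pos hk]
      congr 1
      rw [Finset.sum_eq_single ⟨k, hk⟩]
      · simp
      · intro b _ hb
        rw [if_neg (fun h => hb (Fin.ext h)), zero_mul]
      · simp
    · intro i j; exact (shortest_le_bound hle _ i j).trans hBc
  have hiter : ∀ k ≤ n, ∀ F : Env n, F (.arr 10) = shortest B C 0 → F (.arr 11) = (fun _ _ => 0) →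
      ((body.sem cap N)^[k] F) (.arr 10) = shortest B C k ∧
      ((body.sem cap N)^[k] F) (.arr 11) = fun _ _ => k := by
    intro k
    induction k with
    | zero => exact fun _ F h1 h2 => ⟨h1, h2⟩
    | succ k ih =>
      intro hk F h1 h2
      rw [Function.iterate_succ_apply']
      obtain ⟨h3, h4⟩ := ih (by omega) F h1 h2
      exact hstep k (by omega) _ h3 h4
  unfold shortestCmd
  rw [Cmd.sem_seq, Cmd.sem_seq, Cmd.sem_set 10 (shortest B C 0),
    Cmd.sem_set 11 (fun _ _ => 0)]
  · exact (hiter n le_rfl _ (by simp) (by simp)).1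
  · simp
  · intro _ _; omega
  · intro i j
    simp [hC, hB, shortest, Fin.ext_iff]
  · intro i j; exact (shortest_le_bound hle _ i j).trans hBc

end

/-! ### Program for one operation of a guess. -/

open LogRAM.Cmd LogRAM.Expr in
/-- One step of the evaluation of a guess. -/
def stepCmd : Cmd :=
  -- Array `26` gets the kind of the operation, `27` and `28` the two slots as characteristic
  -- vectors, `29` and `30` their partial weights. Arrays `31` and `32` are distances and ranks;
  -- `33`, `34` and `35` indicate the chosen terminal, the dropped slot and a merge. The number
  -- itself is shifted once its three digits have been read.
  (set 26 ((Expr.const 20).remainder (Expr.const 5))).seq <|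
  (set 27 ((Expr.vec 22 0).times
    ((Expr.vec 6 0).same (((Expr.const 20).quot (Expr.const 5)).remainder (Expr.const 5))))).seq <|
  (set 28 ((Expr.vec 22 0).times ((Expr.vec 6 0).same
    ((((Expr.const 20).quot (Expr.const 5)).quot (Expr.const 5)).remainder (Expr.const 5))))).seq <|
  (set 20 (((Expr.const 20).quot (Expr.const 5)).quot (Expr.const 5) |>.quot (Expr.const 5))).seq <|
  (set 29 ((Expr.vec 27 2).times (rd (.arr 21) 2 0)).total).seq <|
  (set 30 ((Expr.vec 28 2).times (rd (.arr 21) 2 0)).total).seq <|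
  (set 31 (agg .min (Expr.const 4)
    (ite ((rd .inS 2 2).times (Expr.vec 23 2).no) (rd (.arr 10) 2 0) (Expr.const 4)))).seq <|
  (set 32 (((rd .inK 2 2).times (rd .inS 2 2).no).times
    (ite (((Expr.vec 30 2).plus (Expr.vec 31 0)).less ((Expr.vec 30 0).plus (Expr.vec 31 2)))
      (lit 1)
      ((((Expr.vec 30 2).plus (Expr.vec 31 0)).same ((Expr.vec 30 0).plus (Expr.vec 31 2))).times
        ((idx 2).less (idx 0))))).total).seq <|
  (set 33 ((((rd .inK 0 0).times (rd .inS 0 0).no).times (Expr.vec 24 0).no).times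
    ((((Expr.vec 32 0).plus (lit 3)).same (Expr.const 26)).times (Expr.vec 28 2).total))).seq <|
  (set 34 (((Expr.vec 27 0).times ((Expr.const 26).no.times (rd .inK 0 0).no)).times
    ((((rd .inS 2 2).times ((Expr.vec 22 2).no.times (Expr.vec 23 2).no)).total.no).times
      (Expr.vec 24 2).total.no))).seq <|
  (set 35 ((((Expr.const 26).same (lit 1)).times
    ((Expr.vec 27 2).total.times (Expr.vec 28 2).total)).times
      ((Expr.vec 27 2).times (Expr.vec 28 2)).total.no)).seq <|
  (set 25 ((Expr.const 4).least (((Expr.const 25).plus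
    (((Expr.const 26).same (lit 2)).times ((Expr.vec 28 2).times (Expr.vec 30 2)).total)).plus
      ((Expr.vec 33 2).times (Expr.vec 30 2)).total))).seq <|
  (set 21 (ite ((Expr.vec 28 0).times (Expr.const 35))
    (agg .min (Expr.const 4) (((Expr.vec 29 2).plus (Expr.vec 30 2)).plus (rd (.arr 10) 2 1)))
    (ite ((Expr.vec 28 0).times
        (((Expr.const 26).same (lit 2)).plus (Expr.vec 33 2).total))
      (rd (.arr 10) 0 1) (rd (.arr 21) 0 1)))).seq <|
  (set 24 (ite ((Expr.vec 24 0).plus (Expr.vec 33 0)) (lit 1) (lit 0))).seq <|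
  (set 22 ((Expr.vec 22 0).times ((Expr.vec 34 0).no.times
    ((Expr.const 35).times (Expr.vec 27 0)).no))).seq <|
  set 23 (ite ((Expr.vec 23 0).plus (Expr.vec 34 0)) (lit 1) (lit 0))

section

variable {n cap N B : ℕ} {K S : Finset (Fin n)} {D : Fin n → Fin n → ℕ}

/-- Arrays that do not change during the evaluation of guesses. -/
structure Context (B : ℕ) (K S : Finset (Fin n)) (E : Env n) : Prop where
  terminals : E .inK = fun _ v => indic K v
  cut : E .inS = fun _ v => indic S v
  bound : E (.arr 4) = fun _ _ => B
  base : E (.arr 5) = fun _ _ => S.card + 3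
  slot : E (.arr 6) = fun v _ => slotIndex S v

theorem Context.agree {m : ℕ} (hm : 7 ≤ m) {E E' : Env n} (h : Context B K S E)
    (ha : E.Agree m E') : Context B K S E' :=
  ⟨ha.2.1.trans h.terminals, ha.2.2.1.trans h.cut, (ha.2.2.2 4 (by omega)).trans h.bound,
    (ha.2.2.2 5 (by omega)).trans h.base, (ha.2.2.2 6 (by omega)).trans h.slot⟩

/-- The environment represents the state of the evaluation of a guess. -/
structure Represents (B : ℕ) (D : Fin n → Fin n → ℕ) (K S : Finset (Fin n)) (E : Env n)
    (p : Guess n × ℕ) : Prop extends Context B K S E where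
  dist : E (.arr 10) = D
  num : E (.arr 20) = fun _ _ => p.2
  part : E (.arr 21) = p.1.X
  living : E (.arr 22) = fun v _ => indic p.1.al v
  dropped : E (.arr 23) = fun v _ => indic p.1.dr v
  used : E (.arr 24) = fun v _ => indic p.1.us v
  weight : E (.arr 25) = fun _ _ => p.1.tot
  part_le : ∀ u v, p.1.X u v ≤ B
  living_sub : p.1.al ⊆ S
  weight_le : p.1.tot ≤ B

end
end LogRAM

/-! ### Operations of a guess in terms of characteristic vectors. -/

section

variable {n : ℕ}

@[simp] theorem indic_empty (v : Fin n) : indic ∅ v = 0 := by simp [indic]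

@[simp] theorem indic_singleton (u v : Fin n) : indic {u} v = if v = u then 1 else 0 := by
  simp [indic]

theorem indic_eq_zero {A : Finset (Fin n)} {v : Fin n} : indic A v = 0 ↔ v ∉ A := by
  simp [indic]

namespace Guess

variable {B : ℕ} {D : Fin n → Fin n → ℕ} {K S : Finset (Fin n)}

theorem slotAt_eq {σ : Guess n} (hal : σ.al ⊆ S) (i : ℕ) :
    σ.slotAt S i = ∅ ∨ ∃ v ∈ σ.al, σ.slotAt S i = {v} := by
  rcases (σ.slotAt S i).eq_empty_or_nonempty with h | ⟨v, hv⟩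
  · exact Or.inl h
  · have h := (Finset.mem_filter.1 hv)
    right
    refine ⟨v, h.1, ?_⟩
    rw [← h.2]
    exact slotAt_slotIndex hal h.1

theorem termAt_eq (σ : Guess n) (J : Finset (Fin n)) (k : ℕ) :
    σ.termAt B D K S J k = ∅ ∨ ∃ t, t ∉ σ.us ∧ σ.termAt B D K S J k = {t} := by
  rcases (σ.termAt B D K S J k).eq_empty_or_nonempty with h | ⟨t, ht⟩
  · exact Or.inl h
  · right
    have h := Finset.mem_filter.1 ht
    have h' := Finset.mem_sdiff.1 h.1
    refine ⟨t, h'.2, Finset.eq_singleton_iff_unique_mem.2 ⟨ht, fun x hx => ?_⟩⟩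
    have hx := Finset.mem_filter.1 hx
    have hx' := Finset.mem_sdiff.1 hx.1
    exact rank_injOn hx'.1 h'.1 (Nat.add_right_cancel (hx.2.trans h.2.symm))

/-- The slots that are dropped by an operation encoded by `k` for the slots `I`. -/
def dropAt (K S : Finset (Fin n)) (σ : Guess n) (I : Finset (Fin n)) (k : ℕ) : Finset (Fin n) :=
  if k = 0 ∧ S ⊆ σ.al ∪ σ.dr ∧ σ.us = ∅ then I \ K else ∅

/-- Indicator of a merging operation. -/
def mergeAt (I J : Finset (Fin n)) (k : ℕ) : ℕ :=
  if k = 1 ∧ I ≠ ∅ ∧ J ≠ ∅ ∧ Disjoint I J then 1 else 0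

/-- The sets `I`, `J` and `T` have at most one element, so sums over them and indicators replace the
choice of an element. This yields one formula for each component, valid for all kinds of operations,
in the shape in which the program computes it. -/
theorem app_decode {σ : Guess n} (hal : σ.al ⊆ S) (ht : σ.tot ≤ B) (g : ℕ) {k : ℕ}
    {I J T : Finset (Fin n)} (hk : k = g % (S.card + 3))
    (hI : I = σ.slotAt S (g / (S.card + 3) % (S.card + 3)))
    (hJ : J = σ.slotAt S (g / (S.card + 3) / (S.card + 3) % (S.card + 3)))
    (hT : T = if J = ∅ then ∅ else σ.termAt B D K S J k) :
    (∀ v, indic (σ.app B D (σ.decode B D K S g)).al v = indic σ.al v *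
      ((if indic (dropAt K S σ I k) v = 0 then 1 else 0) *
        (if mergeAt I J k * indic I v = 0 then 1 else 0))) ∧
    (∀ v, indic (σ.app B D (σ.decode B D K S g)).dr v =
      if indic σ.dr v + indic (dropAt K S σ I k) v = 0 then 0 else 1) ∧
    (∀ v, indic (σ.app B D (σ.decode B D K S g)).us v =
      if indic σ.us v + indic T v = 0 then 0 else 1) ∧
    (∀ u v, (σ.app B D (σ.decode B D K S g)).X u v =
      if indic J u * mergeAt I J k = 0 then
        if indic J u * ((if k = 2 then 1 else 0) + T.card) = 0 then σ.X u v else D u v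
      else closure₂ B D (fun x => ∑ v ∈ I, σ.X v x) (fun x => ∑ v ∈ J, σ.X v x) v) ∧
    (σ.app B D (σ.decode B D K S g)).tot = min B (σ.tot +
      (if k = 2 then 1 else 0) * (∑ x ∈ J, ∑ v ∈ J, σ.X v x) + ∑ t ∈ T, ∑ v ∈ J, σ.X v t) := by
  have hI' := slotAt_eq hal (g / (S.card + 3) % (S.card + 3))
  have hJ' := slotAt_eq hal (g / (S.card + 3) / (S.card + 3) % (S.card + 3))
  have hT' : T = ∅ ∨ ∃ t, t ∉ σ.us ∧ T = {t} := by
    rw [hT]; split_ifs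
    · exact Or.inl rfl
    · exact σ.termAt_eq J k
  have hskip := app_skip (D := D) ht
  have hmin : min B σ.tot = σ.tot := min_eq_right ht
  have hdec : σ.decode B D K S g =
    if k = 0 then
      match pick I with
      | some v => if v ∉ K ∧ S ⊆ σ.al ∪ σ.dr ∧ σ.us = ∅ then .drop v else .skip
      | none => .skip
    else if k = 1 then
      match pick I, pick J with
      | some v, some u => if v ≠ u then .merge v u else .skip
      | _, _ => .skip
    else if k = 2 then
      match pick J with
      | some u => .close u
      | none => .skip
    else
      match pick J, pick (σ.termAt B D K S J k) with
      | some u, some t => .closeT u t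
      | _, _ => .skip := by
    rw [hk, hI, hJ]; rfl
  have hone : ∀ (A : Finset (Fin n)) v, indic A v = if indic A v = 0 then 0 else 1 := by
    intro A v; unfold indic; split_ifs <;> simp_all
  -- Ranks are encoded from `3` on.
  have hTk : k < 3 → T = ∅ := by
    intro h
    rw [hT]; split_ifs
    · rfl
    · rw [termAt, Finset.filter_eq_empty_iff]; intro t _; omega
  rw [← hI] at hI'
  rw [← hJ] at hJ'
  rw [hdec]
  clear hdec hI hJ hk
  by_cases h0 : k = 0
  · subst h0
    have hm : mergeAt I J 0 = 0 := by simp [mergeAt]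
    rw [hTk (by omega), hm, if_pos rfl]
    rcases hI' with rfl | ⟨v, hv, rfl⟩
    · have hd : dropAt K S σ ∅ 0 = ∅ := by simp [dropAt]
      simp [hd, hskip, ← hone, hmin]
    · simp only [pick_singleton]
      by_cases hc : v ∉ K ∧ S ⊆ σ.al ∪ σ.dr ∧ σ.us = ∅
      · have hd : dropAt K S σ {v} 0 = {v} := by
          rw [dropAt, if_pos ⟨rfl, hc.2⟩, Finset.sdiff_eq_self_iff_disjoint]
          simpa using hc.1
        rw [if_pos hc, hd]
        refine ⟨fun x => ?_, fun x => ?_, fun x => ?_, fun x y => ?_, ?_⟩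
        · by_cases hx : x = v <;> simp [app, Core.app, indic, hx]
        · by_cases hx : x = v <;> simp [app, Op.dropped, indic, hx]
        · simp [app, Op.used, ← hone]
        · simp [app, Core.app]
        · simp [app, Core.cost]
      · have hd : dropAt K S σ {v} 0 = ∅ := by
          rw [dropAt]
          split_ifs with h
          · rw [Finset.sdiff_eq_empty_iff_subset, Finset.singleton_subset_iff]
            by_contra hvK
            exact hc ⟨hvK, h.2⟩
          · rfl
        simp [if_neg hc, hd, hskip, ← hone, hmin]
  have hd : dropAt K S σ I k = ∅ := by rw [dropAt, if_neg (fun h => h0 h.1)]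
  rw [hd, if_neg h0]
  by_cases h1 : k = 1
  · subst h1
    rw [hTk (by omega), if_pos rfl]
    rcases hI' with rfl | ⟨v, hv, rfl⟩
    · have hm : mergeAt ∅ J 1 = 0 := by simp [mergeAt]
      simp [hm, hskip, ← hone, hmin]
    rcases hJ' with rfl | ⟨u, hu, rfl⟩
    · have hm : mergeAt {v} ∅ 1 = 0 := by simp [mergeAt]
      simp [hm, hskip, ← hone, hmin]
    simp only [pick_singleton]
    by_cases hvu : v = u
    · have hm : mergeAt {v} {u} 1 = 0 := by simp [mergeAt, hvu]
      rw [hm, if_neg (not_not.2 hvu)]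
      simp [hskip, ← hone, hmin]
    · have hm : mergeAt {v} {u} 1 = 1 := by simp [mergeAt, hvu]
      rw [hm, if_pos hvu]
      refine ⟨fun x => ?_, fun x => ?_, fun x => ?_, fun x y => ?_, ?_⟩
      · by_cases hx : x = v <;> simp [app, Core.app, indic, hx]
      · simp [app, Op.dropped, ← hone]
      · simp [app, Op.used, ← hone]
      · by_cases hx : x = u <;> simp [app, Core.app, hx]
      · simp [app, Core.cost]
  have hm : mergeAt I J k = 0 := by rw [mergeAt, if_neg (fun h => h1 h.1)]
  rw [hm, if_neg h1]
  by_cases h2 : k = 2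
  · subst h2
    rw [hTk (by omega), if_pos rfl]
    rcases hJ' with rfl | ⟨u, hu, rfl⟩
    · simp [hskip, ← hone, hmin]
    · simp only [pick_singleton]
      refine ⟨fun x => ?_, fun x => ?_, fun x => ?_, fun x y => ?_, ?_⟩
      · simp [app, Core.app]
      · simp [app, Op.dropped, ← hone]
      · simp [app, Op.used, ← hone]
      · by_cases hx : x = u <;> simp [app, Core.app, hx]
      · simp [app, Core.cost]
  rw [if_neg h2, if_neg h2]
  rcases hJ' with rfl | ⟨u, hu, rfl⟩
  · rw [if_pos rfl] at hT
    simp [hT, hskip, ← hone, hmin]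
  rw [if_neg (Finset.singleton_ne_empty u)] at hT
  rw [← hT]
  rcases hT' with h | ⟨t, ht', h⟩
  · rw [h]
    simp [hskip, ← hone, hmin]
  · rw [h]
    simp only [pick_singleton]
    refine ⟨fun x => ?_, fun x => ?_, fun x => ?_, fun x y => ?_, ?_⟩
    · simp [app, Core.app]
    · simp [app, Op.dropped, ← hone]
    · by_cases hx : x = t <;> simp [app, Op.used, indic, hx]
    · by_cases hx : x = u <;> simp [app, Core.app, hx]
    · simp [app, Core.cost]

/-- Here and in the next four lemmas, the expressions of `stepCmd`, in simplified form, are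
identified with the intended functions. -/
theorem mergeAt_eq {I J : Finset (Fin n)} (hI : I = ∅ ∨ ∃ v, I = {v}) (hJ : J = ∅ ∨ ∃ v, J = {v})
    (k : ℕ) : (if ∀ i ∈ I, indic J i = 0 then if k = 1 then I.card * J.card else 0 else 0) =
      mergeAt I J k := by
  rcases hI with rfl | ⟨v, rfl⟩ <;> rcases hJ with rfl | ⟨u, rfl⟩ <;> simp [mergeAt]
  by_cases hvu : v = u <;> simp [hvu]

theorem dropAt_eq (σ : Guess n) (I : Finset (Fin n)) (k : ℕ) (v : Fin n) :
    (if σ.us = ∅ then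
      if ∀ i : Fin n, indic σ.dr i = 0 → indic σ.al i = 0 → indic S i = 0 then
        if indic K v = 0 then if k = 0 then indic I v else 0 else 0
      else 0
    else 0) = indic (dropAt K S σ I k) v := by
  have hiff : (∀ i : Fin n, indic σ.dr i = 0 → indic σ.al i = 0 → indic S i = 0) ↔
      S ⊆ σ.al ∪ σ.dr := by
    simp only [Finset.subset_iff, Finset.mem_union, indic_eq_zero]
    constructor <;> intro h x <;> have := @h x <;> tauto
  simp only [hiff]
  simp only [indic_eq_zero, dropAt]
  by_cases h1 : σ.us = ∅
  · by_cases h2 : S ⊆ σ.al ∪ σ.dr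
    · by_cases h3 : k = 0 <;> by_cases h4 : v ∈ K <;> simp [indic, h1, h2, h3, h4]
    · simp [h2]
  · simp [h1]

theorem termAt_indic (σ : Guess n) {J : Finset (Fin n)} (hJ : J = ∅ ∨ ∃ v, J = {v}) (k : ℕ)
    (t : Fin n) :
    (if rank (K \ S) (σ.dist B D S) (fun x => ∑ v ∈ J, σ.X v x) t + 3 = k then
      if indic σ.us t = 0 then if indic S t = 0 then indic K t * J.card else 0 else 0
    else 0) = indic (if J = ∅ then ∅ else σ.termAt B D K S J k) t := by
  rcases hJ with rfl | ⟨v, rfl⟩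
  · simp
  · rw [if_neg (Finset.singleton_ne_empty v)]
    simp only [indic, termAt, Finset.mem_filter, Finset.mem_sdiff,
      Finset.card_singleton]
    generalize rank (K \ S) (σ.dist B D S) (fun x => ∑ v ∈ {v}, σ.X v x) t = r
    by_cases h1 : r + 3 = k
    · by_cases h2 : t ∈ σ.us <;> by_cases h3 : t ∈ S <;> by_cases h4 : t ∈ K <;>
        simp [h1, h2, h3, h4]
    · simp [h1]

theorem rank_eq (d h : Fin n → ℕ) (t : Fin n) :
    (∑ x, if h t + d x ≤ h x + d t then
        if x < t then if h x + d t = h t + d x then if indic S x = 0 then indic K x else 0 else 0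
        else 0
      else if indic S x = 0 then indic K x else 0) = rank (K \ S) d h t := by
  rw [rank, ← sum_indic]
  refine Finset.sum_congr rfl fun x _ => ?_
  have hKS : (if indic S x = 0 then indic K x else 0) = indic (K \ S) x := by
    simp only [indic, Finset.mem_sdiff]
    by_cases h1 : x ∈ S <;> simp [h1]
  rw [hKS]
  have hB : indic ((K \ S).filter (Before d h · t)) x =
      if Before d h x t then indic (K \ S) x else 0 := by
    simp only [indic, Finset.mem_filter]
    by_cases h1 : x ∈ K \ S <;> simp [h1]
  rw [hB]
  simp only [Before, Fin.lt_def]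
  split_ifs <;> first | rfl | omega

theorem dist_eq (σ : Guess n) (t : Fin n) : Finset.fold min B
    (fun x => if indic σ.dr x = 0 → indic S x = 0 then B else D x t) Finset.univ =
      σ.dist B D S t := by
  unfold dist
  congr 1
  funext x
  by_cases h1 : x ∈ S <;> by_cases h2 : x ∈ σ.dr <;> simp [h1, h2, indic_eq_zero]

end Guess

end

namespace LogRAM

section

variable {n cap N B : ℕ} {K S : Finset (Fin n)} {D : Fin n → Fin n → ℕ}

-- Each of the assignments is replaced by the function it is meant to compute. All these functions
-- are bounded by `B`, by `n + 3` or by the number of guesses, so the cap never acts.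
set_option maxHeartbeats 1000000 in
theorem stepCmd_sem (hf : Fits n cap N B) {E : Env n} {p : Guess n × ℕ} (hD : ∀ u v, D u v ≤ B)
    (h : Represents B D K S E p) (hp : p.2 ≤ N) :
    Represents B D K S (stepCmd.sem cap N E) (Guess.step B D K S p) := by
  classical
  obtain ⟨σ, g⟩ := p
  have hBc := hf.bound_le
  have hn := hf.card
  have hNc := hf.guesses
  have hcard : S.card ≤ n := by simpa using Finset.card_le_univ S
  obtain ⟨⟨hK, hS, hB, hq, hslot⟩, hd, hg, hX, hal, hdr, hus, htot, hXB, hsub, htB⟩ := h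
  simp only at hp hg hX hal hdr hus htot hXB hsub htB
  set q := S.card + 3 with hqdef
  set k := g % q with hk
  set I := σ.slotAt S (g / q % q) with hI
  set J := σ.slotAt S (g / q / q % q) with hJ
  set T := if J = ∅ then ∅ else σ.termAt B D K S J k with hT
  have hrep := Guess.app_decode (D := D) (K := K) hsub htB g hk hI hJ hT
  have hsmall : ∀ i, ∀ x, ∑ v ∈ σ.slotAt S i, σ.X v x ≤ B := by
    intro i x
    rcases Guess.slotAt_eq hsub i with h | ⟨v, -, h⟩ <;> rw [h]
    · simp
    · simpa using hXB v x
  have hdist : ∀ t, σ.dist B D S t ≤ B := by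
    intro t; unfold Guess.dist; rw [Finset.fold_min_le]; exact Or.inl le_rfl
  have hrank : ∀ h t, rank (K \ S) (σ.dist B D S) h t ≤ n := by
    intro h t; exact (Finset.card_le_univ _).trans_eq (Fintype.card_fin n)
  have hslotInd : ∀ i v, indic σ.al v * (if slotIndex S v = i then 1 else 0) =
      indic (σ.slotAt S i) v := by
    intro i v
    by_cases h1 : v ∈ σ.al <;> by_cases h2 : slotIndex S v = i <;> simp [indic, Guess.slotAt, h1, h2]
  have hgq : g / q / q / q ≤ cap :=
    (Nat.div_le_self _ _).trans ((Nat.div_le_self _ _).trans ((Nat.div_le_self _ _).trans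
      (hp.trans hNc)))
  have hkq : k < q := Nat.mod_lt _ (by omega)
  have i1 : ∀ (A : Finset (Fin n)) v, indic A v ≤ cap := fun A v =>
    (indic_le_one A v).trans (by omega)
  have hI' : I = ∅ ∨ ∃ v, I = {v} :=
    (Guess.slotAt_eq hsub (g / q % q)).imp_right fun ⟨v, _, h⟩ => ⟨v, h⟩
  have hJ' : J = ∅ ∨ ∃ v, J = {v} :=
    (Guess.slotAt_eq hsub (g / q / q % q)).imp_right fun ⟨v, _, h⟩ => ⟨v, h⟩
  have hJcard : J.card ≤ 1 := by
    rcases Guess.slotAt_eq hsub (g / q / q % q) with h | ⟨v, -, h⟩ <;> rw [hJ, h] <;> simp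
  have hX' : ∀ u v, (σ.app B D (σ.decode B D K S g)).X u v ≤ B := by
    intro u v
    rw [hrep.2.2.2.1]
    split_ifs
    all_goals first
      | exact hXB u v
      | exact hD u v
      | exact closure₂_le_iff.2 (Or.inl le_rfl)
  have ht' : (σ.app B D (σ.decode B D K S g)).tot ≤ B := min_le_left _ _
  have key : stepCmd.sem cap N E = (((((((((((((((((E.set 26 fun _ _ => k).set 27
      fun v _ => indic I v).set 28 fun v _ => indic J v).set 20 fun _ _ => g / q / q / q).set 29
      fun x _ => ∑ v ∈ I, σ.X v x).set 30 fun x _ => ∑ v ∈ J, σ.X v x).set 31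
      fun t _ => σ.dist B D S t).set 32
      fun t _ => rank (K \ S) (σ.dist B D S) (fun x => ∑ v ∈ J, σ.X v x) t).set 33
      fun t _ => indic T t).set 34 fun v _ => indic (Guess.dropAt K S σ I k) v).set 35
      fun _ _ => Guess.mergeAt I J k).set 25
      fun _ _ => (σ.app B D (σ.decode B D K S g)).tot).set 21
      (σ.app B D (σ.decode B D K S g)).X).set 24
      fun v _ => indic (σ.app B D (σ.decode B D K S g)).us v).set 22
      fun v _ => indic (σ.app B D (σ.decode B D K S g)).al v).set 23
      fun v _ => indic (σ.app B D (σ.decode B D K S g)).dr v)) := by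
    unfold stepCmd
    simp only [Cmd.sem_seq]
    rw [Cmd.sem_set 26 fun _ _ => k,
      Cmd.sem_set 27 fun v _ => indic I v,
      Cmd.sem_set 28 fun v _ => indic J v,
      Cmd.sem_set 20 fun _ _ => g / q / q / q,
      Cmd.sem_set 29 fun x _ => ∑ v ∈ I, σ.X v x,
      Cmd.sem_set 30 fun x _ => ∑ v ∈ J, σ.X v x,
      Cmd.sem_set 31 fun t _ => σ.dist B D S t,
      Cmd.sem_set 32 fun t _ => rank (K \ S) (σ.dist B D S) (fun x => ∑ v ∈ J, σ.X v x) t,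
      Cmd.sem_set 33 fun t _ => indic T t,
      Cmd.sem_set 34 fun v _ => indic (Guess.dropAt K S σ I k) v,
      Cmd.sem_set 35 fun _ _ => Guess.mergeAt I J k,
      Cmd.sem_set 25 fun _ _ => (σ.app B D (σ.decode B D K S g)).tot,
      Cmd.sem_set 21 (σ.app B D (σ.decode B D K S g)).X,
      Cmd.sem_set 24 fun v _ => indic (σ.app B D (σ.decode B D K S g)).us v,
      Cmd.sem_set 22 fun v _ => indic (σ.app B D (σ.decode B D K S g)).al v,
      Cmd.sem_set 23 fun v _ => indic (σ.app B D (σ.decode B D K S g)).dr v]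
    · intro v _
      simp [hdr, hrep.2.1]
    · intro _ _; exact i1 _ _
    · intro v _
      simp [hal, hrep.1]
    · intro _ _; exact i1 _ _
    · intro v _
      simp [hus, hrep.2.2.1]
    · intro _ _; exact i1 _ _
    · intro u v
      simp [hX, hB, hd, hrep.2.2.2.1, sum_indic, closure₂]
    · intro _ _; exact (hX' _ _).trans hBc
    · intro _ _
      simp [hB, htot, hrep.2.2.2.2, sum_indic_mul, add_assoc]
    · intro _ _; exact ht'.trans hBc
    · intro _ _
      simpa [sum_indic_mul, sum_indic] using Guess.mergeAt_eq hI' hJ' k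
    · intro _ _; unfold Guess.mergeAt; split_ifs <;> omega
    · intro v _
      simpa [hK, hS, hal, hdr, hus, sum_indic] using Guess.dropAt_eq σ I k v
    · intro _ _; exact i1 _ _
    · intro t _
      simpa [hK, hS, hus, sum_indic] using Guess.termAt_indic σ hJ' k t
    · intro _ _; exact i1 _ _
    · intro t _
      simpa [hK, hS] using Guess.rank_eq (σ.dist B D S) (fun x => ∑ v ∈ J, σ.X v x) t
    · intro _ _; exact (hrank _ _).trans (by omega)
    · intro t _
      simpa [hS, hdr, hd, hB] using Guess.dist_eq σ t
    · intro _ _; exact (hdist _).trans hBc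
    · intro x _
      simp [hX, sum_indic_mul]
    · intro _ _; exact (hsmall _ _).trans hBc
    · intro x _
      simp [hX, sum_indic_mul]
    · intro _ _; exact (hsmall _ _).trans hBc
    · intro _ _
      simp [hg, hq]
    · intro _ _; exact hgq
    · intro v _
      simp [hg, hq, hal, hslot, hslotInd, ← hJ]
    · intro _ _; exact i1 _ _
    · intro v _
      simp [hg, hq, hal, hslot, hslotInd, ← hI]
    · intro _ _; exact i1 _ _
    · intro _ _
      simp [hg, hq, ← hk]
    · intro _ _; exact hkq.le.trans (by omega)
  have hag := Cmd.agree_sem (m := 20) (cap := cap) (N := N) stepCmd E (by simp [stepCmd, Cmd.From])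
  refine ⟨Context.agree (by omega) ⟨hK, hS, hB, hq, hslot⟩ hag, ?_, ?_, ?_, ?_, ?_, ?_, ?_, hX',
    (Guess.app_al_subset _ _).trans hsub, ht'⟩
  · rw [hag.2.2.2 10 (by omega), hd]
  all_goals rw [key]; simp [Guess.step, hqdef]

end
end LogRAM

/-! ### Program for the minimum over all guesses. -/

namespace LogRAM

open LogRAM.Cmd LogRAM.Expr in
/-- Evaluation of the guess in array `13`. -/
def guessCmd : Cmd :=
  (set 20 (Expr.const 13)).seq <|
  (set 21 (rd (.arr 10) 0 1)).seq <|
  (set 22 (rd .inS 0 0)).seq <|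
  (set 23 (lit 0)).seq <|
  (set 24 (lit 0)).seq <|
  (set 25 (lit 0)).seq <|
  (forN (stepCmd.seq stepCmd)).seq <|
  (set 31 (agg .min (Expr.const 4)
    (ite ((rd .inS 2 2).times (Expr.vec 23 2).no) (rd (.arr 10) 2 0) (Expr.const 4)))).seq <|
  set 12 ((Expr.const 12).least (ite ((Expr.vec 22 2).total.same (lit 1))
    (((Expr.const 25).plus ((Expr.vec 22 2).times (rd (.arr 21) 2 2)).total).plus
      ((((rd .inK 2 2).times (rd .inS 2 2).no).times (Expr.vec 24 2).no).times
        (Expr.vec 31 2)).total)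
    (Expr.const 4)))

open LogRAM.Cmd LogRAM.Expr in
/-- Minimum weight of a Steiner tree in the graph in array `0`. -/
def evalCmd : Cmd :=
  shortestCmd.seq <|
  (set 12 (ite ((rd .inK 2 2).total.minus (lit 1)) (Expr.const 4) (lit 0))).seq <|
  (set 13 (lit 0)).seq <|
  forG (guessCmd.seq (set 13 ((Expr.const 13).plus (lit 1))))

section

variable {n cap N B : ℕ} {K S : Finset (Fin n)} {D : Fin n → Fin n → ℕ}

theorem iterate_stepCmd_sem (hf : Fits n cap N B) (hD : ∀ u v, D u v ≤ B) (m : ℕ) :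
    ∀ {E : Env n} {p : Guess n × ℕ}, Represents B D K S E p → p.2 ≤ N →
      Represents B D K S ((stepCmd.sem cap N)^[m] E) ((Guess.step B D K S)^[m] p) := by
  induction m with
  | zero => exact fun h _ => h
  | succ m ih =>
    intro E p h hp
    rw [Function.iterate_succ_apply, Function.iterate_succ_apply]
    refine ih (stepCmd_sem hf hD h hp) ?_
    exact (Nat.div_le_self _ _).trans ((Nat.div_le_self _ _).trans ((Nat.div_le_self _ _).trans hp))

theorem value_eq (σ : Guess n) (b : ℕ) :
    (if σ.al.card = 1 then σ.tot + ∑ v, indic σ.al v * σ.X v v +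
      ∑ t, ((indic K t * (if indic S t = 0 then 1 else 0)) * (if indic σ.us t = 0 then 1 else 0)) *
        σ.dist B D S t else b) =
      if σ.al.card = 1 then σ.tot + ∑ a ∈ σ.al, σ.X a a + ∑ t ∈ (K \ S) \ σ.us, σ.dist B D S t
      else b := by
  have h : ∀ t, (indic K t * (if indic S t = 0 then 1 else 0)) *
      (if indic σ.us t = 0 then 1 else 0) = indic ((K \ S) \ σ.us) t := by
    intro t
    by_cases h1 : t ∈ K <;> by_cases h2 : t ∈ S <;> by_cases h3 : t ∈ σ.us <;>
      simp [indic, h1, h2, h3]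
  simp only [h, sum_indic_mul]

/-- The `2 * n` operations are run as `n` pairs. They write only to arrays from `20` on, so the
number of the guess and the minimum so far survive. -/
theorem guessCmd_sem (hf : Fits n cap N B) (hD : ∀ u v, D u v ≤ B) {E : Env n} {g b : ℕ}
    (h : Context B K S E) (hd : E (.arr 10) = D) (hg : E (.arr 13) = fun _ _ => g) (hgN : g ≤ N)
    (hb : E (.arr 12) = fun _ _ => b) (hbB : b ≤ B) :
    (guessCmd.sem cap N E) (.arr 13) = (fun _ _ => g) ∧
      (guessCmd.sem cap N E) (.arr 12) = fun _ _ => min b (Guess.valueOf B D K S g) := by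
  have hBc := hf.bound_le
  have hn := hf.card
  have hNc := hf.guesses
  have i1 : ∀ (A : Finset (Fin n)) v, indic A v ≤ cap := fun A v =>
    (indic_le_one A v).trans (by omega)
  unfold guessCmd
  simp only [Cmd.sem_seq]
  set E₀ := Cmd.sem cap N (Cmd.set 25 (Expr.lit 0)) _ with hE₀
  have hE₀' : E₀ = (((((E.set 20 fun _ _ => g).set 21 D).set 22 fun v _ => indic S v).set 23
      fun _ _ => 0).set 24 fun _ _ => 0).set 25 fun _ _ => 0 := by
    rw [hE₀, Cmd.sem_set 20 fun _ _ => g, Cmd.sem_set 21 D, Cmd.sem_set 22 fun v _ => indic S v,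
      Cmd.sem_set 23 fun _ _ => 0, Cmd.sem_set 24 fun _ _ => 0, Cmd.sem_set 25 fun _ _ => 0]
    · simp
    · simp
    · simp
    · simp
    · simp
    · simp
    · simp [h.cut]
    · intro _ _; exact i1 _ _
    · simp [hd]
    · intro _ _; exact (hD _ _).trans hBc
    · simp [hg]
    · intro _ _; exact hgN.trans hNc
  have hrep : Represents B D K S E₀ (Guess.init D S, g) := by
    rw [hE₀']
    refine ⟨⟨?_, ?_, ?_, ?_, ?_⟩, ?_, ?_, ?_, ?_, ?_, ?_, ?_, hD, subset_rfl, Nat.zero_le _⟩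
    · simp [h.terminals]
    · simp [h.cut]
    · simp [h.bound]
    · simp [h.base]
    · simp [h.slot]
    all_goals simp [Guess.init, hd]
  have hag₀ : E.Agree 20 E₀ := by
    rw [hE₀']
    refine ⟨rfl, rfl, rfl, fun a ha => ?_⟩
    simp only [Env.set_arr]
    rw [if_neg (by omega), if_neg (by omega), if_neg (by omega), if_neg (by omega),
      if_neg (by omega), if_neg (by omega)]
  clear_value E₀
  have hit : (Cmd.forN (stepCmd.seq stepCmd)).sem cap N E₀ = (stepCmd.sem cap N)^[2 * n] E₀ := by
    rw [Function.iterate_mul]; rfl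
  have hag₁ : E₀.Agree 20 ((Cmd.forN (stepCmd.seq stepCmd)).sem cap N E₀) :=
    Cmd.agree_sem _ _ (by simp [stepCmd, Cmd.From])
  have hrep₁ := iterate_stepCmd_sem hf hD (2 * n) hrep hgN
  rw [← hit] at hrep₁
  have hag := hag₀.trans hag₁
  generalize (Cmd.forN (stepCmd.seq stepCmd)).sem cap N E₀ = E₁ at hrep₁ hag
  have hval : Guess.valueOf B D K S g =
    ((Guess.step B D K S)^[2 * n] (Guess.init D S, g)).1.value B D K S := rfl
  rw [hval]
  generalize (Guess.step B D K S)^[2 * n] (Guess.init D S, g) = p at hrep₁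
  rw [Cmd.sem_set 31 fun t _ => p.1.dist B D S t,
    Cmd.sem_set 12 fun _ _ => min b (p.1.value B D K S)]
  · have := hag.2.2.2 13 (by omega)
    simp [this, hg]
  · intro _ _
    have := hag.2.2.2 12 (by omega)
    simpa [this, hb, hrep₁.living, hrep₁.weight, hrep₁.part, hrep₁.terminals, hrep₁.cut,
      hrep₁.used, hrep₁.bound, sum_indic, Guess.value] using
      congrArg (min b) (value_eq (K := K) (S := S) (B := B) (D := D) p.1 B)
  · intro _ _; exact (min_le_left _ _).trans (hbB.trans hBc)
  · intro t _
    simpa [hrep₁.cut, hrep₁.dropped, hrep₁.dist, hrep₁.bound] using Guess.dist_eq p.1 t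
  · intro t _
    refine le_trans ?_ hBc
    unfold Guess.dist; rw [Finset.fold_min_le]; exact Or.inl le_rfl

theorem evalCmd_sem (hN : N = (S.card + 3) ^ (6 * S.card)) (hf : Fits n cap N B) {E : Env n}
    (h : Context B K S E) {C : Fin n → Fin n → ℕ} (hC : E (.arr 0) = C) (hle : ∀ i j, C i j ≤ B) :
    (evalCmd.sem cap N E) (.arr 12) = fun _ _ => treeWeight B K S C := by
  have hBc := hf.bound_le
  have hNc := hf.guesses
  have hD := shortestCmd_sem hf h.bound hC hle
  have hDB := shortest_le_bound hle n
  have hag : E.Agree 10 (shortestCmd.sem cap N E) :=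
    Cmd.agree_sem _ _ (by simp [shortestCmd, Cmd.From])
  have h₀ := h.agree (by omega) hag
  unfold evalCmd
  simp only [Cmd.sem_seq]
  generalize shortestCmd.sem cap N E = E₀ at *
  set b := if 1 < K.card then B else 0 with hbdef
  have hbB : b ≤ B := by rw [hbdef]; split_ifs <;> omega
  have hE₁ : Cmd.sem cap N (Cmd.set 13 (Expr.lit 0)) (Cmd.sem cap N (Cmd.set 12 (Expr.ite
      ((Expr.rd .inK 2 2).total.minus (Expr.lit 1)) (Expr.const 4) (Expr.lit 0))) E₀) =
      (E₀.set 12 fun _ _ => b).set 13 fun _ _ => 0 := by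
    rw [Cmd.sem_set 12 fun _ _ => b, Cmd.sem_set 13 fun _ _ => 0]
    · simp
    · simp
    · intro _ _
      simp only [Expr.ev_ite, Expr.ev_minus, Expr.ev_total, Expr.ev_rd, h₀.terminals,
        Function.update_self, sum_indic, Expr.ev_lit, Expr.ev_const, h₀.bound, hbdef]
      by_cases hc : 1 < K.card
      · rw [if_pos hc, if_neg (by omega)]
      · rw [if_neg hc, if_pos (by omega)]
    · intro _ _; exact hbB.trans hBc
  rw [hE₁]
  set body := guessCmd.seq (Cmd.set 13 ((Expr.const 13).plus (Expr.lit 1))) with hbody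
  have hmain : ∀ g ≤ N, ∀ F : Env n, E₀.Agree 11 F → F (.arr 12) = (fun _ _ => b) →
      F (.arr 13) = (fun _ _ => 0) →
      E₀.Agree 11 ((body.sem cap N)^[g] F) ∧
      ((body.sem cap N)^[g] F) (.arr 12) =
        (fun _ _ => Guess.best B (shortest B C n) K S b g) ∧
      ((body.sem cap N)^[g] F) (.arr 13) = fun _ _ => g := by
    intro g
    induction g with
    | zero => exact fun _ F h1 h2 h3 => ⟨h1, h2, h3⟩
    | succ g ih =>
      intro hg F h1 h2 h3
      obtain ⟨a1, a2, a3⟩ := ih (by omega) F h1 h2 h3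
      rw [Function.iterate_succ_apply']
      generalize (body.sem cap N)^[g] F = F' at a1 a2 a3
      have hc := guessCmd_sem hf hDB (h₀.agree (by omega) a1) ((a1.2.2.2 10 (by omega)).trans hD) a3
        (by omega) a2 ((Guess.best_le_init _ _).trans hbB)
      refine ⟨a1.trans (Cmd.agree_sem _ _ (by simp [hbody, guessCmd, stepCmd, Cmd.From])), ?_, ?_⟩
      all_goals
        rw [hbody, Cmd.sem_seq, Cmd.sem_set 13 fun _ _ => g + 1]
        · simp [hc.2, Guess.best]
        · simp [hc.1]
        · intro _ _; omega
  have := (hmain N le_rfl ((E₀.set 12 fun _ _ => b).set 13 fun _ _ => 0) ⟨rfl, rfl, rfl, fun a ha => by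
    simp only [Env.set_arr]; rw [if_neg (by omega), if_neg (by omega)]⟩ (by simp) (by simp)).2.1
  rw [treeWeight, ← hN]
  exact this

end
end LogRAM

/-! ### From the minimum weight to a tree, by deletion of edges. -/

section

variable {n : ℕ}

/-- The graph without the edge between the vertices that are encoded by `m`. -/
def cutPair (G : SimpleGraph (Fin n)) (m : ℕ) : SimpleGraph (Fin n) where
  Adj u v := G.Adj u v ∧ u.1 * n + v.1 ≠ m ∧ v.1 * n + u.1 ≠ m
  symm := ⟨fun _ _ h => ⟨h.1.symm, h.2.2, h.2.1⟩⟩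
  loopless := ⟨fun _ h => h.1.ne rfl⟩

theorem cutPair_le (G : SimpleGraph (Fin n)) (m : ℕ) : cutPair G m ≤ G := fun _ _ h => h.1

theorem cutPair_mono {G G' : SimpleGraph (Fin n)} (h : G ≤ G') (m : ℕ) :
    cutPair G m ≤ cutPair G' m := fun _ _ h' => ⟨h h'.1, h'.2⟩

theorem pair_injective {u v x y : Fin n} (h : x.1 * n + y.1 = u.1 * n + v.1) : x = u ∧ y = v := by
  have hn : 0 < n := u.pos
  have h1 := congrArg (· / n) h
  have h2 := congrArg (· % n) h
  simp only [mul_comm _ n, Nat.mul_add_div hn, Nat.mul_add_mod, Nat.mod_eq_of_lt y.2,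
    Nat.mod_eq_of_lt v.2, Nat.div_eq_of_lt y.2, Nat.div_eq_of_lt v.2, add_zero] at h1 h2
  exact ⟨Fin.ext h1, Fin.ext h2⟩

/-- The subgraph with the edges of `F`; its vertices are the endpoints of edges and the terminals, or
vertex `0` if there are none. -/
def answerGraph (G F : SimpleGraph (Fin n)) (hF : F ≤ G) (K : Finset (Fin n)) : G.Subgraph where
  verts := {v | v ∈ K ∨ (∃ u, F.Adj u v) ∨ (K = ∅ ∧ F = ⊥) ∧ v.1 = 0}
  Adj := F.Adj
  adj_sub h := hF h
  edge_vert h := Or.inr (Or.inl ⟨_, h.symm⟩)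
  symm := ⟨fun _ _ h => h.symm⟩

theorem SimpleGraph.Subgraph.isTree_coe_congr {V : Type*} {G G' : SimpleGraph V} {H : G.Subgraph}
    {H' : G'.Subgraph} (hv : H.verts = H'.verts) (hadj : H.Adj = H'.Adj) (h : H'.coe.IsTree) :
    H.coe.IsTree := by
  rcases H with ⟨X, A, h1, h2, h3⟩
  rcases H' with ⟨X', A', h1', h2', h3'⟩
  simp only at hv hadj
  subst hv hadj
  exact h

theorem edgeWeight_mono {V : Type*} [Fintype V] {G G' : SimpleGraph V} {w : Sym2 V → ℕ}
    {H : G.Subgraph} {H' : G'.Subgraph} (h : ∀ u v, H.Adj u v → H'.Adj u v) :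
    edgeWeight w H ≤ edgeWeight w H' := by
  refine Finset.sum_le_sum_of_subset ?_
  intro e
  simp only [Set.mem_toFinset]
  induction e with
  | _ u v => exact h u v

/-- A spanning tree of a connected subgraph. -/
theorem SimpleGraph.Subgraph.Connected.exists_spanning_tree {V : Type*} {G : SimpleGraph V}
    {H : G.Subgraph} (h : H.Connected) :
    ∃ T : G.Subgraph, T.verts = H.verts ∧ (∀ u v, T.Adj u v → H.Adj u v) ∧ T.coe.IsTree := by
  obtain ⟨T, hT, htree⟩ := h.coe.exists_isTree_le
  refine ⟨⟨H.verts, fun u v => ∃ (hu : u ∈ H.verts) (hv : v ∈ H.verts), T.Adj ⟨u, hu⟩ ⟨v, hv⟩,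
    ?_, ?_, ⟨?_⟩⟩, rfl, ?_, ?_⟩
  · rintro u v ⟨hu, hv, h⟩; exact H.adj_sub (hT h)
  · rintro u v ⟨hu, hv, h⟩; exact hu
  · rintro u v ⟨hu, hv, h⟩; exact ⟨hv, hu, h.symm⟩
  · rintro u v ⟨hu, hv, h⟩; exact hT h
  · convert htree using 1
    ext u v
    exact ⟨fun ⟨_, _, h⟩ => h, fun h => ⟨u.2, v.2, h⟩⟩

/-- A spanning tree of the connecting subgraph has its edges in `F`. An edge of `F` outside it could
be deleted without losing the connection, against `hmin`; so `F` has exactly the edges of that tree.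
The argument is not affected by edges of weight zero. -/
theorem answerGraph_isTree (hn : 0 < n) {G F : SimpleGraph (Fin n)} (hF : F ≤ G)
    {K : Finset (Fin n)} {w : Sym2 (Fin n) → ℕ} {c : ℕ} (hconn : Connects F w K c)
    (hmin : ∀ u v : Fin n, F.Adj u v → ¬ Connects (cutPair F (u.1 * n + v.1)) w K c) :
    (answerGraph G F hF K).coe.IsTree ∧ edgeWeight w (answerGraph G F hF K) ≤ c := by
  obtain ⟨H, h1, h2, h3, h4⟩ := hconn
  obtain ⟨T, hTv, hTH, htree⟩ := h1.exists_spanning_tree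
  have hTc : T.Connected := ⟨htree.1⟩
  have hTF : ∀ u v, T.Adj u v → F.Adj u v := fun u v h => h3 u v (hTH u v h)
  have hFT : ∀ u v, F.Adj u v → T.Adj u v := by
    intro u v huv
    by_contra hT
    refine hmin u v huv ⟨T, hTc, fun v hv => hTv ▸ h2 v hv, fun x y hxy => ⟨hTF x y hxy, ?_, ?_⟩,
      (edgeWeight_mono hTH).trans h4⟩
    · intro h
      obtain ⟨rfl, rfl⟩ := pair_injective h
      exact hT hxy
    · intro h
      obtain ⟨rfl, rfl⟩ := pair_injective h
      exact hT hxy.symm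
  have hadj : F.Adj = T.Adj := by
    funext u v; exact propext ⟨hFT u v, hTF u v⟩
  have hKT : ∀ v ∈ K, v ∈ T.verts := fun v hv => hTv ▸ h2 v hv
  have hnbr : ∀ x ∈ T.verts, ∀ y ∈ T.verts, x ≠ y → ∃ z, T.Adj x z := by
    intro x hx y hy hxy
    obtain ⟨p⟩ := htree.1.preconnected ⟨x, hx⟩ ⟨y, hy⟩
    cases p with
    | nil => exact absurd rfl hxy
    | cons h _ => exact ⟨_, h⟩
  refine ⟨?_, (edgeWeight_mono fun u v h => hTH u v (hFT u v h)).trans h4⟩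
  -- Without edges the tree is a single vertex, and at most one terminal exists; the answer is then
  -- this terminal, or vertex `0` if there is none. Otherwise every vertex of the tree is the end of
  -- an edge, and the edges determine the vertex set.
  by_cases hbot : F = ⊥
  · have hsub : ∀ x ∈ T.verts, ∀ y ∈ T.verts, x = y := by
      intro x hx y hy
      by_contra hxy
      obtain ⟨z, hz⟩ := hnbr x hx y hy hxy
      have := hTF _ _ hz
      rw [hbot] at this
      exact this
    obtain ⟨x, hx⟩ : ∃ x, (answerGraph G F hF K).verts = {x} := by
      rcases K.eq_empty_or_nonempty with hK | ⟨x, hx⟩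
      · refine ⟨⟨0, hn⟩, ?_⟩
        ext v
        simp [answerGraph, hK, hbot, Fin.ext_iff]
      · refine ⟨x, ?_⟩
        ext v
        have hK : K ≠ ∅ := fun h => by simp [h] at hx
        simp only [answerGraph, hbot, hK, SimpleGraph.bot_adj, exists_false, false_and, or_false,
          Set.mem_ofPred_eq, Set.mem_singleton_iff]
        exact ⟨fun hv => hsub v (hKT v hv) x (hKT x hx), fun h => h ▸ hx⟩
    refine SimpleGraph.Subgraph.isTree_coe_congr (H' := G.singletonSubgraph x) (by rw [hx]; rfl) ?_
      (SimpleGraph.IsTree.coe_singletonSubgraph G x)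
    funext u v
    simp [answerGraph, hbot]
  · refine SimpleGraph.Subgraph.isTree_coe_congr (H' := T) ?_ hadj htree
    obtain ⟨u, v, huv⟩ : ∃ u v, F.Adj u v := by
      by_contra! hcon
      exact hbot (by ext u v; simp [hcon u v])
    have hTuv := hFT u v huv
    ext x
    simp only [answerGraph, hbot, and_false, false_and, or_false, Set.mem_ofPred_eq]
    constructor
    · rintro (hx | ⟨y, hy⟩)
      · exact hKT x hx
      · exact T.edge_vert (hFT y x hy).symm
    · intro hx
      right
      by_cases hxu : x = u
      · subst hxu; exact ⟨v, huv.symm⟩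
      · obtain ⟨z, hz⟩ := hnbr x hx u (T.edge_vert hTuv) hxu
        exact ⟨z, (hTF _ _ hz).symm⟩

/-- Deletes all edges that are not needed for a tree of minimum weight. -/
noncomputable def prune (G : SimpleGraph (Fin n)) (w : Sym2 (Fin n) → ℕ) (B : ℕ)
    (K S : Finset (Fin n)) (c : ℕ) : ℕ → SimpleGraph (Fin n)
  | 0 => G
  | m + 1 => if treeWeight B K S (weightMatrix (cutPair (prune G w B K S c m) m) w) = c then
      cutPair (prune G w B K S c m) m else prune G w B K S c m

section

variable {G : SimpleGraph (Fin n)} {w : Sym2 (Fin n) → ℕ} {B : ℕ} {K S : Finset (Fin n)} {c : ℕ}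

theorem prune_succ_le (m : ℕ) : prune G w B K S c (m + 1) ≤ prune G w B K S c m := by
  rw [prune]; split_ifs
  · exact cutPair_le _ _
  · exact le_rfl

theorem prune_anti {m k : ℕ} (h : m ≤ k) : prune G w B K S c k ≤ prune G w B K S c m := by
  induction h with
  | refl => exact le_rfl
  | step _ ih => exact (prune_succ_le _).trans ih

theorem connects_prune (hn : 0 < n) (hc : treeWeight B K S (weightMatrix G w) = c) (hcB : c < B)
    (m : ℕ) : Connects (prune G w B K S c m) w K c := by
  induction m with
  | zero =>
    rcases treeWeight_sound hn (B := B) (K := K) (S := S) (G := G) (w := w) with h | h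
    · omega
    · rwa [hc] at h
  | succ m ih =>
    rw [prune]
    split_ifs with h
    · rcases treeWeight_sound hn (B := B) (K := K) (S := S)
        (G := cutPair (prune G w B K S c m) m) (w := w) with h' | h'
      · omega
      · rwa [h] at h'
    · exact ih

/-- If an edge were dispensable at the end, it would have been so in the larger graph present when
it was examined. The weight without it was then at most `c`, and also at least `c` as for every
subgraph of `G`, so it would have been deleted. -/
theorem not_connects_prune (hn : 0 < n) (hcut : IsMultiwayCut G K S)
    (hc : treeWeight B K S (weightMatrix G w) = c) (hcB : c < B) {N : ℕ} {u v : Fin n}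
    (hN : u.1 * n + v.1 < N) (huv : (prune G w B K S c N).Adj u v) :
    ¬ Connects (cutPair (prune G w B K S c N) (u.1 * n + v.1)) w K c := by
  intro hcon
  set m := u.1 * n + v.1 with hm
  have hle : cutPair (prune G w B K S c m) m ≤ G :=
    (cutPair_le _ _).trans (prune_anti (Nat.zero_le m))
  have h1 := hcon.mono_graph (cutPair_mono (prune_anti hN.le) m)
  have h2 := treeWeight_le (B := B) hcut hle h1
  have h3 : c ≤ treeWeight B K S (weightMatrix (cutPair (prune G w B K S c m) m) w) := by
    rcases treeWeight_sound hn (B := B) (K := K) (S := S)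
      (G := cutPair (prune G w B K S c m) m) (w := w) with h' | h'
    · omega
    · exact hc.symm.le.trans (treeWeight_le hcut le_rfl (h'.mono_graph hle))
  have h4 := prune_anti (show m + 1 ≤ N from hN) huv
  rw [prune, if_pos (le_antisymm h2 h3)] at h4
  exact h4.2.1 rfl

theorem prune_isTree (hn : 0 < n) (hcut : IsMultiwayCut G K S)
    (hc : treeWeight B K S (weightMatrix G w) = c) (hcB : c < B) :
    (answerGraph G (prune G w B K S c (n * n)) (prune_anti (Nat.zero_le _)) K).coe.IsTree ∧
      edgeWeight w (answerGraph G (prune G w B K S c (n * n)) (prune_anti (Nat.zero_le _)) K) ≤ c :=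
  answerGraph_isTree hn _ (connects_prune hn hc hcB _) fun u v huv =>
    not_connects_prune hn hcut hc hcB (by
      have h1 := Nat.mul_le_mul_right n (show u.1 + 1 ≤ n from u.2)
      have h2 := v.2
      rw [Nat.add_mul, one_mul] at h1
      omega) huv

end

end

/-! ## Weights of subgraphs -/

section

variable {n : ℕ} {G : SimpleGraph (Fin n)}

open Classical in
/-- The weight function, extended by zero to all pairs of vertices. -/
noncomputable def extendCost (cost : G.edgeSet → ℕ) (e : Sym2 (Fin n)) : ℕ :=
  if h : e ∈ G.edgeSet then cost ⟨e, h⟩ else 0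

theorem edgeWeight_extendCost (cost : G.edgeSet → ℕ) (H : G.Subgraph) :
    edgeWeight (extendCost cost) H = subgraphWeight cost H := by
  classical
  unfold edgeWeight subgraphWeight
  rw [← Finset.sum_coe_sort]
  refine Fintype.sum_equiv (Equiv.subtypeEquivRight fun e => by simp) _ _ ?_
  rintro ⟨e, he⟩
  have he' : e ∈ G.edgeSet := H.edgeSet_subset (by simpa using he)
  simp [extendCost, he']

/-- Justifies the choice of `B` as one more than the sum of all matrix entries: no subgraph is that
heavy. -/
theorem edgeWeight_le_sum (w : Sym2 (Fin n) → ℕ) (H : G.Subgraph) :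
    edgeWeight w H ≤ ∑ u, ∑ v, weightMatrix G w u v := by
  classical
  have h : ∀ e : Sym2 (Fin n), ∃ p : Fin n × Fin n, e = s(p.1, p.2) := fun e => by
    induction e with
    | _ u v => exact ⟨(u, v), rfl⟩
  choose f hf using h
  rw [← Finset.sum_product']
  have hinj : Set.InjOn f (H.edgeSet.toFinset : Set (Sym2 (Fin n))) := by
    intro e _ e' _ h
    rw [hf e, hf e', h]
  calc edgeWeight w H ≤ ∑ e ∈ H.edgeSet.toFinset, weightMatrix G w (f e).1 (f e).2 := by
        refine Finset.sum_le_sum fun e he => ?_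
        have : G.Adj (f e).1 (f e).2 := by
          have h1 := H.edgeSet_subset (Set.mem_toFinset.1 he)
          rw [hf e] at h1
          exact h1
        rw [weightMatrix, if_pos this, ← hf e]
        exact Nat.le_succ _
    _ = ∑ p ∈ H.edgeSet.toFinset.image f, weightMatrix G w p.1 p.2 := by
        rw [Finset.sum_image hinj]
    _ ≤ _ := Finset.sum_le_sum_of_subset (by simp)

theorem connects_of_connected {w : Sym2 (Fin n) → ℕ} {K : Finset (Fin n)} {H : G.Subgraph}
    (h : H.Connected) (hK : ∀ v ∈ K, v ∈ H.verts) : Connects G w K (edgeWeight w H) := by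
  refine ⟨⟨H.verts, H.Adj, fun h => h.ne, fun h => H.edge_vert h, H.symm⟩, ⟨h.coe⟩, hK,
    fun u v h => H.adj_sub h, edgeWeight_mono fun _ _ h => h⟩

/-- The tree that is found has minimum weight. -/
theorem answerGraph_isMinSteinerTree (hn : 0 < n) {cost : G.edgeSet → ℕ} {K S : Finset (Fin n)}
    (hcut : IsMultiwayCut G K S) {B c : ℕ}
    (hc : treeWeight B K S (weightMatrix G (extendCost cost)) = c) (hcB : c < B) :
    IsMinSteinerTree G cost K (answerGraph G (prune G (extendCost cost) B K S c (n * n))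
      (prune_anti (Nat.zero_le _)) K) := by
  obtain ⟨h1, h2⟩ := prune_isTree hn hcut hc hcB
  refine ⟨⟨h1, fun v hv => Or.inl hv⟩, fun H hH hK => ?_⟩
  rw [← edgeWeight_extendCost, ← edgeWeight_extendCost]
  exact h2.trans (hc ▸ treeWeight_le hcut le_rfl (connects_of_connected hH hK))

theorem not_exists_steinerTree {cost : G.edgeSet → ℕ} {K S : Finset (Fin n)}
    (hcut : IsMultiwayCut G K S) {B : ℕ}
    (hB : ∑ u, ∑ v, weightMatrix G (extendCost cost) u v < B)
    (hc : B ≤ treeWeight B K S (weightMatrix G (extendCost cost))) :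
    ¬ ∃ T : G.Subgraph, IsSteinerTree G K T := by
  rintro ⟨T, hT, hK⟩
  have h1 := treeWeight_le (B := B) hcut le_rfl
    (connects_of_connected (w := extendCost cost) ⟨hT.1⟩ hK)
  have h2 := edgeWeight_le_sum (extendCost cost) T
  omega

end

/-! ### The main program. -/

namespace LogRAM

open LogRAM.Cmd LogRAM.Expr in
/-- Deletes the edge with the number in array `3`, unless it is needed. -/
def pruneCmd : Cmd :=
  (set 1 (rd (.arr 0) 0 1)).seq <|
  (set 0 (ite (((((idx 0).times dim).plus (idx 1)).same (Expr.const 3)).plus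
    ((((idx 1).times dim).plus (idx 0)).same (Expr.const 3))) (lit 0) (rd (.arr 0) 0 1))).seq <|
  evalCmd.seq <|
  (set 0 (ite ((Expr.const 12).same (Expr.const 2)) (rd (.arr 0) 0 1) (rd (.arr 1) 0 1))).seq <|
  set 3 ((Expr.const 3).plus (lit 1))

open LogRAM.Cmd LogRAM.Expr in
/-- Computes a minimum Steiner tree: its adjacency matrix in array `7`, its vertices in array `8`, and
whether it exists in array `9`. -/
def mainCmd : Cmd :=
  (set 4 ((lit 1).plus (rd .inM 2 3).total.total)).seq <|
  (set 5 ((rd .inS 2 2).total.plus (lit 3))).seq <|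
  (set 6 (ite (rd .inS 0 0)
    ((lit 1).plus ((rd .inS 2 2).times ((idx 2).less (idx 0))).total) (lit 0))).seq <|
  (set 0 (rd .inM 0 1)).seq <|
  evalCmd.seq <|
  (set 2 (Expr.const 12)).seq <|
  (set 3 (lit 0)).seq <|
  -- One round for each of the `n * n` ordered pairs of vertices, numbered by array `3`.
  (forN (forN pruneCmd)).seq <|
  (set 7 (ite (rd (.arr 0) 0 1) (lit 1) (lit 0))).seq <|
  (set 8 (ite (((rd .inK 1 1).plus (rd (.arr 0) 2 1).total).plus
    (((rd .inK 2 2).total.plus (rd (.arr 0) 2 3).total.total).no.times (idx 1).no))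
      (lit 1) (lit 0))).seq <|
  set 9 ((Expr.const 2).less (Expr.const 4))

section

variable {n cap N B : ℕ} {G : SimpleGraph (Fin n)} {w : Sym2 (Fin n) → ℕ} {K S : Finset (Fin n)}

theorem weightMatrix_le {F : SimpleGraph (Fin n)} (hF : F ≤ G) (u v : Fin n) :
    weightMatrix F w u v ≤ weightMatrix G w u v := by
  unfold weightMatrix
  by_cases h : F.Adj u v
  · rw [if_pos h, if_pos (hF h)]
  · rw [if_neg h]; exact Nat.zero_le _

theorem weightMatrix_le_sum (u v : Fin n) :
    weightMatrix G w u v ≤ ∑ x, ∑ y, weightMatrix G w x y :=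
  (Finset.single_le_sum (f := fun y => weightMatrix G w u y) (fun _ _ => Nat.zero_le _)
    (Finset.mem_univ v)).trans
    (Finset.single_le_sum (f := fun x => ∑ y, weightMatrix G w x y) (fun _ _ => Nat.zero_le _)
      (Finset.mem_univ u))

@[simp] theorem weightMatrix_eq_zero {u v : Fin n} : weightMatrix G w u v = 0 ↔ ¬ G.Adj u v := by
  unfold weightMatrix
  split_ifs with h <;> simp [h]

theorem weightMatrix_cutPair (m : ℕ) (u v : Fin n) : weightMatrix (cutPair G m) w u v =
    if (if (u : ℕ) * n + v = m then 1 else 0) + (if (v : ℕ) * n + u = m then 1 else 0) = 0 then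
      weightMatrix G w u v else 0 := by
  unfold weightMatrix
  simp only [cutPair]
  by_cases h1 : (u : ℕ) * n + v = m <;> by_cases h2 : (v : ℕ) * n + u = m <;>
    by_cases h3 : G.Adj u v <;> simp [h1, h2, h3]

theorem treeWeight_le_bound (C : Fin n → Fin n → ℕ) : treeWeight B K S C ≤ B := by
  refine (Guess.best_le_init _ _).trans ?_
  split_ifs <;> omega

theorem pruneCmd_sem (hN : N = (S.card + 3) ^ (6 * S.card)) (hf : Fits n cap N B) {E : Env n}
    (h : Context B K S E) {c m : ℕ} (hB : ∀ u v, weightMatrix G w u v ≤ B) (hm : m < n * n)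
    (h0 : E (.arr 0) = weightMatrix (prune G w B K S c m) w) (h2 : E (.arr 2) = fun _ _ => c)
    (h3 : E (.arr 3) = fun _ _ => m) :
    Context B K S (pruneCmd.sem cap N E) ∧
    (pruneCmd.sem cap N E) (.arr 0) = weightMatrix (prune G w B K S c (m + 1)) w ∧
    (pruneCmd.sem cap N E) (.arr 2) = (fun _ _ => c) ∧
    (pruneCmd.sem cap N E) (.arr 3) = fun _ _ => m + 1 := by
  have hBc := hf.bound_le
  have hsq := hf.sq
  set F := prune G w B K S c m with hF
  have hFB : ∀ F' ≤ G, ∀ u v, weightMatrix F' w u v ≤ B := fun F' h u v =>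
    (weightMatrix_le h u v).trans (hB u v)
  have hFG : F ≤ G := prune_anti (Nat.zero_le m)
  have hcG : cutPair F m ≤ G := (cutPair_le _ _).trans hFG
  unfold pruneCmd
  simp only [Cmd.sem_seq]
  rw [Cmd.sem_set 1 (weightMatrix F w)]
  rotate_left
  · intro i j; simp [h0]
  · intro i j; exact (hFB F hFG i j).trans hBc
  set E₁ := E.set 1 (weightMatrix F w) with hE₁
  rw [show Cmd.sem cap N (Cmd.set 0 _) E₁ = E₁.set 0 (weightMatrix (cutPair F m) w) from
    Cmd.sem_set 0 _ (fun i j => by simp [hE₁, h0, h3, weightMatrix_cutPair])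
      (fun i j => (hFB _ hcG i j).trans hBc)]
  set E₂ := E₁.set 0 (weightMatrix (cutPair F m) w) with hE₂
  have hctx₂ : Context B K S E₂ := by
    refine ⟨?_, ?_, ?_, ?_, ?_⟩
    · simp [hE₂, hE₁, h.terminals]
    · simp [hE₂, hE₁, h.cut]
    · simp [hE₂, hE₁, h.bound]
    · simp [hE₂, hE₁, h.base]
    · simp [hE₂, hE₁, h.slot]
  have hev := evalCmd_sem hN hf hctx₂ (C := weightMatrix (cutPair F m) w) (by simp [hE₂])
    (hFB _ hcG)
  have hag : E₂.Agree 10 (evalCmd.sem cap N E₂) :=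
    Cmd.agree_sem _ _ (by simp [evalCmd, guessCmd, stepCmd, shortestCmd, Cmd.From])
  have hctx₃ := hctx₂.agree (by omega) hag
  have a0 : (evalCmd.sem cap N E₂) (.arr 0) = weightMatrix (cutPair F m) w := by
    rw [hag.2.2.2 0 (by omega)]; simp [hE₂]
  have a1 : (evalCmd.sem cap N E₂) (.arr 1) = weightMatrix F w := by
    rw [hag.2.2.2 1 (by omega)]; simp [hE₂, hE₁]
  have a2 : (evalCmd.sem cap N E₂) (.arr 2) = fun _ _ => c := by
    rw [hag.2.2.2 2 (by omega)]; simp [hE₂, hE₁, h2]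
  have a3 : (evalCmd.sem cap N E₂) (.arr 3) = fun _ _ => m := by
    rw [hag.2.2.2 3 (by omega)]; simp [hE₂, hE₁, h3]
  generalize evalCmd.sem cap N E₂ = E₃ at *
  rw [Cmd.sem_set 0 (weightMatrix (prune G w B K S c (m + 1)) w),
    Cmd.sem_set 3 fun _ _ => m + 1]
  · refine ⟨⟨?_, ?_, ?_, ?_, ?_⟩, ?_, ?_, ?_⟩
    · simp [hctx₃.terminals]
    · simp [hctx₃.cut]
    · simp [hctx₃.bound]
    · simp [hctx₃.base]
    · simp [hctx₃.slot]
    all_goals simp [a2]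
  · simp [a3]
  · intro _ _; omega
  · intro i j
    rw [prune, ← hF]
    by_cases hc : treeWeight B K S (weightMatrix (cutPair F m) w) = c
    · simp [hev, a0, a2, hc]
    · simp [hev, a1, a2, hc]
  · intro i j; exact (hFB _ (prune_anti (Nat.zero_le _)) i j).trans hBc

open Classical in
theorem mainCmd_sem (hN : N = (S.card + 3) ^ (6 * S.card)) (hf : Fits n cap N B)
    (hB : B = 1 + ∑ u, ∑ v, weightMatrix G w u v) {c : ℕ}
    (hc : c = treeWeight B K S (weightMatrix G w)) {E : Env n} (hM : E .inM = weightMatrix G w)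
    (hK : E .inK = fun _ v => indic K v) (hS : E .inS = fun _ v => indic S v) :
    (mainCmd.sem cap N E) (.arr 7) =
      (fun u v => if (prune G w B K S c (n * n)).Adj u v then 1 else 0) ∧
    (mainCmd.sem cap N E) (.arr 8) = (fun _ v => if v ∈ (answerGraph G (prune G w B K S c (n * n))
      (prune_anti (Nat.zero_le _)) K).verts then 1 else 0) ∧
    (mainCmd.sem cap N E) (.arr 9) = fun _ _ => if c < B then 1 else 0 := by
  have hBc := hf.bound_le
  have hn := hf.card
  have hcard : S.card ≤ n := by simpa using Finset.card_le_univ S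
  have hMB : ∀ u v, weightMatrix G w u v ≤ B := fun u v => by
    have := weightMatrix_le_sum (G := G) (w := w) u v
    omega
  unfold mainCmd
  simp only [Cmd.sem_seq]
  set E₁ := Cmd.sem cap N (Cmd.set 0 (Expr.rd .inM 0 1)) _ with hE₁
  have hE₁' : E₁ = (((E.set 4 fun _ _ => B).set 5 fun _ _ => S.card + 3).set 6
      fun v _ => slotIndex S v).set 0 (weightMatrix G w) := by
    rw [hE₁, Cmd.sem_set 4 fun _ _ => B, Cmd.sem_set 5 fun _ _ => S.card + 3,
      Cmd.sem_set 6 fun v _ => slotIndex S v, Cmd.sem_set 0 (weightMatrix G w)]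
    · simp [hM]
    · intro _ _; exact (hMB _ _).trans hBc
    · intro v _
      have h : ∀ x : Fin n, (if x < v then indic S x else 0) =
          indic (S.filter (· < v)) x := by
        intro x
        by_cases h1 : x ∈ S <;> by_cases h2 : x < v <;>
          simp [indic, h1, h2]
      by_cases hv : v ∈ S <;> simp [hS, slotIndex, hv, indic_eq_zero, h, sum_indic]
    · intro _ _; exact (slotIndex_le _ _).trans (by omega)
    · intro _ _; simp [hS, sum_indic]
    · intro _ _; omega
    · intro _ _; simp [hM, hB]
    · intro _ _; exact hBc
  clear_value E₁
  have hctx₁ : Context B K S E₁ := by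
    subst hE₁'
    exact ⟨by simp [hK], by simp [hS], by simp, by simp, by simp⟩
  have hev := evalCmd_sem hN hf hctx₁ (C := weightMatrix G w) (by simp [hE₁']) hMB
  have hag : E₁.Agree 10 (evalCmd.sem cap N E₁) :=
    Cmd.agree_sem _ _ (by simp [evalCmd, guessCmd, stepCmd, shortestCmd, Cmd.From])
  have hctx₂ := hctx₁.agree (by omega) hag
  have a0 : (evalCmd.sem cap N E₁) (.arr 0) = weightMatrix G w := by
    rw [hag.2.2.2 0 (by omega)]; simp [hE₁']
  rw [← hc] at hev
  generalize evalCmd.sem cap N E₁ = E₂ at *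
  have hcB : c ≤ B := hc ▸ treeWeight_le_bound _
  rw [Cmd.sem_set 2 fun _ _ => c]
  rotate_left
  · simp [hev]
  · intro _ _; exact hcB.trans hBc
  rw [Cmd.sem_set 3 fun _ _ => 0]
  rotate_left
  · simp
  · simp
  set E₃ := (E₂.set 2 fun _ _ => c).set 3 fun _ _ => 0 with hE₃
  have hctx₃ : Context B K S E₃ := ⟨by simp [hE₃, hctx₂.terminals], by simp [hE₃, hctx₂.cut],
    by simp [hE₃, hctx₂.bound], by simp [hE₃, hctx₂.base], by simp [hE₃, hctx₂.slot]⟩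
  have hit : (Cmd.forN (Cmd.forN pruneCmd)).sem cap N E₃ = (pruneCmd.sem cap N)^[n * n] E₃ := by
    rw [Function.iterate_mul]; rfl
  rw [hit]
  have hloop : ∀ m ≤ n * n, Context B K S ((pruneCmd.sem cap N)^[m] E₃) ∧
      ((pruneCmd.sem cap N)^[m] E₃) (.arr 0) = weightMatrix (prune G w B K S c m) w ∧
      ((pruneCmd.sem cap N)^[m] E₃) (.arr 2) = (fun _ _ => c) ∧
      ((pruneCmd.sem cap N)^[m] E₃) (.arr 3) = fun _ _ => m := by
    intro m
    induction m with
    | zero => exact fun _ => ⟨hctx₃, by simp [hE₃, a0, prune], by simp [hE₃], by simp [hE₃]⟩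
    | succ m ih =>
      intro hm
      obtain ⟨h1, h2, h3, h4⟩ := ih (by omega)
      rw [Function.iterate_succ_apply']
      exact pruneCmd_sem hN hf h1 hMB (by omega) h2 h3 h4
  obtain ⟨h1, h2, h3, -⟩ := hloop (n * n) le_rfl
  generalize (pruneCmd.sem cap N)^[n * n] E₃ = E₄ at *
  set F := prune G w B K S c (n * n) with hF
  have hbot : F = ⊥ ↔ ∀ u v, ¬ F.Adj u v :=
    ⟨fun h u v => by simp [h], fun h => by ext u v; simp [h u v]⟩
  rw [Cmd.sem_set 7 fun u v => if F.Adj u v then 1 else 0]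
  rotate_left
  · simp [h2]
  · intro _ _; split_ifs <;> omega
  rw [Cmd.sem_set 8 fun _ v => if v ∈ (answerGraph G F (prune_anti (Nat.zero_le _)) K).verts
    then 1 else 0]
  rotate_left
  · intro _ v
    have hiff : v ∈ (answerGraph G F (prune_anti (Nat.zero_le _)) K).verts ↔
        v ∈ K ∨ (∃ u, F.Adj u v) ∨ (K = ∅ ∧ F = ⊥) ∧ v.1 = 0 := Iff.rfl
    simp only [hiff, hbot]
    by_cases b1 : v ∈ K
    · simp [h1.terminals, h2, b1, indic]
    · by_cases b2 : ∃ u, F.Adj u v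
      · simp [h1.terminals, h2, b1, b2, indic]
      · by_cases b3 : K = ∅ <;> by_cases b4 : ∀ u v, ¬ F.Adj u v <;> by_cases b5 : v.1 = 0 <;>
          simp [h1.terminals, h2, b1, b2, b3, b4, b5, indic]
  · intro _ _; split_ifs <;> omega
  rw [Cmd.sem_set 9 fun _ _ => if c < B then 1 else 0]
  · simp [hF]
  · simp [h3, h1.bound]
  · intro _ _; split_ifs <;> omega

end
end LogRAM

/-! ## Reading the input and writing the output -/

section

variable {n : ℕ}

theorem flatMap_finRange_eq_ofFn {α : Type*} (f : Fin n → Fin n → α) :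
    ((List.finRange n).flatMap fun u => (List.finRange n).map fun v => f u v) =
      List.ofFn fun k : Fin (n * n) => f k.divNat k.modNat := by
  rw [List.ofFn_mul, List.flatMap, ← List.ofFn_eq_map]
  congr 1
  congr 1
  funext i
  rw [← List.ofFn_eq_map]
  congr 1
  funext j
  have hj := j.2
  have hn : 0 < n := by omega
  congr 1
  · ext
    simp [Fin.divNat, mul_comm (i : ℕ) n, Nat.mul_add_div hn, Nat.div_eq_of_lt hj]
  · ext
    simp [Fin.modNat, Nat.mod_eq_of_lt hj]

theorem map_finRange_getElem? {α : Type*} (f : Fin n → α) (v : Fin n) :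
    ((List.finRange n).map f)[v.1]? = some (f v) := by
  rw [List.getElem?_eq_getElem (by simp)]
  simp

theorem flatMap_finRange_getElem? {α : Type*} (f : Fin n → Fin n → α) (u v : Fin n) :
    ((List.finRange n).flatMap fun u => (List.finRange n).map fun v => f u v)[u.1 * n + v.1]? =
      some (f u v) := by
  have h1 := Nat.mul_le_mul_right n (show u.1 + 1 ≤ n from u.2)
  have hv := v.2
  have hn : 0 < n := by omega
  rw [Nat.add_mul, one_mul] at h1
  rw [flatMap_finRange_eq_ofFn, List.getElem?_eq_getElem (by simp; omega), List.getElem_ofFn]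
  congr 2
  · ext
    simp [Fin.divNat, mul_comm (u : ℕ) n, Nat.mul_add_div hn, Nat.div_eq_of_lt hv]
  · ext
    simp [Fin.modNat, Nat.mod_eq_of_lt hv]

theorem length_flatMap_finRange {α : Type*} (f : Fin n → Fin n → α) :
    ((List.finRange n).flatMap fun u => (List.finRange n).map fun v => f u v).length = n * n := by
  rw [flatMap_finRange_eq_ofFn, List.length_ofFn]

theorem length_encodeSet (X : Set (Fin n)) : (encodeSet X).length = n := by
  simp [encodeSet]

variable {G : SimpleGraph (Fin n)}

theorem length_encodeInstance (cost : G.edgeSet → ℕ) (K S : Finset (Fin n)) :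
    (encodeInstance G cost K S).length = 1 + n * n + n + n := by
  rw [encodeInstance, List.length_append, List.length_append, List.length_append,
    length_flatMap_finRange, length_encodeSet, length_encodeSet]
  rfl

open Classical in
theorem weightMatrix_extendCost (cost : G.edgeSet → ℕ) (u v : Fin n) :
    weightMatrix G (extendCost cost) u v =
      if h : G.Adj u v then cost ⟨s(u, v), h⟩ + 1 else 0 := by
  unfold weightMatrix extendCost
  by_cases h : G.Adj u v
  · simp [h]
  · simp [h]

theorem encodeInstance_eq (cost : G.edgeSet → ℕ) (K S : Finset (Fin n)) :
    encodeInstance G cost K S = [n] ++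
      ((List.finRange n).flatMap fun u => (List.finRange n).map fun v =>
        weightMatrix G (extendCost cost) u v) ++
      (List.finRange n).map (indic K) ++ (List.finRange n).map (indic S) := by
  have h : ∀ X : Finset (Fin n), encodeSet (X : Set (Fin n)) = (List.finRange n).map (indic X) := by
    intro X
    unfold encodeSet
    congr 1
    funext v
    simp [indic]
  rw [encodeInstance, h, h]
  simp only [weightMatrix_extendCost]

theorem encodeInstance_getElem? (cost : G.edgeSet → ℕ) (K S : Finset (Fin n)) :
    (encodeInstance G cost K S)[0]? = some n ∧
    (∀ u v : Fin n, (encodeInstance G cost K S)[1 + u.1 * n + v.1]? =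
      some (weightMatrix G (extendCost cost) u v)) ∧
    (∀ v : Fin n, (encodeInstance G cost K S)[n * n + 1 + v.1]? = some (indic K v)) ∧
    ∀ v : Fin n, (encodeInstance G cost K S)[n * n + n + 1 + v.1]? = some (indic S v) := by
  rw [encodeInstance_eq]
  have hl := length_flatMap_finRange fun u v => weightMatrix G (extendCost cost) u v
  have hM := flatMap_finRange_getElem? fun u v => weightMatrix G (extendCost cost) u v
  generalize ((List.finRange n).flatMap fun u => (List.finRange n).map fun v =>
        weightMatrix G (extendCost cost) u v) = l at *
  refine ⟨by simp, fun u v => ?_, fun v => ?_, fun v => ?_⟩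
  · have h1 := Nat.mul_le_mul_right n (show u.1 + 1 ≤ n from u.2)
    have hv := v.2
    rw [Nat.add_mul, one_mul] at h1
    rw [List.getElem?_append_left (by simp [hl]; omega),
      List.getElem?_append_left (by simp [hl]; omega),
      List.getElem?_append_right (by simp; omega), ← hM u v]
    congr 1
    simp; omega
  · have hv := v.2
    rw [List.getElem?_append_left (by simp [hl]; omega),
      List.getElem?_append_right (by simp [hl]), ← map_finRange_getElem? (indic K) v]
    congr 1
    simp [hl]
  · have hv := v.2
    rw [List.getElem?_append_right (by simp [hl]), ← map_finRange_getElem? (indic S) v]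
    congr 1
    simp [hl]

theorem mem_encodeInstance {cost : G.edgeSet → ℕ} {K S : Finset (Fin n)} {a : ℕ}
    (h : a ∈ encodeInstance G cost K S) :
    a = n ∨ (∃ u v, a = weightMatrix G (extendCost cost) u v) ∨ a ≤ 1 := by
  rw [encodeInstance_eq] at h
  simp only [List.mem_append, List.mem_singleton, List.mem_flatMap, List.mem_map] at h
  rcases h with ((h | ⟨u, -, v, -, h⟩) | ⟨v, -, h⟩) | ⟨v, -, h⟩
  · exact Or.inl h
  · exact Or.inr (Or.inl ⟨u, v, h.symm⟩)
  · exact Or.inr (Or.inr (h ▸ indic_le_one K v))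
  · exact Or.inr (Or.inr (h ▸ indic_le_one S v))

open Classical in
theorem outputs_encodeSubgraph {T : G.Subgraph} {s : LogRAM.State} (h0 : s.mem 0 = 1)
    (hv : ∀ v : Fin n, s.mem (1 + v) = if v ∈ T.verts then 1 else 0)
    (hadj : ∀ u v : Fin n, s.mem (1 + n + u * n + v) = if T.Adj u v then 1 else 0) :
    LogRAM.Outputs s (encodeSubgraph T) := by
  intro i hi
  have hlen : (encodeSubgraph T).length = 1 + n + n * n := by
    rw [encodeSubgraph, List.length_append, List.length_append, length_flatMap_finRange,
      length_encodeSet]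
    rfl
  rw [hlen] at hi
  suffices (encodeSubgraph T)[i]? = some (s.mem i) by
    rw [List.getElem?_eq_getElem (by omega)] at this
    exact (Option.some.inj this).symm
  unfold encodeSubgraph
  have hl := length_encodeSet T.verts
  rcases Nat.lt_or_ge i 1 with h | h
  · obtain rfl : i = 0 := by omega
    simp [h0]
  rcases Nat.lt_or_ge i (1 + n) with h' | h'
  · obtain ⟨v, rfl⟩ : ∃ v : Fin n, i = 1 + v := ⟨⟨i - 1, by omega⟩, by simp; omega⟩
    rw [List.getElem?_append_left (by simp [hl]; omega), List.getElem?_append_right (by simp), hv]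
    simp [encodeSet]
  · have hn : 0 < n := by
      rcases Nat.eq_zero_or_pos n with h0 | h0
      · subst h0; omega
      · exact h0
    obtain ⟨u, v, rfl⟩ : ∃ u v : Fin n, i = 1 + n + u * n + v := by
      refine ⟨⟨(i - (1 + n)) / n, ?_⟩, ⟨(i - (1 + n)) % n, Nat.mod_lt _ hn⟩, ?_⟩
      · rw [Nat.div_lt_iff_lt_mul hn]; omega
      · have := Nat.div_add_mod' (i - (1 + n)) n
        simp only; omega
    rw [List.getElem?_append_right (by simp [hl]; omega), hadj,
      ← flatMap_finRange_getElem? (fun u v => if T.Adj u v then 1 else 0) u v]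
    congr 1
    simp [hl]; omega

end

/-! ## Bounds in terms of the length of the input -/

namespace LogRAM

theorem size_le_inputSize {w : List ℕ} {a : ℕ} (h : a ∈ w) : Nat.size a ≤ inputSize w := by
  have : Nat.size a + 1 ≤ (w.map fun a => Nat.size a + 1).sum :=
    List.le_sum_of_mem (List.mem_map_of_mem (f := fun a => Nat.size a + 1) h)
  unfold inputSize
  omega

theorem length_le_inputSize (w : List ℕ) : w.length ≤ inputSize w := by
  induction w with
  | nil => simp
  | cons a w ih =>
    simp only [inputSize, List.length_cons, List.map_cons, List.sum_cons] at *
    omega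

/-- Maximum nesting depth of loops over guesses. -/
def Cmd.guessDepth : Cmd → ℕ
  | set _ _ => 0
  | seq c₁ c₂ => max c₁.guessDepth c₂.guessDepth
  | forN c => c.guessDepth
  | forG c => c.guessDepth + 1

/-- A loop over guesses contributes no factor here; `Cmd.steps_le` accounts for it by a power of `N`
with exponent `Cmd.guessDepth`. -/
noncomputable def Cmd.stepsPoly : Cmd → Polynomial ℕ
  | set _ e => (.X * (.X * (e.steps + 18) + 9) + 5) + (.X * (.X * 26 + 9) + 5)
  | seq c₁ c₂ => c₁.stepsPoly + c₂.stepsPoly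
  | forN c => .X * (c.stepsPoly + 3) + 3
  | forG c => c.stepsPoly + 6

theorem Cmd.steps_le {n N : ℕ} (hN : 1 ≤ N) (c : Cmd) :
    c.steps n N ≤ c.stepsPoly.eval n * N ^ c.guessDepth := by
  have hpos : ∀ k, 1 ≤ N ^ k := fun k => Nat.one_le_pow _ _ hN
  induction c with
  | set a e =>
    simp only [steps, stepsPoly, guessDepth, pow_zero, mul_one, Polynomial.eval_add,
      Polynomial.eval_mul, Polynomial.eval_X, Polynomial.eval_ofNat]
    exact le_rfl
  | seq c₁ c₂ h₁ h₂ =>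
    simp only [steps, stepsPoly, guessDepth, Polynomial.eval_add, Nat.add_mul]
    exact Nat.add_le_add
      (h₁.trans (Nat.mul_le_mul_left _ (Nat.pow_le_pow_right hN (le_max_left _ _))))
      (h₂.trans (Nat.mul_le_mul_left _ (Nat.pow_le_pow_right hN (le_max_right _ _))))
  | forN c ih =>
    simp only [steps, stepsPoly, guessDepth, Polynomial.eval_add, Polynomial.eval_mul,
      Polynomial.eval_X, Polynomial.eval_ofNat]
    have h := hpos c.guessDepth
    generalize N ^ c.guessDepth = M at *
    have h1 : n * (steps n N c + 3) ≤ n * ((c.stepsPoly.eval n + 3) * M) :=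
      Nat.mul_le_mul_left n (by rw [Nat.add_mul]; omega)
    calc _ = n * (steps n N c + 3) + 3 := by ring
      _ ≤ n * ((c.stepsPoly.eval n + 3) * M) + 3 * M := Nat.add_le_add h1 (by omega)
      _ = _ := by ring
  | forG c ih =>
    simp only [steps, stepsPoly, guessDepth, Polynomial.eval_add, Polynomial.eval_ofNat]
    have h := hpos c.guessDepth
    rw [pow_succ]
    generalize N ^ c.guessDepth = M at *
    have h1 : N * (steps n N c + 3) ≤ N * ((c.stepsPoly.eval n + 3) * M) :=
      Nat.mul_le_mul_left N (by rw [Nat.add_mul]; omega)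
    have h2 : 1 ≤ M * N := Nat.mul_pos h hN
    calc _ = N * (steps n N c + 3) + 3 := by ring
      _ ≤ N * ((c.stepsPoly.eval n + 3) * M) + 3 * (M * N) := Nat.add_le_add h1 (by omega)
      _ = _ := by ring

theorem _root_.Polynomial.eval_nat_mono (p : Polynomial ℕ) {m n : ℕ} (h : m ≤ n) :
    p.eval m ≤ p.eval n := by
  rw [Polynomial.eval_eq_sum, Polynomial.eval_eq_sum]
  exact Finset.sum_le_sum fun i _ => Nat.mul_le_mul_left _ (Nat.pow_le_pow_left h i)

/-- A bound on the number of guesses. -/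
theorem guesses_le (s : ℕ) : (((s + 3) ^ (6 * s) : ℕ) : ℝ) ≤
    4096 * (2 : ℝ) ^ (((18 : ℕ) : ℝ) * ((s : ℝ) * Real.logb 2 (s : ℝ))) := by
  -- For `s = 0, 1` the exponent on the right vanishes and `4 ^ 6 = 4096` is needed. From `s = 2`
  -- on, `s + 3 ≤ s ^ 3` turns `6 * s` into the exponent `18 * s`.
  rcases Nat.lt_or_ge s 2 with h | h
  · interval_cases s <;> norm_num
  · have h1 : s + 3 ≤ s ^ 3 := by nlinarith [Nat.mul_le_mul h h]
    have h2 : (s + 3) ^ (6 * s) ≤ s ^ (18 * s) := by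
      calc (s + 3) ^ (6 * s) ≤ (s ^ 3) ^ (6 * s) := Nat.pow_le_pow_left h1 _
        _ = s ^ (18 * s) := by rw [← pow_mul]; congr 1; ring
    have h3 : (2 : ℝ) ^ (((18 : ℕ) : ℝ) * ((s : ℝ) * Real.logb 2 (s : ℝ))) =
        ((s ^ (18 * s) : ℕ) : ℝ) := by
      have hs : (0 : ℝ) < s := by exact_mod_cast (by omega : 0 < s)
      rw [show ((18 : ℕ) : ℝ) * ((s : ℝ) * Real.logb 2 (s : ℝ)) =
        Real.logb 2 (s : ℝ) * ((18 * s : ℕ) : ℝ) by push_cast; ring,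
        Real.rpow_mul (by norm_num), Real.rpow_logb (by norm_num) (by norm_num) hs,
        Real.rpow_natCast]
      push_cast; rfl
    rw [h3]
    have h4 : (((s + 3) ^ (6 * s) : ℕ) : ℝ) ≤ ((s ^ (18 * s) : ℕ) : ℝ) := by exact_mod_cast h2
    have h5 : (0 : ℝ) ≤ ((s ^ (18 * s) : ℕ) : ℝ) := Nat.cast_nonneg _
    linarith

/-- An upper bound on all numbers that are stored. -/
def capOf (n N W : ℕ) : ℕ := N * (4 * ((W + n + 2) * (W + n + 2)))

theorem fits_capOf {n N W : ℕ} (hN : 1 ≤ N) : Fits n (capOf n N W) N (1 + W) := by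
  have h1 : 1 * (4 * ((W + n + 2) * (W + n + 2))) ≤ capOf n N W := Nat.mul_le_mul_right _ hN
  have h2 : N * 1 ≤ capOf n N W := Nat.mul_le_mul_left _ (by nlinarith)
  refine ⟨?_, by omega, ?_, ?_⟩ <;> nlinarith

/-- As `s ≤ n ≤ l`, the number of guesses has about `6 * l * (l + 2)` bits. It is exponential in the
input, but its length is polynomial, and so is that of the weights. -/
theorem size_capOf_le {n s W l : ℕ} (hs : s ≤ n) (hn : n ≤ l) (hW : W ≤ n * n * 2 ^ l) :
    Nat.size (capOf n ((s + 3) ^ (6 * s)) W) ≤ 6 * l * (l + 2) + 6 * l + 7 := by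
  have hl : l + 3 ≤ 2 ^ (l + 2) := by
    have := (l + 2).lt_two_pow_self
    omega
  have hl' : l < 2 ^ l := l.lt_two_pow_self
  have h1 : (s + 3) ^ (6 * s) ≤ 2 ^ (6 * l * (l + 2)) := by
    calc (s + 3) ^ (6 * s) ≤ (2 ^ (l + 2)) ^ (6 * s) := Nat.pow_le_pow_left (by omega) _
      _ = 2 ^ (6 * s * (l + 2)) := by rw [← pow_mul]; congr 1; ring
      _ ≤ _ := Nat.pow_le_pow_right (by norm_num)
        (Nat.mul_le_mul_right _ (Nat.mul_le_mul_left _ (hs.trans hn)))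
  have h2 : W + n + 2 ≤ 2 ^ (3 * l + 2) := by
    have h3 : n * n ≤ 2 ^ l * 2 ^ l := Nat.mul_le_mul (by omega) (by omega)
    have h4 : W ≤ 2 ^ l * 2 ^ l * 2 ^ l := hW.trans (Nat.mul_le_mul_right _ h3)
    have h5 : 2 ^ (3 * l + 2) = 4 * (2 ^ l * 2 ^ l * 2 ^ l) := by ring
    have h6 : 1 ≤ 2 ^ l := Nat.one_le_two_pow
    have h7 : 2 ^ l ≤ 2 ^ l * 2 ^ l * 2 ^ l := by nlinarith
    rw [h5]
    omega
  rw [Nat.size_le]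
  calc capOf n ((s + 3) ^ (6 * s)) W
      ≤ 2 ^ (6 * l * (l + 2)) * (4 * (2 ^ (3 * l + 2) * 2 ^ (3 * l + 2))) :=
        Nat.mul_le_mul h1 (Nat.mul_le_mul_left _ (Nat.mul_le_mul h2 h2))
    _ = 2 ^ (6 * l * (l + 2) + 6 * l + 6) := by rw [pow_add, pow_add]; ring
    _ < _ := Nat.pow_lt_pow_right (by norm_num) (by omega)

theorem sum_weightMatrix_le {n : ℕ} {G : SimpleGraph (Fin n)} (cost : G.edgeSet → ℕ)
    (K S : Finset (Fin n)) : ∑ u, ∑ v, weightMatrix G (extendCost cost) u v ≤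
      n * n * 2 ^ inputSize (encodeInstance G cost K S) := by
  have h : ∀ u v, weightMatrix G (extendCost cost) u v ≤
      2 ^ inputSize (encodeInstance G cost K S) := by
    intro u v
    have hm := List.mem_of_getElem? ((encodeInstance_getElem? cost K S).2.1 u v)
    exact (Nat.size_le.1 (size_le_inputSize hm)).le
  calc _ ≤ ∑ _u : Fin n, ∑ _v : Fin n, 2 ^ inputSize (encodeInstance G cost K S) :=
        Finset.sum_le_sum fun u _ => Finset.sum_le_sum fun v _ => h u v
    _ = _ := by simp [mul_assoc]

end LogRAM

/-! ### Preparing the registers and presenting the answer. -/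

namespace LogRAM

theorem Holds.setReg {n : ℕ} {E : Env n} {ρ : ℕ → Fin n} {s : State} (h : Holds n E ρ s) {x : ℕ}
    (hx : 2 ≤ x) (hx' : x < 9 ∨ x = 11) (v : ℕ) : Holds n E ρ (s.setReg x v) := by
  refine ⟨?_, ?_, ?_, fun d => ?_, h.mem⟩
  · rw [State.setReg_reg, if_neg (by omega), h.dim]
  · rw [State.setReg_reg, if_neg (by omega), h.one]
  · rw [State.setReg_reg, if_neg (by omega), h.zero]
  · rw [State.setReg_reg, if_neg (by unfold ixr; omega), h.ix]

/-- `|S| + 3` -/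
def baseExpr : Expr := (Expr.rd .inS 0 0).total.plus (Expr.lit 3)

/-- The sixth power of `|S| + 3`; `powerCode` raises it to the power `|S|` by repeated
multiplication. -/
def powExpr : Expr :=
  ((baseExpr.times baseExpr).times baseExpr).times ((baseExpr.times baseExpr).times baseExpr)

def rootExpr : Expr := (((Expr.rd .inM 0 1).total.total).plus Expr.dim).plus (Expr.lit 2)

def capExpr : Expr := (Expr.lit 4).times (rootExpr.times rootExpr)

/-- The number of guesses. -/
def powerCode : Prog :=
  (block [Instr.const 1 1]).seq <|
  (powExpr.comp 0 0).seq <|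
  (block [Instr.copy 4 (slot 0)]).seq <|
  ((Expr.rd .inS 0 0).total.comp 0 0).seq <|
  (block [Instr.const 2 1]).seq <|
  Prog.loop (slot 0) (block [Instr.mul 2 2 4, Instr.sub (slot 0) (slot 0) 1])

def capCode : Prog := (capExpr.comp 0 0).seq (block [Instr.mul 3 2 (slot 0)])

/-- Presents the answer. -/
def outputCode : Prog :=
  ((Expr.const 9).comp 0 0).seq <|
  (block [Instr.copy 6 (slot 0)]).seq <|
  -- Parameters `10` and `9` refer to arrays `8` and `7`. Of the copy of array `8` only the first
  -- row, the vertex vector, persists: the adjacency matrix overwrites everything from cell `n + 1`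
  -- on. Finally register `9`, which is always zero, addresses cell `0`.
  (copyArray 0 0 0 2 10).seq <|
  (copyArray 0 1 0 2 9).seq <|
  block [Instr.store 9 6]

def steinerProg : Prog :=
  (block [Instr.load 0 0]).seq <|
  -- Without vertices there is no tree, and cell `0` already holds the answer `0`.
  Prog.ite 0 (powerCode.seq <| capCode.seq <| (mainCmd.comp 0).seq outputCode) Prog.skip

/-- A bound on the sizes of all expressions and commands of the program. -/
def codeSize : ℕ := mainCmd.sz + powExpr.sz + capExpr.sz + 100

def limitsOf (n v : ℕ) : Limits := ⟨codeSize * v, 2 * codeSize + 100, (codeSize * n + 2) * n + 1⟩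

section

variable {n v cap N : ℕ} {K S : Finset (Fin n)} {E : Env n}

/-- Slot `0` counts down from `|S|`, register `4` holds the factor and register `2` the product.
Every intermediate product is at most `N`, so it fits into the registers. -/
theorem runs_powerCode (hn0 : 0 < n) (hv : 1 ≤ v) (hn : n < 2 ^ v) (hE : ∀ a i j, E a i j < 2 ^ v)
    (hN : N = (S.card + 3) ^ (6 * S.card)) (hNv : N < 2 ^ v) (hS : E .inS = fun _ v => indic S v)
    {s : State} (hs : s.Within (limitsOf n v)) (h : Holds n E (fun _ => ⟨0, hn0⟩) (s.setReg 1 1)) :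
    ∃ s', Runs (limitsOf n v) powerCode s s' (2 + powExpr.steps.eval n + 2 +
      (Expr.rd .inS 0 0).total.steps.eval n + 2 + (n * 4 + 1)) ∧
      Holds n E (fun _ => ⟨0, hn0⟩) s' ∧ s'.reg 2 = N := by
  have hsz : 100 ≤ codeSize := by unfold codeSize; omega
  have hbits : ∀ m, m < 2 ^ v → m < 2 ^ (limitsOf n v).bits := fun m hm =>
    hm.trans_le (Nat.pow_le_pow_right (by norm_num) (Nat.le_mul_of_pos_left _ (by omega)))
  have hone : 1 < 2 ^ (limitsOf n v).bits := hbits 1 (by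
    calc 1 < 2 ^ 1 := by norm_num
      _ ≤ 2 ^ v := Nat.pow_le_pow_right (by norm_num) hv)
  have hregs : ∀ x, x < 100 → x < (limitsOf n v).regs := fun x hx => by
    simp only [limitsOf]; omega
  have hcard : S.card ≤ n := by simpa using Finset.card_le_univ S
  have r1 := runs_block (L := limitsOf n v) (is := [Instr.const 1 1]) hs
    ⟨⟨hregs 1 (by omega), hone⟩, trivial⟩
  simp only [runBlock, Instr.run, List.length_cons, List.length_nil] at r1
  obtain ⟨s₂, r2, v2, f2⟩ := powExpr.runs_comp hn0 hv hn hE 0 0 (fun _ => ⟨0, hn0⟩) _ r1.1 h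
    (fun _ _ => rfl) (Nat.mul_le_mul_right _ (by unfold codeSize; omega))
    (by simp only [limitsOf]; unfold codeSize; omega)
  have h2 := h.frame f2
  have r3 := runs_block (L := limitsOf n v) (is := [Instr.copy 4 (slot 0)]) r2.1
    ⟨hregs 4 (by omega), trivial⟩
  simp only [runBlock, Instr.run, List.length_cons, List.length_nil] at r3
  have h3 := h2.setReg (x := 4) (by omega) (by omega) (s₂.reg (slot 0))
  have v3 : (s₂.setReg 4 (s₂.reg (slot 0))).reg 4 = (S.card + 3) ^ 6 := by
    simp [v2, powExpr, baseExpr, hS, sum_indic]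
    ring
  generalize s₂.setReg 4 (s₂.reg (slot 0)) = s₃ at *
  obtain ⟨s₄, r4, v4, f4⟩ := (Expr.rd .inS 0 0).total.runs_comp hn0 hv hn hE 0 0
    (fun _ => ⟨0, hn0⟩) s₃ r3.1 h3
    (fun _ _ => rfl) (Nat.mul_le_mul_right _ (by
      simp only [Expr.total, Expr.sz, Src.c1, Src.c2]; unfold codeSize; omega))
    (by simp only [limitsOf, Expr.total, Expr.sz, Src.c1, Src.c2]; omega)
  have h4 := h3.frame f4
  have v4' : s₄.reg 4 = (S.card + 3) ^ 6 := by rw [f4.reg 4 (by simp), v3]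
  have v4'' : s₄.reg (slot 0) = S.card := by
    rw [v4]; simp [hS, sum_indic]
  have r5 := runs_block (L := limitsOf n v) (is := [Instr.const 2 1]) r4.1
    ⟨⟨hregs 2 (by omega), hone⟩, trivial⟩
  simp only [runBlock, Instr.run, List.length_cons, List.length_nil] at r5
  set I : ℕ → State → Prop := fun j s => j ≤ S.card ∧ Holds n E (fun _ => ⟨0, hn0⟩) s ∧
    s.reg 4 = (S.card + 3) ^ 6 ∧ s.reg 2 = ((S.card + 3) ^ 6) ^ (S.card - j) with hI
  obtain ⟨s₆, r6, ⟨-, h6, -, v6⟩, -⟩ := Runs.countdown (L := limitsOf n v) (x := slot 0)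
    (P := block [Instr.mul 2 2 4, Instr.sub (slot 0) (slot 0) 1]) (T := 3) I (by
      rintro j s hs ⟨hj, hh, h4, h2⟩ hx
      have hprod : ((S.card + 3) ^ 6) ^ (S.card - (j + 1)) * (S.card + 3) ^ 6 =
          ((S.card + 3) ^ 6) ^ (S.card - j) := by
        rw [← pow_succ]; congr 1; omega
      have hle : ((S.card + 3) ^ 6) ^ (S.card - j) ≤ N := by
        rw [hN, pow_mul]
        exact Nat.pow_le_pow_right (Nat.pos_of_ne_zero (by positivity)) (by omega)
      refine ⟨_, runs_block hs ⟨⟨hregs 2 (by omega), ?_⟩, hregs _ (by unfold slot; omega), trivial⟩,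
        ⟨by omega, ?_, ?_, ?_⟩, ?_⟩
      · rw [h2, h4, hprod]
        exact hbits _ (hle.trans_lt hNv)
      · exact (hh.setReg (by omega) (by omega) _).setReg (by unfold slot; omega)
          (by unfold slot; omega) _
      · simp [runBlock, Instr.run, slot, h4]
      · simp [runBlock, Instr.run, slot, h4, h2, hprod]
      · simp [runBlock, Instr.run, slot, hh.one] at hx ⊢
        omega) S.card (s₄.setReg 2 1) r5.1
    ⟨le_rfl, h4.setReg (by omega) (by omega) _, by simp [v4'], by simp⟩
    (by simp [slot] at v4'' ⊢; exact v4'')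
  refine ⟨s₆, ?_, h6, ?_⟩
  · refine (r1.seq (r2.seq (r3.seq (r4.seq (r5.seq r6))))).mono ?_
    have := Nat.mul_le_mul_right 4 hcard
    omega
  · rw [v6, hN, Nat.sub_zero, pow_mul]

theorem runs_capCode (hn0 : 0 < n) (hv : 1 ≤ v) (hn : n < 2 ^ v) (hE : ∀ a i j, E a i j < 2 ^ v)
    {W : ℕ} (hW : ∑ i, ∑ j, E .inM i j = W) (hcap : capOf n N W < 2 ^ v)
    {s : State} (hs : s.Within (limitsOf n v)) (h : Holds n E (fun _ => ⟨0, hn0⟩) s)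
    (h2 : s.reg 2 = N) :
    ∃ s', Runs (limitsOf n v) capCode s s' (capExpr.steps.eval n + 2) ∧
      Holds' n (capOf n N W) N E s' := by
  have hsz : 100 ≤ codeSize := by unfold codeSize; omega
  obtain ⟨s₂, r2, v2, f2⟩ := capExpr.runs_comp hn0 hv hn hE 0 0 (fun _ => ⟨0, hn0⟩) _ hs h
    (fun _ _ => rfl) (Nat.mul_le_mul_right _ (by unfold codeSize; omega))
    (by simp only [limitsOf]; unfold codeSize; omega)
  have hh := h.frame f2
  have hval : s₂.reg 2 * s₂.reg (slot 0) = capOf n N W := by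
    rw [f2.reg 2 (by simp), h2, v2, capOf]
    simp [capExpr, rootExpr, hW]
  have r3 := runs_block (L := limitsOf n v) (is := [Instr.mul 3 2 (slot 0)]) r2.1
    ⟨⟨by simp only [limitsOf]; omega, by
      rw [hval]
      exact hcap.trans_le (Nat.pow_le_pow_right (by norm_num)
        (Nat.le_mul_of_pos_left _ (by omega)))⟩, trivial⟩
  refine ⟨_, r2.seq r3, ?_⟩
  have hh' := hh.setReg (x := 3) (by omega) (by omega) (s₂.reg 2 * s₂.reg (slot 0))
  refine ⟨hh'.dim, hh'.one, hh'.zero, fun x => (hh'.ix x), ?_, ?_, hh'.mem⟩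
  · simp [runBlock, Instr.run, f2.reg 2 (by simp), h2]
  · simp [runBlock, Instr.run, hval]

theorem runs_outputCode (hn0 : 0 < n) (hv : 1 ≤ v) (hn : n < 2 ^ v) (hE : ∀ a i j, E a i j < 2 ^ v)
    {s : State} (hs : s.Within (limitsOf n v)) (h : Holds' n cap N E s) :
    ∃ s', Runs (limitsOf n v) outputCode s s' ((Expr.const 9).steps.eval n + 2 +
      (n * (n * 26 + 9) + 5) + (n * (n * 26 + 9) + 5) + 2) ∧
      s'.mem 0 = E (.arr 9) ⟨0, hn0⟩ ⟨0, hn0⟩ ∧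
      (∀ v : Fin n, s'.mem (1 + v) = E (.arr 8) ⟨0, hn0⟩ v) ∧
      ∀ u v : Fin n, s'.mem (1 + n + u * n + v) = E (.arr 7) u v := by
  have hsz : 100 ≤ codeSize := by unfold codeSize; omega
  have hh : Holds n E (fun _ => ⟨0, hn0⟩) s := ⟨h.dim, h.one, h.zero, h.ix, h.mem⟩
  obtain ⟨s₁, r1, v1, f1⟩ := (Expr.const 9).runs_comp hn0 hv hn hE 0 0 (fun _ => ⟨0, hn0⟩) _ hs hh
    (fun _ _ => rfl) (Nat.mul_le_mul_right _ (by
      simp only [Expr.const, Expr.sz, Src.c1, Src.c2]; omega))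
    (by simp only [limitsOf, Expr.const, Expr.sz, Src.c1, Src.c2]; omega)
  have h1 := hh.frame f1
  have r2 := runs_block (L := limitsOf n v) (is := [Instr.copy 6 (slot 0)]) r1.1
    ⟨show 6 < 2 * codeSize + 100 by omega, trivial⟩
  simp only [runBlock, Instr.run, List.length_cons, List.length_nil] at r2
  have h2 := h1.setReg (x := 6) (by omega) (by omega) (s₁.reg (slot 0))
  have v2 : (s₁.setReg 6 (s₁.reg (slot 0))).reg 6 = E (.arr 9) ⟨0, hn0⟩ ⟨0, hn0⟩ := by
    simp [v1]
  generalize s₁.setReg 6 (s₁.reg (slot 0)) = s₂ at *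
  have hmul : ∀ i : Fin n, (i : ℕ) * n + n ≤ n * n := fun i => by
    have := Nat.mul_le_mul_right n (show (i : ℕ) + 1 ≤ n from i.2)
    rwa [Nat.add_mul, one_mul] at this
  have hcell : ∀ c ≤ 1, ∀ i j : Fin n, addr n c 0 n i j < (limitsOf n v).cells := by
    intro c hc i j
    have h1 := hmul i
    have h2 := j.2
    have h3 : c * n ≤ 1 * n := Nat.mul_le_mul_right n hc
    have h4 : n * n ≤ codeSize * (n * n) := Nat.le_mul_of_pos_left _ (by omega)
    simp only [addr, limitsOf]
    ring_nf at *
    omega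
  have hdisj : ∀ c ≤ 1, ∀ a, ∀ i j i' j' : Fin n,
      addr n 2 (a + 2) n i j ≠ addr n c 0 n i' j' := by
    intro c hc a i j i' j'
    have h1 := hmul i'
    have h2 := j'.2
    have h3 : c * n ≤ 1 * n := Nat.mul_le_mul_right n hc
    simp only [addr]
    ring_nf at *
    omega
  have hb : ∀ c, c ≤ 100 → c * v ≤ (limitsOf n v).bits := fun c hc =>
    Nat.mul_le_mul_right _ (by omega)
  obtain ⟨s₃, r3, f3, m3, m3'⟩ := runs_copyArray (k := 0) (c1 := 0) (c2 := 0) (d1 := 2) (d2 := 10)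
    hn0 hv hn (hb _ (by omega)) (hb _ (by omega)) (by simp only [limitsOf]; omega)
    (hcell 0 (by omega)) (hdisj 0 (by omega) 8) r2.1 h2.dim h2.one (h2.ix 0) (h2.ix 1)
  obtain ⟨s₄, r4, f4, m4, m4'⟩ := runs_copyArray (k := 0) (c1 := 1) (c2 := 0) (d1 := 2) (d2 := 9)
    hn0 hv hn (hb _ (by omega)) (hb _ (by omega)) (by simp only [limitsOf]; omega)
    (hcell 1 (by omega)) (hdisj 1 (by omega) 7) r3.1 (by rw [f3 0 (by simp), h2.dim])
    (by rw [f3 1 (by unfold slot; omega), h2.one])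
    (by rw [f3 (ixr 0) (by unfold ixr; omega)]; exact h2.ix 0)
    (by rw [f3 (ixr 1) (by unfold ixr; omega)]; exact h2.ix 1)
  have z4 : s₄.reg 9 = 0 := by
    rw [f4 9 (by unfold slot; omega), f3 9 (by unfold slot; omega), h2.zero]
  have v4 : s₄.reg 6 = E (.arr 9) ⟨0, hn0⟩ ⟨0, hn0⟩ := by
    rw [f4 6 (by simp), f3 6 (by simp), v2]
  have r5 := runs_block (L := limitsOf n v) (is := [Instr.store 9 6]) r4.1
    ⟨by show s₄.reg 9 < _; rw [z4]; simp only [limitsOf]; omega, trivial⟩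
  simp only [runBlock, Instr.run, List.length_cons, List.length_nil, z4] at r5
  refine ⟨_, (r1.seq (r2.seq (r3.seq (r4.seq r5)))).mono (by omega), ?_, fun x => ?_, fun x y => ?_⟩
  · simp [v4]
  · have hx := x.2
    have e1 : 1 + (x : ℕ) = addr n 0 0 n (⟨0, hn0⟩ : Fin n) x := by simp [addr]
    rw [State.setMem_mem, if_neg (by omega), m4' _ (fun i j => by simp only [addr]; omega), e1, m3]
    exact h2.mem (.arr 8) _ _
  · have e1 : 1 + n + (x : ℕ) * n + y = addr n 1 0 n x y := by simp only [addr]; ring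
    rw [State.setMem_mem, if_neg (by omega), e1, m4,
      m3' _ (fun i j => hdisj 0 (by omega) 7 x y i j)]
    exact h2.mem (.arr 7) _ _

end

end LogRAM

/-! ### Correctness and resources of the whole program. -/

namespace LogRAM

/-- A bound on the number of steps of the program, divided by the number of guesses. -/
noncomputable def progPoly : Polynomial ℕ :=
  powExpr.steps + (Expr.rd .inS 0 0).total.steps + capExpr.steps + (Expr.const 9).steps +
    mainCmd.stepsPoly + (4 * .X + (.X * (.X * 26 + 9) + 5) + (.X * (.X * 26 + 9) + 5) + 20)

/-- The arrays at the beginning. -/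
noncomputable def inputEnv {n : ℕ} (M : Fin n → Fin n → ℕ) (K S : Finset (Fin n)) : Env n
  | .arr _ => fun _ _ => 0
  | .inM => M
  | .inK => fun _ v => indic K v
  | .inS => fun _ v => indic S v

section

variable {n : ℕ} {G : SimpleGraph (Fin n)} (cost : G.edgeSet → ℕ) (K S : Finset (Fin n))

theorem start_mem (w : List ℕ) (i : ℕ) : (start w).mem i = w[i]?.getD 0 := by
  simp [start, List.toFinsupp_apply]

theorem holds_start (hn0 : 0 < n) : Holds n
    (inputEnv (weightMatrix G (extendCost cost)) K S) (fun _ => ⟨0, hn0⟩)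
    (((start (encodeInstance G cost K S)).setReg 0 n).setReg 1 1) := by
  obtain ⟨-, hM, hK, hS⟩ := encodeInstance_getElem? cost K S
  refine ⟨by simp, by simp, by simp [start], fun x => ?_, fun a i j => ?_⟩
  · rw [State.setReg_reg, if_neg (by unfold ixr; omega), State.setReg_reg,
      if_neg (by unfold ixr; omega)]
    rfl
  · rw [State.setReg_mem, State.setReg_mem, start_mem]
    cases a with
    | arr b =>
      have h : (encodeInstance G cost K S).length ≤
          addr n (Src.arr b).c1 (Src.arr b).c2 ((Src.arr b).stride n) i j := by
        rw [length_encodeInstance]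
        simp only [addr, Src.c1, Src.c2, Src.stride]
        ring_nf
        omega
      rw [List.getElem?_eq_none h]
      rfl
    | inM =>
      have h : addr n Src.inM.c1 Src.inM.c2 (Src.inM.stride n) i j = 1 + i * n + j := by
        simp [addr, Src.c1, Src.c2, Src.stride]
      rw [h, hM]; rfl
    | inK =>
      have h : addr n Src.inK.c1 Src.inK.c2 (Src.inK.stride n) i j = n * n + 1 + j := by
        simp [addr, Src.c1, Src.c2, Src.stride]
      rw [h, hK]; rfl
    | inS =>
      have h : addr n Src.inS.c1 Src.inS.c2 (Src.inS.stride n) i j = n * n + n + 1 + j := by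
        simp only [addr, Src.c1, Src.c2, Src.stride]; ring
      rw [h, hS]; rfl

theorem within_start {v : ℕ} (hn : n < 2 ^ v) (hv : 1 ≤ v)
    (hM : ∀ i j, weightMatrix G (extendCost cost) i j < 2 ^ v) :
    (start (encodeInstance G cost K S)).Within (limitsOf n v) := by
  have hsz : 100 ≤ codeSize := by unfold codeSize; omega
  have hbits : ∀ m, m < 2 ^ v → m < 2 ^ (limitsOf n v).bits := fun m hm =>
    hm.trans_le (Nat.pow_le_pow_right (by norm_num) (Nat.le_mul_of_pos_left _ (by omega)))
  have hone : 1 < 2 ^ v := by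
    calc 1 < 2 ^ 1 := by norm_num
      _ ≤ 2 ^ v := Nat.pow_le_pow_right (by norm_num) hv
  refine ⟨fun i => ?_, fun i _ => rfl, fun a => ?_, fun a ha => ?_⟩
  · exact hbits _ (by simp [start])
  · rw [start_mem]
    refine hbits _ ?_
    rcases h : (encodeInstance G cost K S)[a]? with _ | b
    · simp
    · rcases mem_encodeInstance (List.mem_of_getElem? h) with h | ⟨i, j, h⟩ | h
      · simpa [h] using hn
      · simpa [h] using hM i j
      · simp only [Option.getD_some]; omega
  · rw [start_mem, List.getElem?_eq_none]
    · rfl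
    · rw [length_encodeInstance]
      refine le_trans ?_ ha
      have h1 : n * n ≤ codeSize * (n * n) := Nat.le_mul_of_pos_left _ (by omega)
      simp only [limitsOf]
      ring_nf at *
      omega

/-- The length `v` of the cap bounds the lengths of `n` and of all array entries, and `limitsOf`
allows a constant multiple of it for intermediate values. -/
theorem steinerProg_correct (hcut : IsMultiwayCut G K S) {N W v : ℕ}
    (hN : N = (S.card + 3) ^ (6 * S.card))
    (hW : W = ∑ i, ∑ j, weightMatrix G (extendCost cost) i j) (hv : v = Nat.size (capOf n N W)) :
    ∃ s, Runs (limitsOf n v) steinerProg (start (encodeInstance G cost K S)) s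
      (progPoly.eval n * N) ∧ IsCorrectAnswer G cost K s := by
  have hN1 : 1 ≤ N := hN ▸ Nat.one_le_pow _ _ (by omega)
  have hf := fits_capOf (n := n) (W := W) hN1
  have hcap : capOf n N W < 2 ^ v := hv ▸ Nat.lt_size_self _
  have hcard := hf.card
  have hsz : 100 ≤ codeSize := by unfold codeSize; omega
  have hv1 : 1 ≤ v := by
    rw [hv, Nat.succ_le_iff, Nat.size_pos]; omega
  have hnv : n < 2 ^ v := by omega
  have hB := hf.bound_le
  have hMv : ∀ i j, weightMatrix G (extendCost cost) i j < 2 ^ v := fun i j => by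
    have := weightMatrix_le_sum (G := G) (w := extendCost cost) i j
    omega
  have hs := within_start cost K S hnv hv1 hMv
  have h0 : (start (encodeInstance G cost K S)).mem 0 = n := by
    rw [start_mem, (encodeInstance_getElem? cost K S).1]; rfl
  have hbits : ∀ m, m < 2 ^ v → m < 2 ^ (limitsOf n v).bits := fun m hm =>
    hm.trans_le (Nat.pow_le_pow_right (by norm_num) (Nat.le_mul_of_pos_left _ (by omega)))
  have r0 := runs_block (L := limitsOf n v) (is := [Instr.load 0 0]) hs
    ⟨show 0 < 2 * codeSize + 100 by omega, trivial⟩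
  have hreg0 : (start (encodeInstance G cost K S)).reg 0 = 0 := rfl
  simp only [runBlock, Instr.run, List.length_cons, List.length_nil, hreg0, h0] at r0
  have hsteps : progPoly.eval n ≤ progPoly.eval n * N := Nat.le_mul_of_pos_right _ hN1
  rcases Nat.eq_zero_or_pos n with hn0 | hn0
  · have r1 : Runs (limitsOf n v) (Prog.ite 0 (powerCode.seq <| capCode.seq <|
        (mainCmd.comp 0).seq outputCode) Prog.skip)
        ((start (encodeInstance G cost K S)).setReg 0 n) _ (1 + 1) :=
      Runs.ite r0.1 (fun h => absurd hn0 (by simpa using h)) (fun _ => Runs.skip r0.1)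
    refine ⟨_, (r0.seq r1).mono (le_trans ?_ hsteps), Or.inr ⟨?_, ?_⟩⟩
    · unfold progPoly
      simp only [Polynomial.eval_add, Polynomial.eval_ofNat]
      omega
    · rintro ⟨T, hT, -⟩
      obtain ⟨x⟩ := hT.1.nonempty
      exact absurd x.1.2 (by omega)
    · intro i hi
      have hi0 : i = 0 := by simpa using hi
      subst hi0
      simp [h0, hn0]
  set E := inputEnv (weightMatrix G (extendCost cost)) K S with hE
  have hEv : ∀ a i j, E a i j < 2 ^ v := by
    intro a i j
    have h1 : 1 < 2 ^ v := by omega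
    cases a with
    | arr b => exact Nat.pos_of_ne_zero (by positivity)
    | inM => exact hMv i j
    | inK => exact (indic_le_one K j).trans_lt h1
    | inS => exact (indic_le_one S j).trans_lt h1
  obtain ⟨s₁, r1, h1, g1⟩ := runs_powerCode hn0 hv1 hnv hEv hN (hf.guesses.trans_lt hcap) rfl r0.1
    (holds_start cost K S hn0)
  obtain ⟨s₂, r2, h2⟩ := runs_capCode (N := N) hn0 hv1 hnv hEv (W := W) hW.symm hcap r1.1 h1 g1
  obtain ⟨s₃, r3, h3, -⟩ := mainCmd.runs_comp hn0 hv1 hnv hcap 0 E s₂ hEv r2.1 h2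
    (Nat.mul_le_mul_right _ (by unfold codeSize; omega))
    (by simp only [limitsOf]; unfold codeSize; omega)
    (by
      have h1 : mainCmd.sz * n ≤ codeSize * n := Nat.mul_le_mul_right _ (by unfold codeSize; omega)
      have h2 := Nat.mul_le_mul_right n (Nat.add_le_add_right h1 2)
      simp only [limitsOf]
      omega)
  obtain ⟨s₄, r4, o0, ov, oe⟩ := runs_outputCode hn0 hv1 hnv
    (mainCmd.sem_lt hcap E hEv) r3.1 h3
  obtain ⟨m7, m8, m9⟩ := mainCmd_sem (w := extendCost cost) (c := treeWeight (1 + W) K S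
    (weightMatrix G (extendCost cost))) hN hf (by rw [hW]) rfl (E := E) rfl rfl rfl
  refine ⟨s₄, (r0.seq (Runs.ite r0.1 (fun _ => r1.seq (r2.seq (r3.seq r4)))
    (fun h => absurd h (by simpa using hn0.ne')))).mono ?_, ?_⟩
  · have hm := mainCmd.steps_le (n := n) hN1
    -- Loops over guesses are not nested in each other, so the number of guesses enters the running
    -- time only linearly.
    rw [show mainCmd.guessDepth = 1 from rfl, pow_one] at hm
    have hx := fun x : ℕ => Nat.le_mul_of_pos_right x hN1
    unfold progPoly
    simp only [Polynomial.eval_add, Polynomial.eval_mul, Polynomial.eval_X, Polynomial.eval_ofNat,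
      Nat.add_mul _ _ N]
    have h1 := hx (powExpr.steps.eval n)
    have h2 := hx ((Expr.rd .inS 0 0).total.steps.eval n)
    have h3 := hx (capExpr.steps.eval n)
    have h4 := hx ((Expr.const 9).steps.eval n)
    have h5 := hx (4 * n)
    have h6 := hx (n * (n * 26 + 9))
    have h7 : 5 ≤ 5 * N := hx 5
    have h8 : 20 ≤ 20 * N := hx 20
    omega
  · rw [m9] at o0
    rw [m8] at ov
    rw [m7] at oe
    -- Since `1 + W` exceeds the weight of every subgraph, this decides whether a Steiner tree
    -- exists, which is what array `9` records.
    by_cases hc : treeWeight (1 + W) K S (weightMatrix G (extendCost cost)) < 1 + W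
    · rw [if_pos hc] at o0
      exact Or.inl ⟨_, answerGraph_isMinSteinerTree hn0 hcut rfl hc,
        outputs_encodeSubgraph o0 ov oe⟩
    · rw [if_neg hc] at o0
      refine Or.inr ⟨not_exists_steinerTree hcut (B := 1 + W) (by omega) (not_lt.1 hc), ?_⟩
      intro i hi
      have hi0 : i = 0 := by simpa using hi
      subst hi0
      simpa using o0

end

/-- A bound on the length of the stored numbers, in terms of the length of the input. -/
noncomputable def lengthPoly : Polynomial ℕ := 6 * .X * (.X + 2) + 6 * .X + 7

noncomputable def timePoly : Polynomial ℕ :=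
  4096 * (progPoly * (1 + 2 * (Polynomial.C codeSize * lengthPoly)))

noncomputable def cellsPoly : Polynomial ℕ := (Polynomial.C codeSize * .X + 2) * .X + 1

noncomputable def spacePoly : Polynomial ℕ :=
  Polynomial.C (2 * codeSize + 100) *
    (Polynomial.C (2 * codeSize + 100) + Polynomial.C codeSize * lengthPoly) +
  cellsPoly * (cellsPoly + Polynomial.C codeSize * lengthPoly)

end LogRAM

theorem theorem1 :
    ∃ (P : LogRAM.Prog) (c : ℕ) (p q : Polynomial ℕ),
      ∀ (n : ℕ) (G : SimpleGraph (Fin n)) (cost : G.edgeSet → ℕ) (K S : Finset (Fin n)),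
        IsMultiwayCut G K S →
          ∃ (s : LogRAM.State) (time space : ℕ),
            LogRAM.Exec P (LogRAM.start (encodeInstance G cost K S)) s time space ∧
            IsCorrectAnswer G cost K s ∧
            (time : ℝ) ≤ (2 : ℝ) ^ ((c : ℝ) * ((S.card : ℝ) * Real.logb 2 (S.card : ℝ))) *
              ((p.eval (LogRAM.inputSize (encodeInstance G cost K S)) : ℕ) : ℝ) ∧
            space ≤ q.eval (LogRAM.inputSize (encodeInstance G cost K S)) := by
  -- The constant `18` comes from `guesses_le`; its factor `4096` is absorbed into `timePoly`.
  refine ⟨LogRAM.steinerProg, 18, LogRAM.timePoly, LogRAM.spacePoly, ?_⟩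
  intro n G cost K S hcut
  obtain ⟨s, ⟨-, t, m, hE, ht, hm⟩, hs⟩ := LogRAM.steinerProg_correct cost K S hcut rfl rfl rfl
  refine ⟨s, t, m, hE, hs, ?_⟩
  have hnl : n ≤ LogRAM.inputSize (encodeInstance G cost K S) := by
    refine le_trans ?_ (LogRAM.length_le_inputSize _)
    rw [length_encodeInstance]
    omega
  have hcard : S.card ≤ n := by simpa using Finset.card_le_univ S
  have hsize := LogRAM.size_capOf_le hcard hnl (LogRAM.sum_weightMatrix_le cost K S)
  generalize LogRAM.inputSize (encodeInstance G cost K S) = l at *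
  generalize ∑ i, ∑ j, weightMatrix G (extendCost cost) i j = W at *
  have hb : LogRAM.codeSize * Nat.size (LogRAM.capOf n ((S.card + 3) ^ (6 * S.card)) W) ≤
      LogRAM.codeSize * LogRAM.lengthPoly.eval l := by
    refine Nat.mul_le_mul_left _ ?_
    simpa [LogRAM.lengthPoly] using hsize
  generalize Nat.size (LogRAM.capOf n ((S.card + 3) ^ (6 * S.card)) W) = v at *
  constructor
  · have hg := LogRAM.guesses_le S.card
    generalize (S.card + 3) ^ (6 * S.card) = N at *
    have hp := LogRAM.progPoly.eval_nat_mono hnl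
    have h1 : t ≤ N * (LogRAM.progPoly.eval l *
        (1 + 2 * (LogRAM.codeSize * LogRAM.lengthPoly.eval l))) := by
      refine ht.trans ?_
      calc LogRAM.progPoly.eval n * N * (1 + 2 * (LogRAM.limitsOf n v).bits)
          ≤ LogRAM.progPoly.eval l * N * (1 + 2 * (LogRAM.codeSize * LogRAM.lengthPoly.eval l)) :=
            Nat.mul_le_mul (Nat.mul_le_mul_right _ hp) (by
              show 1 + 2 * (LogRAM.codeSize * v) ≤ _
              omega)
        _ = _ := by ring
    have h2 : LogRAM.timePoly.eval l = 4096 * (LogRAM.progPoly.eval l *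
        (1 + 2 * (LogRAM.codeSize * LogRAM.lengthPoly.eval l))) := by
      simp [LogRAM.timePoly]
    rw [h2]
    generalize LogRAM.progPoly.eval l * (1 + 2 * (LogRAM.codeSize * LogRAM.lengthPoly.eval l)) = A at *
    have h3 : (t : ℝ) ≤ (N : ℝ) * A := by exact_mod_cast h1
    refine h3.trans ((mul_le_mul_of_nonneg_right hg (Nat.cast_nonneg A)).trans (le_of_eq ?_))
    push_cast
    ring
  · have hc : (LogRAM.codeSize * n + 2) * n + 1 ≤ LogRAM.cellsPoly.eval l := by
      simp only [LogRAM.cellsPoly, Polynomial.eval_add, Polynomial.eval_mul, Polynomial.eval_C,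
        Polynomial.eval_X, Polynomial.eval_ofNat, Polynomial.eval_one]
      gcongr
    refine hm.trans ?_
    simp only [LogRAM.spacePoly, Polynomial.eval_add, Polynomial.eval_mul, Polynomial.eval_C]
    simp only [LogRAM.Limits.space, LogRAM.limitsOf]
    gcongr
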